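/- **Setting.** Let $\mathsf H$ be a finite-dimensional Hilbert space, $\langle\!\langle A|B\rangle\!\rangle=\mathrm{Tr}(A^\dagger B)$, and let $\mathcal L(x)$ be Lindbladians $$\mathcal L(\rho)=-i[H,\rho]+\tfrac12\sum_\ell\kappa_\ell\,(2F_\ell\rho F_\ell^\dagger-F_\ell^\dagger F_\ell\rho-\rho F_\ell^\dagger F_\ell),\qquad H=H^\dagger,\ \kappa_\ell>0,$$ depending on $x=(x_\alpha)$ in an open set $M\subseteq\mathbb R^m$; write $\partial_\alpha=\partial/\partial x_\alpha$. The asymptotic subspace $\mathrm{As}(x)$ is the span of the eigenmatrices of $\mathcal L(x)$ with purely imaginary eigenvalue. Assume that it is steady, $\mathcal L(x)\rho=0$ for all $\rho\in\mathrm{As}(x)$. The asymptotic projection $\mathcal P_\infty$ is the projection onto $\mathrm{As}(x)$ whose kernel is the common kernel of all conserved quantities, i.e. of the left eigenmatrices of $\mathcal L(x)$ with purely imaginary eigenvalue. Assume that $x\mapsto\mathcal P_\infty(x)$ is $C^1$ on $M$. Let $P(x)$ be the orthogonal projection onto the smallest subspace of $\mathsf H$ carrying all elements of $\mathrm{As}(x)$,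 put $A_{\rm ul}=PAP$, and define the minimal projection by $\mathcal P_\Psi(\rho)=\mathcal P_\infty(\rho_{\rm ul})$. Paths are $C^1$ maps $\gamma:[0,1]\to M$, with partial path $\gamma_s=\gamma|_{[0,s]}$ for $s\in[0,1]$; $\mathbb P\exp$ is the path-ordered exponential (later times to the left). **1. Conserved quantities.** For every basis $\{\Psi_\mu\}$ of $\mathrm{As}(x)$ there are unique $J^\mu$ with $\langle\!\langle J^\mu|\mathcal L(x)=0$ and $\langle\!\langle J^\mu|\Psi_\nu\rangle\!\rangle=\delta_{\mu\nu}$, and then $\mathcal P_\infty=\sum_\mu|\Psi_\mu\rangle\!\rangle\langle\!\langle J^\mu|$ and $\mathcal P_\Psi=\sum_\mu|\Psi_\mu\rangle\!\rangle\langle\!\langle J^\mu_{\rm ul}|$. **2. The connection only sees $J_{\rm ul}$.** Let $\Psi_\mu(x)$ be $C^1$ on $M$ and a basis of $\mathrm{As}(x)$ at each $x$, with dual conserved quantities $J^\mu(x)$ as in 1. The adiabatic connection satisfies $$\mathcal A_{\alpha,\mu\nu}:=\langle\!\langle J^\mu|\partial_\alpha\Psi_\nu\rangle\!\rangle=\langle\!\langle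 J^\mu_{\rm ul}|\partial_\alpha\Psi_\nu\rangle\!\rangle .$$ For every path and every $s\in[0,1]$, the operator holonomy $\mathcal U(s)=\mathbb P\exp\int_0^s\dot{\mathcal P}_\infty\mathcal P_\infty\,dr$ (the dot is the derivative along the path) and the coordinate holonomy $\mathcal B(s)=\mathbb P\exp\bigl(-\sum_\alpha\int_{\gamma_s}\mathcal A_\alpha\,dx_\alpha\bigr)$ are related by $\mathcal U(s)\Psi_\nu(\gamma(0))=\sum_\mu\mathcal B(s)_{\mu\nu}\Psi_\mu(\gamma(s))$. **3. The holonomy depends only on $\mathcal P_\Psi$.** If $\mathcal P_\Psi$ is also $C^1$ on $M$, then for every path, $s\in[0,1]$ and $\rho\in\mathrm{As}(\gamma(0))$, $$\mathcal U(s)\rho=\Bigl(\mathbb P\exp\int_0^s\dot{\mathcal P}_\Psi\mathcal P_\Psi\,dr\Bigr)\rho .$$ **4. Noiseless-subsystem blocks.** Suppose there are a reference space $\bigl(\bigoplus_\varkappa\mathbb C^{d_\varkappa}\otimes\mathbb C^{a_\varkappa}\bigr)\oplus\mathbb C^q$ (finitely many blocks $\varkappa$), $C^1$ unitaries $S(x)$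 from it to $\mathsf H$, and $C^1$ density matrices $\varrho_\varkappa(x)$ on $\mathbb C^{a_\varkappa}$ (of possibly varying rank) such that for all $x\in M$ $$\mathrm{As}(x)=\Bigl\{S(x)\Bigl[\bigoplus_\varkappa X_\varkappa\otimes\varrho_\varkappa(x)\oplus0\Bigr]S(x)^\dagger:\ X_\varkappa\in M_{d_\varkappa}(\mathbb C)\Bigr\}.$$ Let $\{\bar\Psi_{\varkappa\mu}\}_{\mu}$ be a fixed Hermitian orthonormal basis of $M_{d_\varkappa}(\mathbb C)$, $n_\varkappa=\sqrt{\mathrm{Tr}\,\varrho_\varkappa^2}$, $G_\alpha=iS^\dagger\partial_\alpha S$, let $\bar P_\varkappa$ be the identity of $\mathbb C^{d_\varkappa}$ and $P_{{\rm ax},\varkappa}(x)$ the projection onto the range of $\varrho_\varkappa(x)$, let $\mathrm{tr}_{{\rm ax},\varkappa}$ be the partial trace over $\mathbb C^{a_\varkappa}$ of the diagonal block $\varkappa$, and put $$\widetilde A^\varkappa_\alpha=\mathrm{tr}_{{\rm ax},\varkappa}\{(\bar P_\varkappa\otimes\varrho_\varkappa)G_\alpha\},\qquad \widetilde{\mathcal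 A}^\varkappa_{\alpha,\mu\nu}=\langle\!\langle\bar\Psi_{\varkappa\mu}|-i[\widetilde A^\varkappa_\alpha,\bar\Psi_{\varkappa\nu}]\rangle\!\rangle .$$ Then the following hold on $M$. (a) The $\Psi_{\varkappa\mu}=S(\bar\Psi_{\varkappa\mu}\otimes\varrho_\varkappa/n_\varkappa)S^\dagger$ form a basis of $\mathrm{As}(x)$; $\mathcal P_\Psi(\rho)=S\bigl[\bigoplus_\varkappa\mathrm{tr}_{{\rm ax},\varkappa}\{(\bar P_\varkappa\otimes P_{{\rm ax},\varkappa})S^\dagger\rho S\}\otimes\varrho_\varkappa\oplus 0\bigr]S^\dagger$; and each $\widetilde A^\varkappa_\alpha$ is Hermitian. (b) The connection in the basis $\Psi_{\varkappa\mu}$ is block diagonal and on the block $\varkappa$ equals $\widetilde{\mathcal A}^\varkappa_{\alpha,\mu\nu}-(\partial_\alpha\ln n_\varkappa)\,\delta_{\mu\nu}$. (c) Fix a path and $s\in[0,1]$. Then $U_\varkappa(s)=\mathbb P\exp\bigl(i\sum_\alpha\int_{\gamma_s}\widetilde A^\varkappa_\alpha dx_\alpha\bigr)$ and $\mathcal B^{\rm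 dfs}_\varkappa(s)=\mathbb P\exp\bigl(-\sum_\alpha\int_{\gamma_s}\widetilde{\mathcal A}^\varkappa_\alpha dx_\alpha\bigr)$ are unitary matrices with $\mathcal B^{\rm dfs}_\varkappa(s)_{\mu\nu}=\langle\!\langle\bar\Psi_{\varkappa\mu}|U_\varkappa(s)\bar\Psi_{\varkappa\nu}U_\varkappa(s)^\dagger\rangle\!\rangle$. The holonomy is $$\mathcal B(s)=\bigoplus_\varkappa\exp\Bigl(\sum_\alpha\int_{\gamma_s}\partial_\alpha\ln n_\varkappa\,dx_\alpha\Bigr)\mathcal B^{\rm dfs}_\varkappa(s),$$ where the exponential factor is $n_\varkappa(\gamma(s))/n_\varkappa(\gamma(0))$, and $\mathcal U(s)$ maps $S\bigl[\bigoplus_\varkappa X_\varkappa\otimes\varrho_\varkappa\oplus 0\bigr]S^\dagger$ at $\gamma(0)$ to $S\bigl[\bigoplus_\varkappa U_\varkappa(s)X_\varkappa U_\varkappa(s)^\dagger\otimes\varrho_\varkappa\oplus 0\bigr]S^\dagger$ at $\gamma(s)$. If the path is closed, then $\mathcal B(1)=\bigoplus_\varkappa\mathcal B^{\rm dfs}_\varkappa(1)$,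 which is unitary. (d) If $S$ and all $\varrho_\varkappa$ are $C^2$ on $M$, the curvature $\mathcal F_{\alpha\beta}=\partial_\alpha\mathcal A_\beta-\partial_\beta\mathcal A_\alpha+[\mathcal A_\alpha,\mathcal A_\beta]$ is $$\mathcal F_{\alpha\beta}=\bigoplus_\varkappa\bigl(\partial_\alpha\widetilde{\mathcal A}^\varkappa_\beta-\partial_\beta\widetilde{\mathcal A}^\varkappa_\alpha+[\widetilde{\mathcal A}^\varkappa_\alpha,\widetilde{\mathcal A}^\varkappa_\beta]\bigr),$$ and its block $\varkappa$ is the matrix of $-i[\widetilde F^\varkappa_{\alpha\beta},\cdot]$ in the basis $\{\bar\Psi_{\varkappa\mu}\}$, with $\widetilde F^\varkappa_{\alpha\beta}=\partial_\alpha\widetilde A^\varkappa_\beta-\partial_\beta\widetilde A^\varkappa_\alpha-i[\widetilde A^\varkappa_\alpha,\widetilde A^\varkappa_\beta]$. -/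

import Mathlib

open scoped Matrix Matrix.Norms.L2Operator Kronecker ComplexOrder

noncomputable section

namespace LindbladHolonomy

/-! ### Operators, superoperators and Lindbladians -/

/-- Superoperators on the space of operators of a finite-dimensional Hilbert space. -/
abbrev Superop (n : Type) [Fintype n] [DecidableEq n] : Type :=
  Matrix n n ℂ →L[ℂ] Matrix n n ℂ

/-- The Hilbert-Schmidt inner product `Tr (A† B)`. -/
def hs {n : Type} [Fintype n] (A B : Matrix n n ℂ) : ℂ := (Aᴴ * B).trace

/-- `𝓛 ρ = -i[H, ρ] + (1/2) ∑ κ (2 F ρ F† - F†F ρ - ρ F†F)` with a Hermitian Hamiltonian, finitely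
many jump operators and positive rates. -/
def IsLindbladian {n : Type} [Fintype n] [DecidableEq n] (𝓛 : Superop n) : Prop :=
  ∃ (r : ℕ) (H : Matrix n n ℂ) (F : Fin r → Matrix n n ℂ) (rate : Fin r → ℝ),
    H.IsHermitian ∧ (∀ l, 0 < rate l) ∧
    ∀ ρ : Matrix n n ℂ, 𝓛 ρ = -Complex.I • (H * ρ - ρ * H) +
      (1 / 2 : ℂ) • ∑ l, (rate l : ℂ) •
        ((2 : ℂ) • (F l * ρ * (F l)ᴴ) - (F l)ᴴ * F l * ρ - ρ * ((F l)ᴴ * F l))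

/-! ### The asymptotic subspace and its projections -/

/-- The asymptotic subspace: the span of all eigenmatrices with purely imaginary eigenvalue. -/
def asymptoticSubspace {n : Type} [Fintype n] [DecidableEq n] (𝓛 : Superop n) :
    Submodule ℂ (Matrix n n ℂ) :=
  ⨆ Δ : ℝ, Module.End.eigenspace (𝓛 : Matrix n n ℂ →ₗ[ℂ] Matrix n n ℂ) (Complex.I * (Δ : ℂ))

/-- The asymptotic subspace is steady: nothing in it evolves. -/
def IsSteady {n : Type} [Fintype n] [DecidableEq n] (𝓛 : Superop n) : Prop :=
  ∀ ρ ∈ asymptoticSubspace 𝓛, 𝓛 ρ = 0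

/-- The operators annihilated by every conserved quantity, that is, by every left eigenmatrix
`⟨⟨J| 𝓛 = iΔ ⟨⟨J|` with purely imaginary eigenvalue. -/
def conservedAnnihilator {n : Type} [Fintype n] [DecidableEq n] (𝓛 : Superop n) :
    Submodule ℂ (Matrix n n ℂ) where
  carrier := {ρ | ∀ (Δ : ℝ) (J : Matrix n n ℂ),
    (∀ σ, hs J (𝓛 σ) = Complex.I * (Δ : ℂ) * hs J σ) → hs J ρ = 0}
  add_mem' := by
    intro a b ha hb Δ J hJ
    have h1 := ha Δ J hJ
    have h2 := hb Δ J hJ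
    simp only [hs] at h1 h2 ⊢
    rw [Matrix.mul_add, Matrix.trace_add, h1, h2, add_zero]
  zero_mem' := by
    intro Δ J _
    simp [hs]
  smul_mem' := by
    intro c a ha Δ J hJ
    have h1 := ha Δ J hJ
    simp only [hs] at h1 ⊢
    rw [Matrix.mul_smul, Matrix.trace_smul, h1, smul_zero]

open Classical in
/-- The asymptotic projection `∑ |Ψ⟩⟩⟨⟨J|`: the projection onto the asymptotic subspace whose kernel
is the joint kernel of the conserved quantities. The two subspaces are complementary for every
Lindbladian. -/
def asymptoticProjection {n : Type} [Fintype n] [DecidableEq n] (𝓛 : Superop n) : Superop n :=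
  if h : IsCompl (asymptoticSubspace 𝓛) (conservedAnnihilator 𝓛) then
    LinearMap.toContinuousLinearMap (Submodule.projection _ _ h)
  else 0

/-- The matrix of the orthogonal projection onto a subspace. -/
def projMatrix {n : Type} [Fintype n] [DecidableEq n]
    (W : Submodule ℂ (EuclideanSpace ℂ n)) : Matrix n n ℂ :=
  Matrix.toEuclideanLin.symm (W.starProjection : EuclideanSpace ℂ n →ₗ[ℂ] EuclideanSpace ℂ n)

/-- The orthogonal projection onto the range of a matrix. -/
def rangeProj {n : Type} [Fintype n] [DecidableEq n] (A : Matrix n n ℂ) : Matrix n n ℂ :=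
  projMatrix (LinearMap.range (Matrix.toEuclideanLin A))

/-- The projection `P` onto the non-decaying subspace, the smallest subspace of the Hilbert space
that carries all asymptotic states. -/
def nonDecayingProj {n : Type} [Fintype n] [DecidableEq n] (𝓛 : Superop n) : Matrix n n ℂ :=
  projMatrix (⨆ ρ ∈ asymptoticSubspace 𝓛, LinearMap.range (Matrix.toEuclideanLin ρ))

/-- The upper-left corner `A ↦ P A P`. -/
def upperLeft {n : Type} [Fintype n] [DecidableEq n] (𝓛 : Superop n) : Superop n :=
  LinearMap.toContinuousLinearMap
    (LinearMap.mulLeft ℂ (nonDecayingProj 𝓛) ∘ₗ LinearMap.mulRight ℂ (nonDecayingProj 𝓛))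

/-- The minimal projection: the asymptotic projection after restriction to the upper-left corner. -/
def minimalProjection {n : Type} [Fintype n] [DecidableEq n] (𝓛 : Superop n) : Superop n :=
  asymptoticProjection 𝓛 * upperLeft 𝓛

/-- `Ψ` is a basis of the asymptotic subspace. -/
def IsSteadyBasis {n ι : Type} [Fintype n] [DecidableEq n]
    (𝓛 : Superop n) (Ψ : ι → Matrix n n ℂ) : Prop :=
  LinearIndependent ℂ Ψ ∧ Submodule.span ℂ (Set.range Ψ) = asymptoticSubspace 𝓛

/-- `J` consists of conserved quantities (`⟨⟨J^μ| 𝓛 = 0`) biorthogonal to the family `Ψ`. -/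
def IsConservedDual {n ι : Type} [Fintype n] [DecidableEq n] [DecidableEq ι]
    (𝓛 : Superop n) (Ψ J : ι → Matrix n n ℂ) : Prop :=
  (∀ μ σ, hs (J μ) (𝓛 σ) = 0) ∧ ∀ μ ν, hs (J μ) (Ψ ν) = if μ = ν then 1 else 0

/-! ### Connections, path-ordered exponentials and holonomies -/

/-- The partial derivative in the direction of the coordinate `α` of parameter space. -/
def pd {m : ℕ} {V : Type*} [NormedAddCommGroup V] [NormedSpace ℝ V]
    (α : Fin m) (f : (Fin m → ℝ) → V) (x : Fin m → ℝ) : V :=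
  fderiv ℝ f x (Pi.single α 1)

/-- The adiabatic connection `A_{α,μν} = ⟨⟨J^μ | ∂_α Ψ_ν⟩⟩`. -/
def adiabaticConnection {n ι : Type} [Fintype n] [DecidableEq n] {m : ℕ}
    (J Ψ : (Fin m → ℝ) → ι → Matrix n n ℂ) (α : Fin m) (x : Fin m → ℝ) : Matrix ι ι ℂ :=
  Matrix.of fun μ ν => hs (J x μ) (pd α (fun y => Ψ y ν) x)

/-- The curvature `∂_α A_β - ∂_β A_α + c [A_α, A_β]`; the constant `c` is `1` for a connection in
superoperator form and `-i` for a connection given by Hermitian matrices. -/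
def curvature {ι : Type} [Fintype ι] [DecidableEq ι] {m : ℕ} (c : ℂ)
    (A : Fin m → (Fin m → ℝ) → Matrix ι ι ℂ) (α β : Fin m) (x : Fin m → ℝ) : Matrix ι ι ℂ :=
  pd α (A β) x - pd β (A α) x + c • (A α x * A β x - A β x * A α x)

/-- The terms of the Dyson series of the generator `K`. -/
def dysonTerm {A : Type*} [NormedRing A] [NormedAlgebra ℝ A] (K : ℝ → A) : ℕ → ℝ → A
  | 0, _ => 1
  | k + 1, s => ∫ r in (0 : ℝ)..s, K r * dysonTerm K k r

/-- The path-ordered exponential `𝒫 exp (∫_0^s K)`, later times to the left, as its Dyson series. -/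
def pathOrderedExp {A : Type*} [NormedRing A] [NormedAlgebra ℝ A] (K : ℝ → A) (s : ℝ) : A :=
  ∑' k, dysonTerm K k s

/-- A continuously differentiable path `[0,1] → M` in parameter space. -/
def IsPath {m : ℕ} (M : Set (Fin m → ℝ)) (γ : ℝ → Fin m → ℝ) : Prop :=
  ContDiffOn ℝ 1 γ (Set.Icc 0 1) ∧ ∀ s ∈ Set.Icc (0 : ℝ) 1, γ s ∈ M

/-- The velocity of the coordinate `α` along a path. -/
def velocity {m : ℕ} (γ : ℝ → Fin m → ℝ) (α : Fin m) (s : ℝ) : ℝ :=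
  derivWithin γ (Set.Icc 0 1) s α

/-- The operator form `𝒫 exp (∫_0^s Q' Q)` of the holonomy of a family of projections `Q`. -/
def operatorHolonomy {n : Type} [Fintype n] [DecidableEq n] {m : ℕ}
    (Q : (Fin m → ℝ) → Superop n) (γ : ℝ → Fin m → ℝ) (s : ℝ) : Superop n :=
  pathOrderedExp
    (fun r => derivWithin (fun t => Q (γ t)) (Set.Icc 0 1) r * Q (γ r)) s

/-- The coordinate form `𝒫 exp (c ∑_α ∫ A_α dx_α)` of the holonomy, taken along the path up to `s`;
the constant `c` is `-1` for a connection in superoperator form and `i` for a connection given by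
Hermitian matrices. -/
def coordinateHolonomy {ι : Type} [Fintype ι] [DecidableEq ι] {m : ℕ} (c : ℂ)
    (A : Fin m → (Fin m → ℝ) → Matrix ι ι ℂ) (γ : ℝ → Fin m → ℝ) (s : ℝ) : Matrix ι ι ℂ :=
  pathOrderedExp (fun r => c • ∑ α, (velocity γ α r : ℂ) • A α (γ r)) s

/-! ### Noiseless-subsystem blocks -/

section NoiselessSubsystem

/-- Basis labels of the reference Hilbert space `(⊕_κ H_dfs^κ ⊗ H_ax^κ) ⊕ (decaying part)`. -/
abbrev RefIndex {b : ℕ} (d a : Fin b → ℕ) (q : ℕ) : Type :=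
  (Σ κ : Fin b, Fin (d κ) × Fin (a κ)) ⊕ Fin q

variable {b : ℕ} {d a : Fin b → ℕ} {q : ℕ}

/-- The block-diagonal operator `(⊕_κ Y_κ) ⊕ 0` on the reference space. -/
def blockOp (Y : ∀ κ, Matrix (Fin (d κ) × Fin (a κ)) (Fin (d κ) × Fin (a κ)) ℂ) :
    Matrix (RefIndex d a q) (RefIndex d a q) ℂ :=
  Matrix.fromBlocks (Matrix.blockDiagonal' Y) 0 0 0

/-- The partial trace over the auxiliary factor of the block `κ`. -/
def traceAx (κ : Fin b) (Z : Matrix (RefIndex d a q) (RefIndex d a q) ℂ) :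
    Matrix (Fin (d κ)) (Fin (d κ)) ℂ :=
  Matrix.of fun k l => ∑ j : Fin (a κ), Z (Sum.inl ⟨κ, (k, j)⟩) (Sum.inl ⟨κ, (l, j)⟩)

variable {n : Type} [Fintype n] [DecidableEq n] {m : ℕ}

/-- The operator `S ((⊕_κ Y_κ) ⊕ 0) S†` on the system Hilbert space. -/
def inFrame (S : Matrix n (RefIndex d a q) ℂ)
    (Y : ∀ κ, Matrix (Fin (d κ) × Fin (a κ)) (Fin (d κ) × Fin (a κ)) ℂ) : Matrix n n ℂ :=
  S * blockOp (q := q) Y * Sᴴ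

/-- Over the parameter region `M`, the asymptotic subspace is a sum of noiseless-subsystem blocks of
fixed shape: the unitary `S x` carries `⊕_κ Op(H_dfs^κ) ⊗ ϱ_κ(x)` onto it, where the `ϱ_κ(x)` are
density matrices. -/
structure IsNSFamily (M : Set (Fin m → ℝ)) (𝓛 : (Fin m → ℝ) → Superop n)
    (S : (Fin m → ℝ) → Matrix n (RefIndex d a q) ℂ)
    (ϱ : ∀ κ, (Fin m → ℝ) → Matrix (Fin (a κ)) (Fin (a κ)) ℂ) : Prop where
  contDiff_S : ContDiffOn ℝ 1 S M
  contDiff_ϱ : ∀ κ, ContDiffOn ℝ 1 (ϱ κ) M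
  unitary_left : ∀ x ∈ M, (S x)ᴴ * S x = 1
  unitary_right : ∀ x ∈ M, S x * (S x)ᴴ = 1
  posSemidef : ∀ x ∈ M, ∀ κ, (ϱ κ x).PosSemidef
  trace_one : ∀ x ∈ M, ∀ κ, (ϱ κ x).trace = 1
  asymptotic : ∀ x ∈ M, ∀ ρ : Matrix n n ℂ, ρ ∈ asymptoticSubspace (𝓛 x) ↔
    ∃ X : ∀ κ, Matrix (Fin (d κ)) (Fin (d κ)) ℂ,
      ρ = inFrame (S x) (fun κ => X κ ⊗ₖ ϱ κ x)

/-- A parameter-independent Hermitian orthonormal operator basis of each decoherence-free factor. -/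
def IsHermitianBasis (B : ∀ κ, Fin (d κ ^ 2) → Matrix (Fin (d κ)) (Fin (d κ)) ℂ) : Prop :=
  ∀ κ, (∀ μ, (B κ μ).IsHermitian) ∧ ∀ μ ν, hs (B κ μ) (B κ ν) = if μ = ν then 1 else 0

/-- The auxiliary norm `n_ax = √(Tr ϱ²)`. -/
def axNorm {k : ℕ} (ϱ : (Fin m → ℝ) → Matrix (Fin k) (Fin k) ℂ) (x : Fin m → ℝ) : ℝ :=
  Real.sqrt (ϱ x * ϱ x).trace.re

/-- The steady-state basis `Ψ_{κμ} = S (B_{κμ} ⊗ ϱ_κ / n_κ) S†`. -/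
def nsBasis (S : (Fin m → ℝ) → Matrix n (RefIndex d a q) ℂ)
    (ϱ : ∀ κ, (Fin m → ℝ) → Matrix (Fin (a κ)) (Fin (a κ)) ℂ)
    (B : ∀ κ, Fin (d κ ^ 2) → Matrix (Fin (d κ)) (Fin (d κ)) ℂ)
    (x : Fin m → ℝ) (i : Σ κ : Fin b, Fin (d κ ^ 2)) : Matrix n n ℂ :=
  inFrame (S x) (Pi.single i.1 (B i.1 i.2 ⊗ₖ (((axNorm (ϱ i.1) x)⁻¹ : ℂ) • ϱ i.1 x)))

/-- The generator of motion `G_α = i S† ∂_α S`. -/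
def motionGen (S : (Fin m → ℝ) → Matrix n (RefIndex d a q) ℂ) (α : Fin m) (x : Fin m → ℝ) :
    Matrix (RefIndex d a q) (RefIndex d a q) ℂ :=
  Complex.I • ((S x)ᴴ * pd α S x)

/-- The effective Hamiltonian `tr_ax {(P_dfs ⊗ ϱ_ax) G_α}` of the block `κ`. -/
def dfsHamiltonian (S : (Fin m → ℝ) → Matrix n (RefIndex d a q) ℂ)
    (ϱ : ∀ κ, (Fin m → ℝ) → Matrix (Fin (a κ)) (Fin (a κ)) ℂ)
    (κ : Fin b) (α : Fin m) (x : Fin m → ℝ) : Matrix (Fin (d κ)) (Fin (d κ)) ℂ :=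
  traceAx κ (blockOp (q := q) (Pi.single κ ((1 : Matrix (Fin (d κ)) (Fin (d κ)) ℂ) ⊗ₖ ϱ κ x)) *
    motionGen S α x)

/-- The matrix of `-i[W, ·]` in an operator basis. -/
def hamMatrix {k : ℕ} (B : Fin (k ^ 2) → Matrix (Fin k) (Fin k) ℂ) (W : Matrix (Fin k) (Fin k) ℂ) :
    Matrix (Fin (k ^ 2)) (Fin (k ^ 2)) ℂ :=
  Matrix.of fun μ ν => hs (B μ) (-Complex.I • (W * B ν - B ν * W))

/-- The matrix of `U · U†` in an operator basis. -/
def conjMatrix {k : ℕ} (B : Fin (k ^ 2) → Matrix (Fin k) (Fin k) ℂ) (U : Matrix (Fin k) (Fin k) ℂ) :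
    Matrix (Fin (k ^ 2)) (Fin (k ^ 2)) ℂ :=
  Matrix.of fun μ ν => hs (B μ) (U * B ν * Uᴴ)

/-- The decoherence-free-subspace connection `-i[tr_ax {(P_dfs ⊗ ϱ_ax) G_α}, ·]` of the block `κ`. -/
def dfsConnection (S : (Fin m → ℝ) → Matrix n (RefIndex d a q) ℂ)
    (ϱ : ∀ κ, (Fin m → ℝ) → Matrix (Fin (a κ)) (Fin (a κ)) ℂ)
    (B : ∀ κ, Fin (d κ ^ 2) → Matrix (Fin (d κ)) (Fin (d κ)) ℂ)
    (κ : Fin b) (α : Fin m) (x : Fin m → ℝ) : Matrix (Fin (d κ ^ 2)) (Fin (d κ ^ 2)) ℂ :=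
  hamMatrix (B κ) (dfsHamiltonian S ϱ κ α x)

/-- The scalar connection `-∂_α ln n_ax`. -/
def axConnection {k : ℕ} (ϱ : (Fin m → ℝ) → Matrix (Fin k) (Fin k) ℂ) (α : Fin m)
    (x : Fin m → ℝ) : ℝ :=
  -pd α (fun y => Real.log (axNorm ϱ y)) x

end NoiselessSubsystem

end LindbladHolonomy

end

/-!
The argument rests on three facts about a steady Lindbladian `𝓛`.

*The asymptotic projection is positive.* A minimum principle for the generator in the Heisenberg
picture (`IsJumpForm.posSemidef_of_resolvent`) shows that `lam (lam - 𝓛)⁻¹` is positive and bounded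
uniformly in `lam > 0`. Letting `lam → 0`, zero is a semisimple eigenvalue, so kernel and range of
`𝓛` are complementary, and `𝒫_∞`, the projection onto the kernel along the range, is a limit of
positive maps (`asymptoticProjection_posSemidef`).

*Conserved quantities are block diagonal.* If `𝓛†(J) = 0`, then `𝓛†(J†J) = ∑ [F, J]†[F, J]` has zero
expectation in every steady state. Hence `J` commutes with all jump operators on the support of the
asymptotic states and maps a steady state of maximal support to an asymptotic operator
(`conserved_mul_mem`). In particular the off-diagonal corners of `J` relative to the non-decaying
projection `P` vanish, so an operator without a lower-right corner is paired with `J` through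
`P J P` only (`hs_upperLeft_conserved`).

*Asymptotic operators move without a lower-right corner.* For positive `σ` and `B` the function
`y ↦ ⟨⟨B| Q 𝒫_∞(y)σ Q⟩⟩` with `Q = 1 - P(x)` is nonnegative and vanishes at `y = x`, so its
derivative vanishes there (`corner_fderiv_asymptoticProjection`). This uses no differentiability of
`P`, whose rank may jump.

The last two facts show that the connection sees only `P J P`, and that `𝒫_∞` and `𝒫_Ψ` agree on the
velocities of asymptotic operators. Path-ordered exponentials are the solutions of linear
differential equations (`hasDerivWithinAt_pathOrderedExp`, `eq_pathOrderedExp`), and the operator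
holonomy of a family of projections `Q` is characterized by `Q w = w` and `Q w' = 0`
(`operatorHolonomy_apply_eq`). Every statement about holonomies is then a check that two curves
solve the same differential equation with the same initial value.

For noiseless-subsystem blocks, the product of `J` with the steady state `S (⊕ 1 ⊗ ϱ_κ) S†` is
asymptotic, which forces `P J P = S (⊕ X_κ ⊗ P_ax) S†` and, by biorthogonality,
`J^{κμ}_ul = S (n_κ B_{κμ} ⊗ P_ax) S†` (`IsNSFamily.upperLeft_dual`). Pairing this with the product
rule for `∂_α Ψ_{κν}` gives the connection (`IsNSFamily.adiabaticConnection_eq`). The derivative of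
`ϱ_κ` drops out because `Tr (P_ax ∂_α ϱ_κ) = 0`, again a first-order condition at a minimum, valid
also where the rank of `ϱ_κ` changes. The remaining scalar part `-∂_α ln n_κ` is central and exact:
it contributes the ratio of auxiliary norms to the holonomy and nothing to the curvature.
-/

set_option linter.unusedSectionVars false

noncomputable section

namespace LindbladHolonomy

/-! ### The Hilbert-Schmidt inner product -/

section JumpForm

variable {n : Type} [Fintype n]

lemma hs_add_left (A B C : Matrix n n ℂ) : hs (A + B) C = hs A C + hs B C := by
  simp [hs, Matrix.add_mul]

lemma hs_add_right (A B C : Matrix n n ℂ) : hs A (B + C) = hs A B + hs A C := by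
  simp [hs, Matrix.mul_add]

lemma hs_sub_left (A B C : Matrix n n ℂ) : hs (A - B) C = hs A C - hs B C := by
  simp [hs, Matrix.sub_mul]

lemma hs_sub_right (A B C : Matrix n n ℂ) : hs A (B - C) = hs A B - hs A C := by
  simp [hs, Matrix.mul_sub]

lemma hs_smul_left (c : ℂ) (A B : Matrix n n ℂ) : hs (c • A) B = star c * hs A B := by
  simp [hs]

lemma hs_smul_right (c : ℂ) (A B : Matrix n n ℂ) : hs A (c • B) = c * hs A B := by
  simp [hs]

lemma hs_sum_right {ι : Type*} (s : Finset ι) (A : Matrix n n ℂ) (B : ι → Matrix n n ℂ) :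
    hs A (∑ i ∈ s, B i) = ∑ i ∈ s, hs A (B i) := by
  simp [hs, Matrix.mul_sum, Matrix.trace_sum]

lemma hs_sum_left {ι : Type*} (s : Finset ι) (A : ι → Matrix n n ℂ) (B : Matrix n n ℂ) :
    hs (∑ i ∈ s, A i) B = ∑ i ∈ s, hs (A i) B := by
  simp [hs, Matrix.sum_mul, Matrix.trace_sum, Matrix.conjTranspose_sum]

lemma hs_zero_right (A : Matrix n n ℂ) : hs A 0 = 0 := by simp [hs]

lemma hs_zero_left (A : Matrix n n ℂ) : hs 0 A = 0 := by simp [hs]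

lemma star_hs (A B : Matrix n n ℂ) : star (hs A B) = hs B A := by
  rw [hs, hs, ← Matrix.trace_conjTranspose, Matrix.conjTranspose_mul,
    Matrix.conjTranspose_conjTranspose]

lemma eq_zero_of_hs_self {A : Matrix n n ℂ} (h : hs A A = 0) : A = 0 :=
  Matrix.trace_conjTranspose_mul_self_eq_zero_iff.1 h

lemma eq_zero_of_forall_hs {A : Matrix n n ℂ} (h : ∀ B, hs B A = 0) : A = 0 :=
  eq_zero_of_hs_self (h A)

lemma eq_of_forall_hs {A B : Matrix n n ℂ} (h : ∀ C, hs A C = hs B C) : A = B := by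
  refine sub_eq_zero.1 (eq_zero_of_hs_self ?_)
  rw [hs_sub_left, h, sub_self]

/-- Moving left and right factors across the Hilbert-Schmidt inner product. -/
lemma hs_mul_mul (A B X Y : Matrix n n ℂ) : hs A (X * B * Y) = hs (Xᴴ * A * Yᴴ) B := by
  simp only [hs, Matrix.conjTranspose_mul, Matrix.conjTranspose_conjTranspose]
  rw [← Matrix.mul_assoc, Matrix.trace_mul_comm]
  simp only [Matrix.mul_assoc]

/-! ### Lindbladians in jump form and the minimum principle -/

variable [DecidableEq n]

/-- The Lindbladian `ρ ↦ ∑ F ρ F† + K ρ + ρ K†`, with rates absorbed in the jump operators `F` and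
the Hamiltonian and the recycling term collected in `K`, which obeys `K + K† + ∑ F†F = 0`. -/
structure IsJumpForm {r : ℕ} (𝓛 : Superop n) (F : Fin r → Matrix n n ℂ) (K : Matrix n n ℂ) :
    Prop where
  balance : Kᴴ + K + ∑ l, (F l)ᴴ * F l = 0
  apply : ∀ ρ, 𝓛 ρ = ∑ l, F l * ρ * (F l)ᴴ + K * ρ + ρ * Kᴴ

lemma IsLindbladian.exists_jumpForm {𝓛 : Superop n} (h : IsLindbladian 𝓛) :
    ∃ (r : ℕ) (F : Fin r → Matrix n n ℂ) (K : Matrix n n ℂ), IsJumpForm 𝓛 F K := by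
  obtain ⟨r, H, F, w, hH, hw, hL⟩ := h
  set D : Matrix n n ℂ := ∑ l, (w l : ℂ) • ((F l)ᴴ * F l) with hD
  have hDh : Dᴴ = D := by
    simp [hD, Matrix.conjTranspose_sum, Matrix.conjTranspose_smul]
  have hFD : ∑ l, (((Real.sqrt (w l) : ℝ) : ℂ) • F l)ᴴ * (((Real.sqrt (w l) : ℝ) : ℂ) • F l) =
      D := by
    rw [hD]
    refine Finset.sum_congr rfl fun l _ => ?_
    simp [Matrix.conjTranspose_smul, smul_smul, Real.mul_self_sqrt (hw l).le]
  refine ⟨r, fun l => ((Real.sqrt (w l) : ℝ) : ℂ) • F l,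
    -Complex.I • H - (1 / 2 : ℂ) • D, ?_, ?_⟩
  · rw [hFD, Matrix.conjTranspose_sub, Matrix.conjTranspose_smul, Matrix.conjTranspose_smul, hDh,
      hH.eq]
    simp only [star_neg, Complex.star_def, Complex.conj_I, map_div₀, map_one, Complex.conj_ofNat]
    module
  · intro ρ
    have h1 : ∑ l, (((Real.sqrt (w l) : ℝ) : ℂ) • F l) * ρ * (((Real.sqrt (w l) : ℝ) : ℂ) • F l)ᴴ
        = ∑ l, (w l : ℂ) • (F l * ρ * (F l)ᴴ) := by
      refine Finset.sum_congr rfl fun l _ => ?_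
      simp [Matrix.conjTranspose_smul, smul_smul, Real.mul_self_sqrt (hw l).le]
    have h2 : ∑ l, (w l : ℂ) •
          ((2 : ℂ) • (F l * ρ * (F l)ᴴ) - (F l)ᴴ * F l * ρ - ρ * ((F l)ᴴ * F l))
        = (2 : ℂ) • ∑ l, (w l : ℂ) • (F l * ρ * (F l)ᴴ) - D * ρ - ρ * D := by
      rw [hD, Finset.sum_mul, Finset.mul_sum, Finset.smul_sum, ← Finset.sum_sub_distrib,
        ← Finset.sum_sub_distrib]
      refine Finset.sum_congr rfl fun l _ => ?_
      rw [Matrix.smul_mul, Matrix.mul_smul]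
      module
    rw [hL, h1, h2, Matrix.conjTranspose_sub, Matrix.conjTranspose_smul, Matrix.conjTranspose_smul,
      hDh, hH.eq]
    simp only [star_neg, Complex.star_def, Complex.conj_I, map_div₀, map_one, Complex.conj_ofNat,
      Matrix.sub_mul, Matrix.mul_sub, Matrix.smul_mul, Matrix.mul_smul]
    module

/-- The generator in the Heisenberg picture, the Hilbert-Schmidt adjoint of
`ρ ↦ ∑ F ρ F† + K ρ + ρ K†`. -/
def heisenbergGen {r : ℕ} (F : Fin r → Matrix n n ℂ) (K : Matrix n n ℂ) :
    Matrix n n ℂ →ₗ[ℂ] Matrix n n ℂ where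
  toFun A := ∑ l, (F l)ᴴ * A * F l + Kᴴ * A + A * K
  map_add' A B := by
    simp only [Matrix.mul_add, Matrix.add_mul, Finset.sum_add_distrib]
    abel
  map_smul' c A := by
    simp only [Matrix.mul_smul, Matrix.smul_mul, ← Finset.smul_sum, smul_add, RingHom.id_apply]

variable {r : ℕ} {F : Fin r → Matrix n n ℂ} {K : Matrix n n ℂ} {𝓛 : Superop n}

lemma heisenbergGen_apply (A : Matrix n n ℂ) :
    heisenbergGen F K A = ∑ l, (F l)ᴴ * A * F l + Kᴴ * A + A * K := rfl

lemma heisenbergGen_conjTranspose (A : Matrix n n ℂ) :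
    heisenbergGen F K Aᴴ = (heisenbergGen F K A)ᴴ := by
  simp only [heisenbergGen_apply, Matrix.conjTranspose_add, Matrix.conjTranspose_sum,
    Matrix.conjTranspose_mul, Matrix.conjTranspose_conjTranspose, Matrix.mul_assoc]
  abel

lemma IsJumpForm.conjTranspose (h : IsJumpForm 𝓛 F K) (ρ : Matrix n n ℂ) : 𝓛 ρᴴ = (𝓛 ρ)ᴴ := by
  simp only [h.apply, Matrix.conjTranspose_add, Matrix.conjTranspose_sum,
    Matrix.conjTranspose_mul, Matrix.conjTranspose_conjTranspose, Matrix.mul_assoc]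
  abel

lemma IsJumpForm.hs_apply (h : IsJumpForm 𝓛 F K) (A ρ : Matrix n n ℂ) :
    hs A (𝓛 ρ) = hs (heisenbergGen F K A) ρ := by
  rw [h.apply, heisenbergGen_apply, hs_add_right, hs_add_right, hs_sum_right, hs_add_left,
    hs_add_left, hs_sum_left]
  congr 1
  · congr 1
    · refine Finset.sum_congr rfl fun l _ => ?_
      rw [hs_mul_mul, Matrix.conjTranspose_conjTranspose]
    · simpa using hs_mul_mul A ρ K 1
  · simpa using hs_mul_mul A ρ 1 Kᴴ

/-- Trace preservation, in the Heisenberg picture. -/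
lemma IsJumpForm.heisenbergGen_one (h : IsJumpForm 𝓛 F K) : heisenbergGen F K 1 = 0 := by
  rw [heisenbergGen_apply, ← h.balance]
  simp only [Matrix.mul_one, Matrix.one_mul]
  abel

lemma exists_min_eigenvalue [Nonempty n] {A : Matrix n n ℂ} (hA : A.IsHermitian) :
    ∃ (a : ℝ) (v : n → ℂ), v ≠ 0 ∧ A *ᵥ v = (a : ℂ) • v ∧ (A - (a : ℂ) • 1).PosSemidef := by
  obtain ⟨i, hi⟩ := Finite.exists_min hA.eigenvalues
  refine ⟨hA.eigenvalues i, ⇑(hA.eigenvectorBasis i), ?_, ?_, ?_⟩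
  · have := hA.eigenvectorBasis.orthonormal.ne_zero i
    intro h0
    exact this (by ext j; exact congrFun h0 j)
  · rw [hA.mulVec_eigenvectorBasis]
    ext j
    simp
  · open scoped MatrixOrder in
    have h1 : algebraMap ℝ (Matrix n n ℂ) (hA.eigenvalues i) ≤ A := by
      rw [algebraMap_le_iff_le_spectrum (a := A) (ha := hA)]
      intro x hx
      rw [hA.spectrum_real_eq_range_eigenvalues] at hx
      obtain ⟨j, rfl⟩ := hx
      exact hi j
    have h2 : algebraMap ℝ (Matrix n n ℂ) (hA.eigenvalues i) =
        ((hA.eigenvalues i : ℝ) : ℂ) • 1 := by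
      rw [Algebra.algebraMap_eq_smul_one, Complex.coe_smul]
    rw [← h2]
    exact Matrix.le_iff.1 h1

/-- The minimum principle: in the eigenvector of the smallest eigenvalue of `A` the generator in the
Heisenberg picture has a nonnegative expectation value. -/
lemma IsJumpForm.posSemidef_of_resolvent (h : IsJumpForm 𝓛 F K) {lam : ℝ} (hlam : 0 < lam)
    {A : Matrix n n ℂ} (hA : A.IsHermitian)
    (hB : ((lam : ℂ) • A - heisenbergGen F K A).PosSemidef) : A.PosSemidef := by
  rcases isEmpty_or_nonempty n with hn | hn
  · have : A = 0 := Subsingleton.elim _ _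
    rw [this]; exact Matrix.PosSemidef.zero
  obtain ⟨a, v, hv, hav, hC⟩ := exists_min_eigenvalue hA
  set C := A - (a : ℂ) • (1 : Matrix n n ℂ) with hCdef
  have hAC : A = C + (a : ℂ) • 1 := by rw [hCdef]; abel
  -- `C = A - a ≥ 0` annihilates `v`, and the unital generator does not see the shift by `a`
  have hgen : heisenbergGen F K A = heisenbergGen F K C := by
    rw [hAC, map_add, map_smul, h.heisenbergGen_one, smul_zero, add_zero]
  have hCv : C *ᵥ v = 0 := by
    rw [hCdef, Matrix.sub_mulVec, hav, Matrix.smul_mulVec, Matrix.one_mulVec, sub_self]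
  have hvC : star v ᵥ* C = 0 := by
    have := congrArg star hCv
    rwa [Matrix.star_mulVec, hC.isHermitian.eq, star_zero] at this
  have hexp : 0 ≤ star v ⬝ᵥ (heisenbergGen F K C *ᵥ v) := by
    rw [heisenbergGen_apply, Matrix.add_mulVec, Matrix.add_mulVec, dotProduct_add, dotProduct_add,
      ← Matrix.mulVec_mulVec v Kᴴ C, hCv, ← Matrix.mulVec_mulVec v C K,
      Matrix.dotProduct_mulVec _ C, hvC, Matrix.mulVec_zero, dotProduct_zero, zero_dotProduct,
      add_zero, add_zero,
      Matrix.sum_mulVec, dotProduct_sum]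
    refine Finset.sum_nonneg fun l _ => ?_
    exact (hC.conjTranspose_mul_mul_same (F l)).dotProduct_mulVec_nonneg v
  have hpos : 0 ≤ star v ⬝ᵥ (((lam : ℂ) • A - heisenbergGen F K A) *ᵥ v) :=
    hB.dotProduct_mulVec_nonneg v
  rw [Matrix.sub_mulVec, dotProduct_sub, hgen, Matrix.smul_mulVec, hav, dotProduct_smul,
    dotProduct_smul] at hpos
  have hlav := add_nonneg hpos hexp
  rw [sub_add_cancel] at hlav
  have hvv : 0 < star v ⬝ᵥ v := Matrix.dotProduct_star_self_pos_iff.2 hv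
  have ha : 0 ≤ a := by
    by_contra hneg
    push Not at hneg
    have hvre : 0 < (star v ⬝ᵥ v).re := (Complex.lt_def.1 hvv).1
    have h3 := (Complex.le_def.1 hlav).1
    simp only [smul_eq_mul, Complex.re_ofReal_mul, Complex.zero_re] at h3
    have : lam * (a * (star v ⬝ᵥ v).re) < 0 :=
      mul_neg_of_pos_of_neg hlam (mul_neg_of_neg_of_pos hneg hvre)
    linarith
  rw [hAC]
  refine hC.add (Matrix.PosSemidef.one.smul ?_)
  exact_mod_cast ha

end JumpForm

/-! ### The resolvent in the Heisenberg picture and the asymptotic projection -/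

section Resolvent

variable {n : Type} [Fintype n] [DecidableEq n]
  {r : ℕ} {F : Fin r → Matrix n n ℂ} {K : Matrix n n ℂ} {𝓛 : Superop n}

/-- The positive semidefinite matrices span all matrices. -/
lemma posSemidef_span_induction {p : Matrix n n ℂ → Prop} (hpos : ∀ A, A.PosSemidef → p A)
    (hadd : ∀ A B, p A → p B → p (A + B)) (hsmul : ∀ (c : ℂ) A, p A → p (c • A))
    (A : Matrix n n ℂ) : p A := by
  open scoped MatrixOrder in
  have h : A ∈ Submodule.span ℂ {a : Matrix n n ℂ | 0 ≤ a} := by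
    rw [CStarAlgebra.span_nonneg]; trivial
  induction h using Submodule.span_induction with
  | mem x hx => exact hpos x (Matrix.nonneg_iff_posSemidef.1 hx)
  | zero => exact hpos 0 Matrix.PosSemidef.zero
  | add x y _ _ hx hy => exact hadd x y hx hy
  | smul c x _ hx => exact hsmul c x hx

lemma eq_zero_of_forall_posSemidef_hs {A : Matrix n n ℂ} (h : ∀ B, B.PosSemidef → hs B A = 0) :
    A = 0 := by
  refine eq_zero_of_forall_hs fun B => ?_
  refine posSemidef_span_induction (p := fun B => hs B A = 0) h ?_ ?_ B
  · intro B C hB hC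
    rw [hs_add_left, hB, hC, add_zero]
  · intro c B hB
    rw [hs_smul_left, hB, mul_zero]

lemma PosSemidef.exists_eq_conjTranspose_mul_self {A : Matrix n n ℂ} (hA : A.PosSemidef) :
    ∃ C : Matrix n n ℂ, A = Cᴴ * C := by
  open scoped MatrixOrder in
  exact CStarAlgebra.nonneg_iff_eq_star_mul_self.1 (Matrix.nonneg_iff_posSemidef.2 hA)

lemma hs_nonneg_of_posSemidef {A B : Matrix n n ℂ} (hA : A.PosSemidef) (hB : B.PosSemidef) :
    0 ≤ hs A B := by
  obtain ⟨C, rfl⟩ := PosSemidef.exists_eq_conjTranspose_mul_self hA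
  rw [hs, Matrix.conjTranspose_mul, Matrix.conjTranspose_conjTranspose, Matrix.mul_assoc,
    Matrix.trace_mul_comm]
  exact (hB.mul_mul_conjTranspose_same C).trace_nonneg

/-- Positivity can be tested on positive semidefinite matrices. -/
lemma posSemidef_of_forall_hs_nonneg {A : Matrix n n ℂ} (h : ∀ B, B.PosSemidef → 0 ≤ hs B A) :
    A.PosSemidef := by
  have hherm : A.IsHermitian := by
    refine sub_eq_zero.1 (eq_zero_of_forall_posSemidef_hs fun B hB => ?_)
    have h1 : hs B Aᴴ = star (hs B A) := by
      rw [star_hs, hs, hs, hB.isHermitian.eq, Matrix.trace_mul_comm]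
    rw [hs_sub_right, h1, sub_eq_zero]
    exact (IsSelfAdjoint.of_nonneg (h B hB)).star_eq
  refine Matrix.PosSemidef.of_dotProduct_mulVec_nonneg hherm fun v => ?_
  have h2 := h _ (Matrix.posSemidef_vecMulVec_self_star v)
  rw [hs, (Matrix.posSemidef_vecMulVec_self_star v).isHermitian.eq, Matrix.vecMulVec_mul,
    Matrix.trace_vecMulVec] at h2
  rwa [Matrix.dotProduct_mulVec, dotProduct_comm]

lemma posSemidef_exists_le {A : Matrix n n ℂ} (hA : A.PosSemidef) :
    ∃ c : ℝ, 0 ≤ c ∧ ((c : ℂ) • (1 : Matrix n n ℂ) - A).PosSemidef := by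
  refine ⟨‖A‖, norm_nonneg _, ?_⟩
  open scoped MatrixOrder in
  have h : A ≤ algebraMap ℝ (Matrix n n ℂ) ‖A‖ :=
    IsSelfAdjoint.le_algebraMap_norm_self hA.isHermitian
  rw [Algebra.algebraMap_eq_smul_one] at h
  rw [Complex.coe_smul]
  exact Matrix.le_iff.1 h

lemma posSemidef_norm_le {A : Matrix n n ℂ} {c : ℝ} (hc : 0 ≤ c) (hA : A.PosSemidef)
    (h : ((c : ℂ) • (1 : Matrix n n ℂ) - A).PosSemidef) : ‖A‖ ≤ c := by
  open scoped MatrixOrder in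
  rw [CStarAlgebra.norm_le_iff_le_algebraMap A hc (Matrix.nonneg_iff_posSemidef.2 hA),
    Algebra.algebraMap_eq_smul_one, Matrix.le_iff]
  rwa [Complex.coe_smul] at h

/-- The minimum principle makes `lam - L†` injective. -/
lemma IsJumpForm.eq_zero_of_resolvent (h : IsJumpForm 𝓛 F K) {lam : ℝ} (hlam : 0 < lam)
    {A : Matrix n n ℂ} (hA : (lam : ℂ) • A - heisenbergGen F K A = 0) : A = 0 := by
  have herm : ∀ C : Matrix n n ℂ, C.IsHermitian → (lam : ℂ) • C - heisenbergGen F K C = 0 →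
      C = 0 := by
    intro C hC h0
    have h1 : C.PosSemidef := h.posSemidef_of_resolvent hlam hC (by
      rw [h0]; exact Matrix.PosSemidef.zero)
    have h2 : (-C).PosSemidef := h.posSemidef_of_resolvent hlam hC.neg (by
      rw [smul_neg, map_neg, neg_sub_neg, ← neg_sub, h0, neg_zero]; exact Matrix.PosSemidef.zero)
    refine eq_zero_of_forall_posSemidef_hs fun B hB => ?_
    have h3 := hs_nonneg_of_posSemidef hB h1
    have h4 := hs_nonneg_of_posSemidef hB h2
    have h5 : hs B (-C) = -hs B C := by simp [hs]
    rw [h5] at h4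
    exact le_antisymm (neg_nonneg.1 h4) h3
  have hA' : (lam : ℂ) • Aᴴ - heisenbergGen F K Aᴴ = 0 := by
    rw [heisenbergGen_conjTranspose]
    have := congrArg Matrix.conjTranspose hA
    simpa [Matrix.conjTranspose_sub, Matrix.conjTranspose_smul] using this
  have h1 : A + Aᴴ = 0 := herm _ (Matrix.isHermitian_add_transpose_self A) (by
    rw [map_add, smul_add, add_sub_add_comm, hA, hA', add_zero])
  have h2 : Complex.I • (A - Aᴴ) = 0 := herm _ (by
      rw [Matrix.IsHermitian, Matrix.conjTranspose_smul, Matrix.conjTranspose_sub,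
        Matrix.conjTranspose_conjTranspose, Complex.star_def, Complex.conj_I, neg_smul, ← smul_neg,
        neg_sub]) (by
    have h4 : (lam : ℂ) • Complex.I • (A - Aᴴ) - heisenbergGen F K (Complex.I • (A - Aᴴ)) =
        Complex.I • (((lam : ℂ) • A - heisenbergGen F K A) -
          ((lam : ℂ) • Aᴴ - heisenbergGen F K Aᴴ)) := by
      rw [map_smul, map_sub]
      module
    rw [h4, hA, hA', sub_self, smul_zero])
  have h3 : A - Aᴴ = 0 := (smul_eq_zero.1 h2).resolve_left Complex.I_ne_zero
  have h4 : (2 : ℂ) • A = 0 := by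
    rw [two_smul]
    calc A + A = (A + Aᴴ) + (A - Aᴴ) := by abel
      _ = 0 := by rw [h1, h3, add_zero]
  exact (smul_eq_zero.1 h4).resolve_left two_ne_zero

lemma IsJumpForm.exists_resolvent (h : IsJumpForm 𝓛 F K) {lam : ℝ} (hlam : 0 < lam)
    (B : Matrix n n ℂ) : ∃ A, (lam : ℂ) • A - heisenbergGen F K A = B := by
  have hinj : Function.Injective ((lam : ℂ) • LinearMap.id - heisenbergGen F K :
      Matrix n n ℂ →ₗ[ℂ] Matrix n n ℂ) := by
    rw [← LinearMap.ker_eq_bot, LinearMap.ker_eq_bot']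
    intro A hA
    exact h.eq_zero_of_resolvent hlam (by simpa using hA)
  obtain ⟨A, hA⟩ := (LinearMap.injective_iff_surjective.1 hinj) B
  exact ⟨A, by simpa using hA⟩

/-- The resolvent `lam (lam - L†)⁻¹` is positive and unital, hence does not enlarge the bounds of a
positive matrix. -/
lemma IsJumpForm.exists_resolvent_posSemidef (h : IsJumpForm 𝓛 F K) {lam : ℝ} (hlam : 0 < lam)
    {B : Matrix n n ℂ} (hB : B.PosSemidef) {c : ℝ}
    (hc : ((c : ℂ) • (1 : Matrix n n ℂ) - B).PosSemidef) :
    ∃ A, (lam : ℂ) • A - heisenbergGen F K A = B ∧ A.PosSemidef ∧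
      ((c : ℂ) • (1 : Matrix n n ℂ) - (lam : ℂ) • A).PosSemidef := by
  obtain ⟨A, hA⟩ := h.exists_resolvent hlam B
  have hAh : A.IsHermitian := by
    refine sub_eq_zero.1 (h.eq_zero_of_resolvent hlam ?_)
    rw [map_sub, smul_sub, sub_sub_sub_comm, hA, heisenbergGen_conjTranspose]
    have h1 : (lam : ℂ) • Aᴴ - (heisenbergGen F K A)ᴴ = Bᴴ := by
      rw [← hA, Matrix.conjTranspose_sub, Matrix.conjTranspose_smul]
      simp
    rw [h1, hB.isHermitian.eq, sub_self]
  refine ⟨A, hA, h.posSemidef_of_resolvent hlam hAh (by rwa [hA]), ?_⟩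
  refine h.posSemidef_of_resolvent hlam ?_ ?_
  · refine Matrix.IsHermitian.sub ?_ ?_
    · simp [Matrix.IsHermitian, Matrix.conjTranspose_smul]
    · rw [Matrix.IsHermitian, Matrix.conjTranspose_smul, hAh.eq]
      simp
  · have h2 : (lam : ℂ) • ((c : ℂ) • (1 : Matrix n n ℂ) - (lam : ℂ) • A) -
        heisenbergGen F K ((c : ℂ) • (1 : Matrix n n ℂ) - (lam : ℂ) • A) =
        (lam : ℂ) • ((c : ℂ) • (1 : Matrix n n ℂ) - B) := by
      rw [map_sub, map_smul, map_smul, h.heisenbergGen_one, ← hA]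
      module
    rw [h2]
    exact hc.smul (by exact_mod_cast hlam.le)

/-- Expectation values of the positive resolvents stay bounded as `lam → 0`. -/
lemma IsJumpForm.exists_bounded_resolvent (h : IsJumpForm 𝓛 F K) {B : Matrix n n ℂ}
    (hB : B.PosSemidef) (ρ : Matrix n n ℂ) :
    ∃ C : ℝ, ∀ lam : ℝ, 0 < lam → ∃ A, (lam : ℂ) • A - heisenbergGen F K A = B ∧
      A.PosSemidef ∧ ‖(lam : ℂ) * hs A ρ‖ ≤ C := by
  obtain ⟨c, hc, hcB⟩ := posSemidef_exists_le hB
  let f : Matrix n n ℂ →ₗ[ℂ] ℂ := Matrix.traceLinearMap n ℂ ℂ ∘ₗ LinearMap.mulRight ℂ ρ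
  refine ⟨‖LinearMap.toContinuousLinearMap f‖ * c, fun lam hlam => ?_⟩
  obtain ⟨A, hA, hApos, hAc⟩ := h.exists_resolvent_posSemidef hlam hB hcB
  refine ⟨A, hA, hApos, ?_⟩
  have h1 : (lam : ℂ) * hs A ρ = LinearMap.toContinuousLinearMap f ((lam : ℂ) • A) := by
    rw [map_smul, smul_eq_mul, hs, hApos.isHermitian.eq]
    rfl
  rw [h1]
  refine ((LinearMap.toContinuousLinearMap f).le_opNorm _).trans ?_
  refine mul_le_mul_of_nonneg_left ?_ (norm_nonneg _)
  exact posSemidef_norm_le hc (hApos.smul (by exact_mod_cast hlam.le)) hAc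

lemma IsJumpForm.hs_resolvent (h : IsJumpForm 𝓛 F K) {lam : ℝ} {A B : Matrix n n ℂ}
    (hA : (lam : ℂ) • A - heisenbergGen F K A = B) (τ : Matrix n n ℂ) :
    hs B τ = hs A ((lam : ℂ) • τ - 𝓛 τ) := by
  rw [← hA, hs_sub_left, hs_sub_right, h.hs_apply, hs_smul_left, hs_smul_right]
  simp

/-- The eigenvalue zero of a Lindbladian is semisimple: a Jordan block would make the operators
`lam (lam - 𝓛)⁻¹` unbounded as `lam → 0`. -/
lemma IsJumpForm.apply_eq_zero_of_apply_apply (h : IsJumpForm 𝓛 F K) {ρ : Matrix n n ℂ}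
    (hρ : 𝓛 (𝓛 ρ) = 0) : 𝓛 ρ = 0 := by
  refine eq_zero_of_forall_posSemidef_hs fun B hB => ?_
  obtain ⟨C, hC⟩ := h.exists_bounded_resolvent hB ρ
  have hbound : ∀ lam : ℝ, 0 < lam → ‖hs B (𝓛 ρ)‖ ≤ lam * (C + ‖hs B ρ‖) := by
    intro lam hlam
    obtain ⟨A, hA, -, hAC⟩ := hC lam hlam
    -- `(lam - 𝓛) (lam ρ + 𝓛 ρ) = lam² ρ`
    have h1 := h.hs_resolvent hA ((lam : ℂ) • ρ + 𝓛 ρ)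
    have h2 : (lam : ℂ) • ((lam : ℂ) • ρ + 𝓛 ρ) - 𝓛 ((lam : ℂ) • ρ + 𝓛 ρ) =
        (lam : ℂ) • (lam : ℂ) • ρ := by
      rw [map_add, map_smul, hρ]
      module
    rw [h2, hs_add_right, hs_smul_right, hs_smul_right, hs_smul_right] at h1
    have h3 : hs B (𝓛 ρ) = (lam : ℂ) * ((lam : ℂ) * hs A ρ - hs B ρ) := by
      rw [mul_sub, ← h1]; ring
    rw [h3, norm_mul, Complex.norm_real, Real.norm_of_nonneg hlam.le]
    refine mul_le_mul_of_nonneg_left ((norm_sub_le _ _).trans ?_) hlam.le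
    gcongr
  have hlim : Filter.Tendsto (fun lam : ℝ => lam * (C + ‖hs B ρ‖)) (nhdsWithin 0 (Set.Ioi 0))
      (nhds 0) := by
    have : Filter.Tendsto (fun lam : ℝ => lam * (C + ‖hs B ρ‖)) (nhds 0)
        (nhds (0 * (C + ‖hs B ρ‖))) := (continuous_id.mul continuous_const).tendsto 0
    rw [zero_mul] at this
    exact this.mono_left nhdsWithin_le_nhds
  have := ge_of_tendsto hlim (Filter.eventually_of_mem self_mem_nhdsWithin hbound)
  exact norm_le_zero_iff.1 this

lemma IsJumpForm.isCompl_ker_range (h : IsJumpForm 𝓛 F K) :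
    IsCompl (LinearMap.ker (𝓛 : Matrix n n ℂ →ₗ[ℂ] Matrix n n ℂ))
      (LinearMap.range (𝓛 : Matrix n n ℂ →ₗ[ℂ] Matrix n n ℂ)) := by
  have hd : Disjoint (LinearMap.ker (𝓛 : Matrix n n ℂ →ₗ[ℂ] Matrix n n ℂ))
      (LinearMap.range (𝓛 : Matrix n n ℂ →ₗ[ℂ] Matrix n n ℂ)) := by
    rw [Submodule.disjoint_def]
    rintro _ hx ⟨y, rfl⟩
    exact h.apply_eq_zero_of_apply_apply hx
  refine IsCompl.of_eq hd.eq_bot ?_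
  refine Submodule.eq_top_of_disjoint _ _ ?_ hd
  rw [add_comm]
  exact (LinearMap.finrank_range_add_finrank_ker _).ge

/-- The functional `⟨⟨A| · ⟩⟩`. -/
def hsLinear (A : Matrix n n ℂ) : Matrix n n ℂ →ₗ[ℂ] ℂ where
  toFun := hs A
  map_add' := hs_add_right A
  map_smul' c B := hs_smul_right c A B

/-- Every linear functional is of the form `⟨⟨J| · ⟩⟩`. -/
lemma exists_hs_eq (f : Matrix n n ℂ →ₗ[ℂ] ℂ) : ∃ J : Matrix n n ℂ, ∀ A, hs J A = f A := by
  refine ⟨Matrix.of fun i j => star (f (Matrix.single i j 1)), fun A => ?_⟩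
  conv_rhs => rw [Matrix.matrix_eq_sum_single A]
  simp only [map_sum]
  rw [hs, Matrix.trace, Finset.sum_comm]
  refine Finset.sum_congr rfl fun j _ => ?_
  rw [Matrix.diag_apply, Matrix.mul_apply]
  refine Finset.sum_congr rfl fun i _ => ?_
  have : Matrix.single i j (A i j) = A i j • Matrix.single i j (1 : ℂ) := by
    rw [Matrix.smul_single, smul_eq_mul, mul_one]
  rw [this, map_smul, smul_eq_mul, mul_comm]
  simp

end Resolvent

section AsymptoticProjection

variable {n : Type} [Fintype n] [DecidableEq n] {𝓛 : Superop n}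

lemma asymptoticSubspace_eq_ker (hst : IsSteady 𝓛) :
    asymptoticSubspace 𝓛 = LinearMap.ker (𝓛 : Matrix n n ℂ →ₗ[ℂ] Matrix n n ℂ) := by
  apply le_antisymm
  · intro ρ hρ
    exact hst ρ hρ
  · refine le_trans ?_ (le_iSup _ (0 : ℝ))
    intro ρ hρ
    rw [Module.End.mem_eigenspace_iff]
    simpa using hρ

lemma mem_asymptoticSubspace_iff (hst : IsSteady 𝓛) {ρ : Matrix n n ℂ} :
    ρ ∈ asymptoticSubspace 𝓛 ↔ 𝓛 ρ = 0 := by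
  rw [asymptoticSubspace_eq_ker hst]
  rfl

/-- If the asymptotic subspace is steady, there are no conserved quantities of nonzero frequency,
and the joint kernel of the conserved quantities is the range of the generator. -/
lemma conservedAnnihilator_eq_range (hL : IsLindbladian 𝓛) (hst : IsSteady 𝓛) :
    conservedAnnihilator 𝓛 = LinearMap.range (𝓛 : Matrix n n ℂ →ₗ[ℂ] Matrix n n ℂ) := by
  obtain ⟨r, F, K, h⟩ := hL.exists_jumpForm
  apply le_antisymm
  · intro ρ hρ
    -- test against the functionals that factor through the projection onto the kernel
    have hc := h.isCompl_ker_range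
    set π := Submodule.projection (LinearMap.ker (𝓛 : Matrix n n ℂ →ₗ[ℂ] Matrix n n ℂ)) _ hc
      with hπ
    have h0 : π ρ = 0 := by
      refine eq_zero_of_forall_hs fun B => ?_
      obtain ⟨J, hJ⟩ := exists_hs_eq
        (hsLinear B ∘ₗ π)
      have := hρ 0 J (fun σ => by
        rw [hJ]
        have : π (𝓛 σ) = 0 := by
          rw [← LinearMap.mem_ker, hπ, Submodule.ker_projection]
          exact ⟨σ, rfl⟩
        simp [this])
      rw [hJ] at this
      exact this
    rw [← LinearMap.mem_ker, hπ, Submodule.ker_projection] at h0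
    exact h0
  · rintro _ ⟨σ, rfl⟩ Δ J hJ
    refine (hJ σ).trans ?_
    by_cases hΔ : Δ = 0
    · simp [hΔ]
    -- `iΔ` is not an eigenvalue, so `𝓛 - iΔ` is onto and `J = 0`
    have hinj : Function.Injective ((𝓛 : Matrix n n ℂ →ₗ[ℂ] Matrix n n ℂ) -
        (Complex.I * (Δ : ℂ)) • (LinearMap.id : Matrix n n ℂ →ₗ[ℂ] Matrix n n ℂ)) := by
      rw [← LinearMap.ker_eq_bot, LinearMap.ker_eq_bot']
      intro τ hτ
      have h1 : 𝓛 τ = (Complex.I * (Δ : ℂ)) • τ := by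
        simpa [sub_eq_zero] using hτ
      have h2 : τ ∈ asymptoticSubspace 𝓛 := by
        refine (le_iSup (fun Δ : ℝ => Module.End.eigenspace
          (𝓛 : Matrix n n ℂ →ₗ[ℂ] Matrix n n ℂ) (Complex.I * (Δ : ℂ))) Δ) ?_
        rw [Module.End.mem_eigenspace_iff]
        exact h1
      rw [hst τ h2] at h1
      refine (smul_eq_zero.1 h1.symm).resolve_left ?_
      simp [hΔ]
    obtain ⟨τ, hτ⟩ := (LinearMap.injective_iff_surjective.1 hinj) σ
    rw [← hτ]
    simp [hs_sub_right, hs_smul_right, hJ]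

lemma isCompl_asymptoticSubspace (hL : IsLindbladian 𝓛) (hst : IsSteady 𝓛) :
    IsCompl (asymptoticSubspace 𝓛) (conservedAnnihilator 𝓛) := by
  obtain ⟨r, F, K, h⟩ := hL.exists_jumpForm
  rw [asymptoticSubspace_eq_ker hst, conservedAnnihilator_eq_range hL hst]
  exact h.isCompl_ker_range

lemma asymptoticProjection_apply (hL : IsLindbladian 𝓛) (hst : IsSteady 𝓛) (ρ : Matrix n n ℂ) :
    asymptoticProjection 𝓛 ρ =
      Submodule.projection _ _ (isCompl_asymptoticSubspace hL hst) ρ := by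
  rw [asymptoticProjection, dif_pos (isCompl_asymptoticSubspace hL hst)]
  rfl

lemma asymptoticProjection_mem (hL : IsLindbladian 𝓛) (hst : IsSteady 𝓛) (ρ : Matrix n n ℂ) :
    asymptoticProjection 𝓛 ρ ∈ asymptoticSubspace 𝓛 := by
  rw [asymptoticProjection_apply hL hst]
  exact Submodule.projection_apply_mem _ _

lemma asymptoticProjection_of_mem (hL : IsLindbladian 𝓛) (hst : IsSteady 𝓛) {ρ : Matrix n n ℂ}
    (hρ : ρ ∈ asymptoticSubspace 𝓛) : asymptoticProjection 𝓛 ρ = ρ := by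
  rw [asymptoticProjection_apply hL hst]
  exact Submodule.projection_apply_left _ ⟨ρ, hρ⟩

lemma asymptoticProjection_generator (hL : IsLindbladian 𝓛) (hst : IsSteady 𝓛)
    (ρ : Matrix n n ℂ) : asymptoticProjection 𝓛 (𝓛 ρ) = 0 := by
  rw [asymptoticProjection_apply hL hst, ← LinearMap.mem_ker, Submodule.ker_projection,
    conservedAnnihilator_eq_range hL hst]
  exact ⟨ρ, rfl⟩

lemma exists_eq_asymptoticProjection_add (hL : IsLindbladian 𝓛) (hst : IsSteady 𝓛)
    (ρ : Matrix n n ℂ) : ∃ τ, ρ = asymptoticProjection 𝓛 ρ + 𝓛 τ := by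
  have h1 : ρ - asymptoticProjection 𝓛 ρ ∈
      LinearMap.range (𝓛 : Matrix n n ℂ →ₗ[ℂ] Matrix n n ℂ) := by
    rw [← conservedAnnihilator_eq_range hL hst,
      ← Submodule.ker_projection (isCompl_asymptoticSubspace hL hst), LinearMap.mem_ker, map_sub,
      ← asymptoticProjection_apply hL hst, ← asymptoticProjection_apply hL hst,
      asymptoticProjection_of_mem hL hst (asymptoticProjection_mem hL hst ρ), sub_self]
  obtain ⟨τ, hτ⟩ := h1
  have hτ' : 𝓛 τ = ρ - asymptoticProjection 𝓛 ρ := hτ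
  exact ⟨τ, by rw [hτ']; abel⟩

/-- Conserved quantities do not see the difference between an operator and its asymptotic part. -/
lemma hs_asymptoticProjection (hL : IsLindbladian 𝓛) (hst : IsSteady 𝓛) {J : Matrix n n ℂ}
    (hJ : ∀ σ, hs J (𝓛 σ) = 0) (ρ : Matrix n n ℂ) : hs J (asymptoticProjection 𝓛 ρ) = hs J ρ := by
  obtain ⟨τ, hτ⟩ := exists_eq_asymptoticProjection_add hL hst ρ
  conv_rhs => rw [hτ]
  rw [hs_add_right, hJ, add_zero]

/-- The asymptotic projection is determined by the conserved quantities. -/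
lemma asymptoticProjection_eq_of_forall_hs (hL : IsLindbladian 𝓛) (hst : IsSteady 𝓛)
    {ρ σ : Matrix n n ℂ} (h : ∀ J, (∀ τ, hs J (𝓛 τ) = 0) → hs J ρ = hs J σ) :
    asymptoticProjection 𝓛 ρ = asymptoticProjection 𝓛 σ := by
  refine sub_eq_zero.1 (eq_zero_of_forall_hs fun B => ?_)
  obtain ⟨J, hJ⟩ := exists_hs_eq
    (hsLinear B ∘ₗ
      (asymptoticProjection 𝓛 : Matrix n n ℂ →ₗ[ℂ] Matrix n n ℂ))
  have hJ' : ∀ A, hs J A = hs B (asymptoticProjection 𝓛 A) := hJ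
  rw [hs_sub_right, ← hJ', ← hJ', sub_eq_zero]
  refine h J fun τ => ?_
  rw [hJ', asymptoticProjection_generator hL hst, hs_zero_right]

/-- The asymptotic projection is the limit `lam → 0` of the positive maps `lam (lam - 𝓛)⁻¹`, hence
positive. -/
lemma asymptoticProjection_posSemidef (hL : IsLindbladian 𝓛) (hst : IsSteady 𝓛)
    {σ : Matrix n n ℂ} (hσ : σ.PosSemidef) : (asymptoticProjection 𝓛 σ).PosSemidef := by
  obtain ⟨r, F, K, h⟩ := hL.exists_jumpForm
  refine posSemidef_of_forall_hs_nonneg fun B hB => ?_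
  obtain ⟨τ, hτ⟩ := exists_eq_asymptoticProjection_add hL hst σ
  set π := asymptoticProjection 𝓛 σ with hπ
  have hπ0 : 𝓛 π = 0 := hst _ (asymptoticProjection_mem hL hst σ)
  obtain ⟨C, hC⟩ := h.exists_bounded_resolvent hB τ
  have hexp : ∀ lam : ℝ, 0 < lam → ∃ z : ℂ, 0 ≤ z ∧ ‖z - hs B π‖ ≤ lam * (C + ‖hs B τ‖) := by
    intro lam hlam
    obtain ⟨A, hA, hApos, hAC⟩ := hC lam hlam
    refine ⟨lam * hs A σ, mul_nonneg (by exact_mod_cast hlam.le)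
      (hs_nonneg_of_posSemidef hApos hσ), ?_⟩
    have h1 := h.hs_resolvent hA π
    have h2 := h.hs_resolvent hA τ
    rw [hπ0, sub_zero, hs_smul_right] at h1
    rw [hs_sub_right, hs_smul_right] at h2
    have h3 : (lam : ℂ) * hs A σ - hs B π = (lam : ℂ) * ((lam : ℂ) * hs A τ - hs B τ) := by
      rw [hτ, hs_add_right, h1, h2]
      ring
    rw [h3, norm_mul, Complex.norm_real, Real.norm_of_nonneg hlam.le]
    refine mul_le_mul_of_nonneg_left ((norm_sub_le _ _).trans ?_) hlam.le
    gcongr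
  choose! z hz0 hz using hexp
  have hlim : Filter.Tendsto z (nhdsWithin 0 (Set.Ioi 0)) (nhds (hs B π)) := by
    rw [tendsto_iff_norm_sub_tendsto_zero]
    have hlin : Filter.Tendsto (fun lam : ℝ => lam * (C + ‖hs B τ‖)) (nhdsWithin 0 (Set.Ioi 0))
        (nhds 0) := by
      have : Filter.Tendsto (fun lam : ℝ => lam * (C + ‖hs B τ‖)) (nhds 0)
          (nhds (0 * (C + ‖hs B τ‖))) := (continuous_id.mul continuous_const).tendsto 0
      rw [zero_mul] at this
      exact this.mono_left nhdsWithin_le_nhds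
    exact squeeze_zero' (Filter.Eventually.of_forall fun _ => norm_nonneg _)
      (Filter.eventually_of_mem self_mem_nhdsWithin hz) hlin
  exact ge_of_tendsto hlim (Filter.eventually_of_mem self_mem_nhdsWithin hz0)

end AsymptoticProjection

/-! ### The non-decaying subspace and the corners of conserved quantities -/

section RangeProjection

variable {n : Type} [Fintype n] [DecidableEq n]

lemma toEuclideanLin_projMatrix (W : Submodule ℂ (EuclideanSpace ℂ n)) (v : EuclideanSpace ℂ n) :
    Matrix.toEuclideanLin (projMatrix W) v = W.starProjection v := by
  rw [projMatrix, LinearEquiv.apply_symm_apply]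
  rfl

lemma projMatrix_isHermitian (W : Submodule ℂ (EuclideanSpace ℂ n)) :
    (projMatrix W).IsHermitian := by
  rw [← Matrix.isSymmetric_toEuclideanLin_iff, projMatrix, LinearEquiv.apply_symm_apply]
  exact W.starProjection_isSymmetric

lemma toEuclideanLin_mul_apply (A B : Matrix n n ℂ) (v : EuclideanSpace ℂ n) :
    Matrix.toEuclideanLin (A * B) v = Matrix.toEuclideanLin A (Matrix.toEuclideanLin B v) := by
  simp [Matrix.toLpLin_apply, Matrix.mulVec_mulVec]

lemma projMatrix_mul_eq_self {W : Submodule ℂ (EuclideanSpace ℂ n)} {A : Matrix n n ℂ}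
    (h : LinearMap.range (Matrix.toEuclideanLin A) ≤ W) : projMatrix W * A = A := by
  apply Matrix.toEuclideanLin.injective
  ext1 v
  rw [toEuclideanLin_mul_apply, toEuclideanLin_projMatrix,
    Submodule.starProjection_eq_self_iff.2 (h ⟨v, rfl⟩)]

lemma range_mul_le (A B : Matrix n n ℂ) : LinearMap.range (Matrix.toEuclideanLin (A * B)) ≤
    LinearMap.range (Matrix.toEuclideanLin A) := by
  rintro _ ⟨v, rfl⟩
  rw [toEuclideanLin_mul_apply]
  exact ⟨_, rfl⟩

lemma exists_eq_mul_of_range_le {A B : Matrix n n ℂ}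
    (h : LinearMap.range (Matrix.toEuclideanLin B) ≤ LinearMap.range (Matrix.toEuclideanLin A)) :
    ∃ R, B = A * R := by
  have h1 : ∀ j : n, ∃ w : EuclideanSpace ℂ n, Matrix.toEuclideanLin A w =
      Matrix.toEuclideanLin B (EuclideanSpace.single j 1) := fun j => h ⟨_, rfl⟩
  choose w hw using h1
  refine ⟨Matrix.of fun i j => w j i, ?_⟩
  ext i j
  have h2 := congrArg (fun u : EuclideanSpace ℂ n => u i) (hw j)
  simp only [Matrix.toLpLin_apply, PiLp.ofLp_single, Matrix.mulVec_single_one] at h2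
  exact h2.symm

lemma rangeProj_isHermitian (A : Matrix n n ℂ) : (rangeProj A).IsHermitian :=
  projMatrix_isHermitian _

lemma rangeProj_mul_self (A : Matrix n n ℂ) : rangeProj A * A = A :=
  projMatrix_mul_eq_self le_rfl

lemma exists_rangeProj_eq_mul (A : Matrix n n ℂ) : ∃ R, rangeProj A = A * R := by
  refine exists_eq_mul_of_range_le ?_
  rintro _ ⟨v, rfl⟩
  rw [rangeProj, toEuclideanLin_projMatrix]
  exact Submodule.starProjection_apply_mem _ _

lemma rangeProj_mul_rangeProj (A : Matrix n n ℂ) : rangeProj A * rangeProj A = rangeProj A := by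
  obtain ⟨R, hR⟩ := exists_rangeProj_eq_mul A
  conv_lhs => rw [hR, ← Matrix.mul_assoc, ← hR, rangeProj_mul_self]
  exact hR.symm

/-- A Hermitian matrix that fixes the columns of `A` and factors through `A` is the orthogonal
projection onto its range. -/
lemma eq_rangeProj {A P : Matrix n n ℂ} (hP : P.IsHermitian) (hPA : P * A = A)
    (hR : ∃ R, P = A * R) : P = rangeProj A := by
  obtain ⟨R, hR⟩ := hR
  obtain ⟨R', hR'⟩ := exists_rangeProj_eq_mul A
  have h1 : rangeProj A * P = P := by
    rw [hR, ← Matrix.mul_assoc, rangeProj_mul_self]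
  have h2 : P * rangeProj A = rangeProj A := by
    rw [hR', ← Matrix.mul_assoc, hPA]
  have h3 := congrArg Matrix.conjTranspose h1
  rw [Matrix.conjTranspose_mul, hP.eq, (rangeProj_isHermitian A).eq] at h3
  rw [← h3, h2]

/-- A positive matrix with a vanishing diagonal corner has vanishing off-diagonal corners. -/
lemma mul_eq_zero_of_mul_mul_conjTranspose {A Q : Matrix n n ℂ} (hA : A.PosSemidef)
    (h : Q * A * Qᴴ = 0) : Q * A = 0 := by
  obtain ⟨C, rfl⟩ := PosSemidef.exists_eq_conjTranspose_mul_self hA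
  have h1 : (C * Qᴴ)ᴴ * (C * Qᴴ) = 0 := by
    rw [Matrix.conjTranspose_mul, Matrix.conjTranspose_conjTranspose, ← h]
    simp only [Matrix.mul_assoc]
  have h2 := Matrix.conjTranspose_mul_self_eq_zero.1 h1
  have h3 := congrArg Matrix.conjTranspose h2
  rw [Matrix.conjTranspose_mul, Matrix.conjTranspose_conjTranspose, Matrix.conjTranspose_zero] at h3
  rw [← Matrix.mul_assoc, h3, Matrix.zero_mul]

end RangeProjection

section Corners

variable {n : Type} [Fintype n] [DecidableEq n] {𝓛 : Superop n}

/-- A steady operator through which all asymptotic operators factor carries the whole non-decaying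
subspace. -/
lemma nonDecayingProj_eq_rangeProj {ρ₀ : Matrix n n ℂ} (hρ₀ : ρ₀ ∈ asymptoticSubspace 𝓛)
    (h : ∀ σ ∈ asymptoticSubspace 𝓛, ∃ R, σ = ρ₀ * R) : nonDecayingProj 𝓛 = rangeProj ρ₀ := by
  rw [nonDecayingProj, rangeProj]
  congr 1
  apply le_antisymm
  · refine iSup₂_le fun σ hσ => ?_
    obtain ⟨R, rfl⟩ := h σ hσ
    exact range_mul_le _ _
  · exact le_iSup₂ (f := fun ρ (_ : ρ ∈ asymptoticSubspace 𝓛) =>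
      LinearMap.range (Matrix.toEuclideanLin ρ)) ρ₀ hρ₀

lemma nonDecayingProj_isHermitian (𝓛 : Superop n) : (nonDecayingProj 𝓛).IsHermitian :=
  projMatrix_isHermitian _

/-- The image of the identity under the asymptotic projection is a steady state of maximal
support. -/
lemma exists_maximal_steady (hL : IsLindbladian 𝓛) (hst : IsSteady 𝓛) :
    ∃ ρ₀ ∈ asymptoticSubspace 𝓛, ρ₀.PosSemidef ∧ nonDecayingProj 𝓛 = rangeProj ρ₀ := by
  refine ⟨asymptoticProjection 𝓛 1, asymptoticProjection_mem hL hst 1,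
    asymptoticProjection_posSemidef hL hst Matrix.PosSemidef.one,
    nonDecayingProj_eq_rangeProj (asymptoticProjection_mem hL hst 1) ?_⟩
  set ρ₀ := asymptoticProjection 𝓛 1 with hρ₀
  obtain ⟨R, hR⟩ := exists_rangeProj_eq_mul ρ₀
  have hQρ : (1 - rangeProj ρ₀) * ρ₀ = 0 := by
    rw [Matrix.sub_mul, rangeProj_mul_self, Matrix.one_mul, sub_self]
  -- a positive `σ ≤ c` has `0 ≤ 𝒫_∞ σ ≤ c 𝒫_∞ 1`, so its image is supported where `𝒫_∞ 1` is
  have key : ∀ σ : Matrix n n ℂ, (1 - rangeProj ρ₀) * asymptoticProjection 𝓛 σ = 0 := by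
    refine posSemidef_span_induction ?_ ?_ ?_
    · intro σ hσ
      obtain ⟨c, hc, hcσ⟩ := posSemidef_exists_le hσ
      have h1 := asymptoticProjection_posSemidef hL hst hσ
      have h2 := asymptoticProjection_posSemidef hL hst hcσ
      rw [map_sub, map_smul, ← hρ₀] at h2
      refine mul_eq_zero_of_mul_mul_conjTranspose h1 ?_
      have h3 := h1.mul_mul_conjTranspose_same (1 - rangeProj ρ₀)
      have h4 := h2.mul_mul_conjTranspose_same (1 - rangeProj ρ₀)
      rw [Matrix.mul_sub, Matrix.mul_smul, hQρ, smul_zero, zero_sub, Matrix.neg_mul] at h4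
      open scoped MatrixOrder in
      exact le_antisymm (by rw [Matrix.le_iff, zero_sub]; exact h4)
        (Matrix.nonneg_iff_posSemidef.2 h3)
    · intro A B hA hB
      rw [map_add, Matrix.mul_add, hA, hB, add_zero]
    · intro c A hA
      rw [map_smul, Matrix.mul_smul, hA, smul_zero]
  intro σ hσ
  have h1 := key σ
  rw [asymptoticProjection_of_mem hL hst hσ, Matrix.sub_mul, Matrix.one_mul, sub_eq_zero] at h1
  exact ⟨R * σ, by rw [← Matrix.mul_assoc, ← hR, ← h1]⟩

lemma nonDecayingProj_mul {σ : Matrix n n ℂ} (hσ : σ ∈ asymptoticSubspace 𝓛) :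
    nonDecayingProj 𝓛 * σ = σ :=
  projMatrix_mul_eq_self (le_iSup₂ (f := fun ρ (_ : ρ ∈ asymptoticSubspace 𝓛) =>
      LinearMap.range (Matrix.toEuclideanLin ρ)) σ hσ)

lemma conjTranspose_mem_asymptoticSubspace (hL : IsLindbladian 𝓛) (hst : IsSteady 𝓛)
    {σ : Matrix n n ℂ} (hσ : σ ∈ asymptoticSubspace 𝓛) : σᴴ ∈ asymptoticSubspace 𝓛 := by
  obtain ⟨r, F, K, h⟩ := hL.exists_jumpForm
  rw [mem_asymptoticSubspace_iff hst] at hσ ⊢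
  rw [h.conjTranspose, hσ, Matrix.conjTranspose_zero]

lemma mul_nonDecayingProj (hL : IsLindbladian 𝓛) (hst : IsSteady 𝓛) {σ : Matrix n n ℂ}
    (hσ : σ ∈ asymptoticSubspace 𝓛) : σ * nonDecayingProj 𝓛 = σ := by
  have h1 := congrArg Matrix.conjTranspose
    (nonDecayingProj_mul (conjTranspose_mem_asymptoticSubspace hL hst hσ))
  rwa [Matrix.conjTranspose_mul, Matrix.conjTranspose_conjTranspose,
    (nonDecayingProj_isHermitian 𝓛).eq] at h1

lemma conserved_conjTranspose (hL : IsLindbladian 𝓛) {J : Matrix n n ℂ}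
    (hJ : ∀ σ, hs J (𝓛 σ) = 0) : ∀ σ, hs Jᴴ (𝓛 σ) = 0 := by
  obtain ⟨r, F, K, h⟩ := hL.exists_jumpForm
  intro σ
  have h1 : heisenbergGen F K J = 0 :=
    eq_of_forall_hs fun C => by rw [← h.hs_apply, hJ, hs_zero_left]
  rw [h.hs_apply, heisenbergGen_conjTranspose, h1, Matrix.conjTranspose_zero, hs_zero_left]

/-- The dissipation of a conserved quantity: `L†(J†J) = ∑ [F, J]†[F, J]`. -/
lemma IsJumpForm.heisenbergGen_conjTranspose_mul_self {r : ℕ} {F : Fin r → Matrix n n ℂ}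
    {K : Matrix n n ℂ} (h : IsJumpForm 𝓛 F K) {J : Matrix n n ℂ} (hJ : heisenbergGen F K J = 0) :
    heisenbergGen F K (Jᴴ * J) = ∑ l, (F l * J - J * F l)ᴴ * (F l * J - J * F l) := by
  have h1 : heisenbergGen F K Jᴴ = 0 := by
    rw [heisenbergGen_conjTranspose, hJ, Matrix.conjTranspose_zero]
  have h2 : heisenbergGen F K (Jᴴ * J) = heisenbergGen F K (Jᴴ * J) - heisenbergGen F K Jᴴ * J
      - Jᴴ * heisenbergGen F K J + Jᴴ * (Kᴴ + K + ∑ l, (F l)ᴴ * F l) * J := by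
    rw [h1, hJ, h.balance]; simp
  rw [h2]
  simp only [heisenbergGen_apply, Matrix.add_mul, Matrix.mul_add, Finset.sum_mul, Finset.mul_sum,
    Matrix.conjTranspose_sub, Matrix.conjTranspose_mul, Matrix.sub_mul, Matrix.mul_sub,
    Finset.sum_sub_distrib, Matrix.mul_assoc]
  abel

/-- A conserved quantity commutes with the jump operators and with the effective Hamiltonian on the
support of a steady state, because its dissipation has zero expectation there. Hence it maps that
steady state to an asymptotic operator. -/
lemma conserved_mul_mem (hL : IsLindbladian 𝓛) (hst : IsSteady 𝓛) {J ρ₀ : Matrix n n ℂ}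
    (hJ : ∀ σ, hs J (𝓛 σ) = 0) (hρ₀ : ρ₀ ∈ asymptoticSubspace 𝓛) (hpos : ρ₀.PosSemidef) :
    J * ρ₀ ∈ asymptoticSubspace 𝓛 := by
  obtain ⟨r, F, K, h⟩ := hL.exists_jumpForm
  have hJ0 : heisenbergGen F K J = 0 :=
    eq_of_forall_hs fun C => by rw [← h.hs_apply, hJ, hs_zero_left]
  have hρ := hst _ hρ₀
  have hdis : ∑ l, ((F l * J - J * F l) * ρ₀ * (F l * J - J * F l)ᴴ).trace = 0 := by
    have h1 := h.hs_apply (Jᴴ * J) ρ₀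
    rw [hρ, hs_zero_right, h.heisenbergGen_conjTranspose_mul_self hJ0, hs_sum_left] at h1
    rw [h1]
    refine Finset.sum_congr rfl fun l _ => ?_
    rw [hs, Matrix.conjTranspose_mul, Matrix.conjTranspose_conjTranspose, Matrix.mul_assoc _ _ ρ₀,
      Matrix.trace_mul_comm]
  have hF : ∀ l, (F l * J - J * F l) * ρ₀ = 0 := by
    intro l
    have hp := fun l => hpos.mul_mul_conjTranspose_same (F l * J - J * F l)
    have h2 := (Finset.sum_eq_zero_iff_of_nonneg fun l _ => (hp l).trace_nonneg).1 hdis l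
      (Finset.mem_univ l)
    refine mul_eq_zero_of_mul_mul_conjTranspose hpos ?_
    obtain ⟨C, hC⟩ := PosSemidef.exists_eq_conjTranspose_mul_self (hp l)
    rw [hC] at h2 ⊢
    rw [Matrix.trace_conjTranspose_mul_self_eq_zero_iff.1 h2, Matrix.mul_zero]
  have hF' : ∀ l, F l * J * ρ₀ = J * F l * ρ₀ := by
    intro l
    have := hF l
    rwa [Matrix.sub_mul, sub_eq_zero] at this
  have hK : K * J * ρ₀ = J * K * ρ₀ := by
    have h1 := congrArg (· * ρ₀) hJ0
    simp only [heisenbergGen_apply, Matrix.add_mul, Finset.sum_mul, Matrix.zero_mul] at h1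
    have h2 : ∑ l, (F l)ᴴ * J * F l * ρ₀ = (∑ l, (F l)ᴴ * F l) * (J * ρ₀) := by
      rw [Finset.sum_mul]
      refine Finset.sum_congr rfl fun l _ => ?_
      rw [Matrix.mul_assoc, Matrix.mul_assoc, ← Matrix.mul_assoc J, ← hF' l]
      simp only [Matrix.mul_assoc]
    have h3 : ∑ l, (F l)ᴴ * F l = -Kᴴ - K := by
      rw [eq_sub_iff_add_eq, eq_neg_iff_add_eq_zero, ← h.balance]; abel
    rw [h2, h3, Matrix.sub_mul, Matrix.neg_mul] at h1
    rw [← sub_eq_zero, ← neg_eq_zero, ← h1]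
    simp only [Matrix.mul_assoc]
    abel
  rw [mem_asymptoticSubspace_iff hst, h.apply]
  rw [h.apply] at hρ
  have h4 : ∑ l, F l * (J * ρ₀) * (F l)ᴴ = ∑ l, J * (F l * ρ₀ * (F l)ᴴ) := by
    refine Finset.sum_congr rfl fun l _ => ?_
    rw [← Matrix.mul_assoc, hF' l]
    simp only [Matrix.mul_assoc]
  rw [h4, ← Matrix.mul_assoc K, hK, ← Finset.mul_sum, Matrix.mul_assoc J K, Matrix.mul_assoc J ρ₀,
    ← Matrix.mul_add, ← Matrix.mul_add, hρ, Matrix.mul_zero]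

/-- Conserved quantities leave the non-decaying subspace invariant. -/
lemma conserved_mul_nonDecayingProj (hL : IsLindbladian 𝓛) (hst : IsSteady 𝓛) {J : Matrix n n ℂ}
    (hJ : ∀ σ, hs J (𝓛 σ) = 0) :
    nonDecayingProj 𝓛 * J * nonDecayingProj 𝓛 = J * nonDecayingProj 𝓛 := by
  obtain ⟨ρ₀, hmem, hpos, hP⟩ := exists_maximal_steady hL hst
  obtain ⟨R, hR⟩ := exists_rangeProj_eq_mul ρ₀
  have h1 := nonDecayingProj_mul (conserved_mul_mem hL hst hJ hmem hpos)
  have h2 : nonDecayingProj 𝓛 = ρ₀ * R := hP.trans hR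
  calc nonDecayingProj 𝓛 * J * nonDecayingProj 𝓛
      = nonDecayingProj 𝓛 * (J * ρ₀) * R := by
        conv_lhs => rw [Matrix.mul_assoc]; arg 2; rw [h2]
        simp only [Matrix.mul_assoc]
    _ = J * nonDecayingProj 𝓛 := by rw [h1, Matrix.mul_assoc, ← h2]

lemma nonDecayingProj_mul_conserved (hL : IsLindbladian 𝓛) (hst : IsSteady 𝓛) {J : Matrix n n ℂ}
    (hJ : ∀ σ, hs J (𝓛 σ) = 0) :
    nonDecayingProj 𝓛 * J * nonDecayingProj 𝓛 = nonDecayingProj 𝓛 * J := by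
  have h1 := congrArg Matrix.conjTranspose
    (conserved_mul_nonDecayingProj hL hst (conserved_conjTranspose hL hJ))
  simpa only [Matrix.conjTranspose_mul, Matrix.conjTranspose_conjTranspose,
    (nonDecayingProj_isHermitian 𝓛).eq, ← Matrix.mul_assoc] using h1

lemma upperLeft_apply (𝓛 : Superop n) (A : Matrix n n ℂ) :
    upperLeft 𝓛 A = nonDecayingProj 𝓛 * A * nonDecayingProj 𝓛 := by
  rw [Matrix.mul_assoc]
  rfl

lemma hs_upperLeft (𝓛 : Superop n) (A B : Matrix n n ℂ) :
    hs A (upperLeft 𝓛 B) = hs (upperLeft 𝓛 A) B := by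
  rw [upperLeft_apply, upperLeft_apply, hs_mul_mul, (nonDecayingProj_isHermitian 𝓛).eq]

/-- The block-off-diagonal corners of a conserved quantity vanish, so on operators without a
lower-right corner only its upper-left corner counts. -/
lemma hs_upperLeft_conserved (hL : IsLindbladian 𝓛) (hst : IsSteady 𝓛) {J σ : Matrix n n ℂ}
    (hJ : ∀ τ, hs J (𝓛 τ) = 0)
    (hσ : (1 - nonDecayingProj 𝓛) * σ * (1 - nonDecayingProj 𝓛) = 0) :
    hs (upperLeft 𝓛 J) σ = hs J σ := by
  have h1 := conserved_mul_nonDecayingProj hL hst hJ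
  have h2 := nonDecayingProj_mul_conserved hL hst hJ
  have hQ : (1 - nonDecayingProj 𝓛)ᴴ = 1 - nonDecayingProj 𝓛 := by
    rw [Matrix.conjTranspose_sub, Matrix.conjTranspose_one, (nonDecayingProj_isHermitian 𝓛).eq]
  have h3 : J = upperLeft 𝓛 J + (1 - nonDecayingProj 𝓛) * J * (1 - nonDecayingProj 𝓛) := by
    simp only [upperLeft_apply, Matrix.sub_mul, Matrix.mul_sub, Matrix.one_mul, Matrix.mul_one]
    rw [h1, ← h2, h1]
    abel
  have h4 : hs ((1 - nonDecayingProj 𝓛) * J * (1 - nonDecayingProj 𝓛)) σ = 0 := by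
    have := hs_mul_mul J σ (1 - nonDecayingProj 𝓛) (1 - nonDecayingProj 𝓛)
    rw [hQ, hσ, hs_zero_right] at this
    exact this.symm
  conv_rhs => rw [h3, hs_add_left, h4, add_zero]

lemma minimalProjection_apply (𝓛 : Superop n) (ρ : Matrix n n ℂ) :
    minimalProjection 𝓛 ρ = asymptoticProjection 𝓛 (upperLeft 𝓛 ρ) := rfl

/-- The minimal and the asymptotic projection differ only on lower-right corners. -/
lemma minimalProjection_eq (hL : IsLindbladian 𝓛) (hst : IsSteady 𝓛) {σ : Matrix n n ℂ}
    (hσ : (1 - nonDecayingProj 𝓛) * σ * (1 - nonDecayingProj 𝓛) = 0) :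
    minimalProjection 𝓛 σ = asymptoticProjection 𝓛 σ := by
  rw [minimalProjection_apply]
  refine asymptoticProjection_eq_of_forall_hs hL hst fun J hJ => ?_
  rw [hs_upperLeft, hs_upperLeft_conserved hL hst hJ hσ]

lemma minimalProjection_of_mem (hL : IsLindbladian 𝓛) (hst : IsSteady 𝓛) {σ : Matrix n n ℂ}
    (hσ : σ ∈ asymptoticSubspace 𝓛) : minimalProjection 𝓛 σ = σ := by
  rw [minimalProjection_apply, upperLeft_apply, nonDecayingProj_mul hσ,
    mul_nonDecayingProj hL hst hσ, asymptoticProjection_of_mem hL hst hσ]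

end Corners

/-! ### Path-ordered exponentials as solutions of linear differential equations -/

section PathOrderedExp

open Set

variable {A : Type*} [NormedRing A] [NormedAlgebra ℝ A]

lemma dysonTerm_congr {K K' : ℝ → A} (h : ∀ r ∈ Icc (0 : ℝ) 1, K r = K' r) (k : ℕ) :
    ∀ s ∈ Icc (0 : ℝ) 1, dysonTerm K k s = dysonTerm K' k s := by
  induction k with
  | zero => intro s _; rfl
  | succ k ih =>
    intro s hs
    refine intervalIntegral.integral_congr fun r hr => ?_
    rw [uIcc_of_le hs.1] at hr
    have hr' : r ∈ Icc (0 : ℝ) 1 := ⟨hr.1, hr.2.trans hs.2⟩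
    simp only [h r hr', ih r hr']

lemma continuous_dysonTerm {K : ℝ → A} (hK : Continuous K) (k : ℕ) :
    Continuous (dysonTerm K k) := by
  induction k with
  | zero => exact continuous_const
  | succ k ih =>
    exact intervalIntegral.continuous_primitive (μ := MeasureTheory.volume)
      (fun a b => (hK.mul ih).intervalIntegrable a b) 0

lemma norm_dysonTerm_le {K : ℝ → A} {C : ℝ} (hC : ∀ r, ‖K r‖ ≤ C) (k : ℕ) :
    ∀ s ∈ Icc (0 : ℝ) 1, ‖dysonTerm K k s‖ ≤ ‖(1 : A)‖ * (C ^ k * (s ^ k / k.factorial)) := by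
  have hC0 : 0 ≤ C := (norm_nonneg _).trans (hC 0)
  induction k with
  | zero => intro s _; simp [dysonTerm]
  | succ k ih =>
    intro s hs
    have hint : ∫ r in (0 : ℝ)..s, C * (‖(1 : A)‖ * (C ^ k * (r ^ k / k.factorial))) =
        ‖(1 : A)‖ * (C ^ (k + 1) * (s ^ (k + 1) / (k + 1).factorial)) := by
      simp only [intervalIntegral.integral_const_mul, intervalIntegral.integral_div, integral_pow]
      rw [Nat.factorial_succ]
      push_cast
      field_simp
      ring
    rw [← hint]
    refine intervalIntegral.norm_integral_le_of_norm_le hs.1 ?_ ?_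
    · refine MeasureTheory.ae_of_all _ fun r hr => ?_
      refine (norm_mul_le _ _).trans ?_
      exact mul_le_mul (hC r) (ih r ⟨hr.1.le, hr.2.trans hs.2⟩) (norm_nonneg _) hC0
    · exact Continuous.intervalIntegrable (by fun_prop) _ _

lemma pathOrderedExp_congr {K K' : ℝ → A} (h : ∀ r ∈ Icc (0 : ℝ) 1, K r = K' r) {s : ℝ}
    (hs : s ∈ Icc (0 : ℝ) 1) : pathOrderedExp K s = pathOrderedExp K' s :=
  tsum_congr fun k => dysonTerm_congr h k s hs

lemma pathOrderedExp_zero (K : ℝ → A) : pathOrderedExp K 0 = 1 := by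
  rw [pathOrderedExp, tsum_eq_single 0]
  · rfl
  · intro k hk
    obtain ⟨k, rfl⟩ := Nat.exists_eq_succ_of_ne_zero hk
    exact intervalIntegral.integral_same

variable [CompleteSpace A]

/-- The Dyson series solves the integral equation of the path-ordered exponential. -/
lemma pathOrderedExp_integral_eq {K : ℝ → A} (hK : Continuous K) {C : ℝ} (hC : ∀ r, ‖K r‖ ≤ C) :
    ContinuousOn (pathOrderedExp K) (Icc 0 1) ∧ ∀ s ∈ Icc (0 : ℝ) 1,
      pathOrderedExp K s = 1 + ∫ r in (0 : ℝ)..s, K r * pathOrderedExp K r := by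
  have hC0 : 0 ≤ C := (norm_nonneg _).trans (hC 0)
  set u : ℕ → ℝ := fun k => ‖(1 : A)‖ * (C ^ k / k.factorial) with hu
  have hsum : Summable u := (Real.summable_pow_div_factorial C).mul_left _
  have hbound : ∀ k, ∀ s ∈ Icc (0 : ℝ) 1, ‖dysonTerm K k s‖ ≤ u k := by
    intro k s hs
    refine (norm_dysonTerm_le hC k s hs).trans ?_
    rw [hu]
    refine mul_le_mul_of_nonneg_left ?_ (norm_nonneg _)
    rw [← mul_div_assoc]
    gcongr
    exact mul_le_of_le_one_right (by positivity) (pow_le_one₀ hs.1 hs.2)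
  have hS : ∀ s ∈ Icc (0 : ℝ) 1, Summable fun k => dysonTerm K k s := fun s hs =>
    Summable.of_norm_bounded hsum fun k => hbound k s hs
  refine ⟨continuousOn_tsum (fun k => (continuous_dysonTerm hK k).continuousOn) hsum hbound, ?_⟩
  intro s hs
  let f : ℕ → C(ℝ, A) := fun k => ⟨fun r => K r * dysonTerm K k r,
    hK.mul (continuous_dysonTerm hK k)⟩
  have hf : Summable fun k => ‖(f k).restrict (⟨uIcc 0 s, isCompact_uIcc⟩ :
      TopologicalSpace.Compacts ℝ)‖ := by
    refine Summable.of_nonneg_of_le (fun _ => norm_nonneg _) (fun k => ?_) (hsum.mul_left C)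
    refine (ContinuousMap.norm_le _ (mul_nonneg hC0 ?_)).2 ?_
    · exact (norm_nonneg _).trans (hbound k 0 ⟨le_rfl, zero_le_one⟩)
    · rintro ⟨r, hr⟩
      have hr' : r ∈ uIcc 0 s := hr
      rw [uIcc_of_le hs.1] at hr'
      refine (norm_mul_le _ _).trans ?_
      exact mul_le_mul (hC r) (hbound k r ⟨hr'.1, hr'.2.trans hs.2⟩) (norm_nonneg _) hC0
  have h1 := (intervalIntegral.hasSum_intervalIntegral_of_summable_norm (a := 0) (b := s) (f := f)
    hf).tsum_eq
  rw [pathOrderedExp, (hS s hs).tsum_eq_zero_add]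
  congr 1
  refine Eq.trans h1 ?_
  refine intervalIntegral.integral_congr fun r hr => ?_
  rw [uIcc_of_le hs.1] at hr
  exact (hS r ⟨hr.1, hr.2.trans hs.2⟩).tsum_mul_left (K r)

/-- The fundamental theorem of calculus for an integrand that is continuous on `[0,1]` only. -/
lemma hasDerivWithinAt_primitive {g : ℝ → A} (hg : ContinuousOn g (Icc 0 1)) {s : ℝ}
    (hs : s ∈ Icc (0 : ℝ) 1) :
    HasDerivWithinAt (fun t => ∫ r in (0 : ℝ)..t, g r) (g s) (Icc 0 1) s := by
  set g' : ℝ → A := IccExtend zero_le_one ((Icc (0 : ℝ) 1).domRestrict g) with hg'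
  have hcont : Continuous g' := (continuousOn_iff_continuous_domRestrict.1 hg).Icc_extend'
  have heq : ∀ r ∈ Icc (0 : ℝ) 1, g' r = g r := fun r hr => by
    rw [hg', IccExtend_of_mem _ _ hr]; rfl
  have h1 : HasDerivWithinAt (fun t => ∫ r in (0 : ℝ)..t, g' r) (g' s) (Icc 0 1) s :=
    (intervalIntegral.integral_hasDerivAt_right (hcont.intervalIntegrable _ _)
      hcont.stronglyMeasurable.stronglyMeasurableAtFilter hcont.continuousAt).hasDerivWithinAt
  rw [heq s hs] at h1
  have h2 : ∀ t ∈ Icc (0 : ℝ) 1, ∫ r in (0 : ℝ)..t, g r = ∫ r in (0 : ℝ)..t, g' r := by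
    intro t ht
    refine intervalIntegral.integral_congr fun r hr => ?_
    rw [uIcc_of_le ht.1] at hr
    exact (heq r ⟨hr.1, hr.2.trans ht.2⟩).symm
  exact h1.congr h2 (h2 s hs)

/-- The path-ordered exponential solves `U' = K U` on `[0,1]`. Only the values of `K` on `[0,1]`
matter, so `K` may be extended by constants to the line. -/
lemma hasDerivWithinAt_pathOrderedExp {K : ℝ → A} (hK : ContinuousOn K (Icc 0 1)) {s : ℝ}
    (hs : s ∈ Icc (0 : ℝ) 1) :
    HasDerivWithinAt (pathOrderedExp K) (K s * pathOrderedExp K s) (Icc 0 1) s := by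
  set K' : ℝ → A := IccExtend zero_le_one ((Icc (0 : ℝ) 1).domRestrict K) with hK'
  have hcont : Continuous K' := (continuousOn_iff_continuous_domRestrict.1 hK).Icc_extend'
  have heq : ∀ r ∈ Icc (0 : ℝ) 1, K r = K' r := fun r hr => by
    rw [hK', IccExtend_of_mem _ _ hr]; rfl
  obtain ⟨C, hC⟩ := isCompact_Icc.exists_bound_of_continuousOn hK
  have hC' : ∀ r, ‖K' r‖ ≤ C := fun r => hC _ (projIcc (0 : ℝ) 1 zero_le_one r).2
  obtain ⟨hU, hint⟩ := pathOrderedExp_integral_eq hcont hC'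
  have h1 := (hasDerivWithinAt_primitive (hcont.continuousOn.mul hU) hs).const_add (1 : A)
  have h2 : ∀ t ∈ Icc (0 : ℝ) 1, pathOrderedExp K t =
      1 + ∫ r in (0 : ℝ)..t, (K' r * pathOrderedExp K' r) := fun t ht => by
    rw [pathOrderedExp_congr heq ht, hint t ht]
  rw [heq s hs, pathOrderedExp_congr heq hs]
  exact h1.congr h2 (h2 s hs)

/-- Solutions of a differential equation on `[0,1]` that is Lipschitz in space are determined by
their initial value. -/
lemma ode_unique_unitInterval {E : Type*} [NormedAddCommGroup E] [NormedSpace ℝ E]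
    {v : ℝ → E → E} {C : ℝ} (hv : ∀ t ∈ Icc (0 : ℝ) 1, ∀ x y, ‖v t x - v t y‖ ≤ C * ‖x - y‖)
    {f g : ℝ → E} (hf : ∀ t ∈ Icc (0 : ℝ) 1, HasDerivWithinAt f (v t (f t)) (Icc 0 1) t)
    (hg : ∀ t ∈ Icc (0 : ℝ) 1, HasDerivWithinAt g (v t (g t)) (Icc 0 1) t) (h0 : f 0 = g 0) :
    ∀ t ∈ Icc (0 : ℝ) 1, f t = g t := by
  have hmem : ∀ t ∈ Ico (0 : ℝ) 1, Icc (0 : ℝ) 1 ∈ nhdsWithin t (Ici t) := fun t ht =>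
    Filter.mem_of_superset (Icc_mem_nhdsGE ht.2) (Icc_subset_Icc_left ht.1)
  refine ODE_solution_unique_of_mem_Icc_right (v := v) (s := fun _ => univ) (K := C.toNNReal)
    ?_ (fun t ht => (hf t ht).continuousWithinAt) ?_ (fun _ _ => mem_univ _)
    (fun t ht => (hg t ht).continuousWithinAt) ?_ (fun _ _ => mem_univ _) h0
  · intro t ht
    refine LipschitzWith.lipschitzOnWith ?_
    refine LipschitzWith.of_dist_le_mul fun x y => ?_
    rw [dist_eq_norm, dist_eq_norm]
    refine (hv t (Ico_subset_Icc_self ht) x y).trans ?_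
    gcongr
    exact Real.le_coe_toNNReal C
  · intro t ht
    exact (hf t (Ico_subset_Icc_self ht)).mono_of_mem_nhdsWithin (hmem t ht)
  · intro t ht
    exact (hg t (Ico_subset_Icc_self ht)).mono_of_mem_nhdsWithin (hmem t ht)

/-- The path-ordered exponential is the only solution of `X' = K X` with `X 0 = 1`. -/
lemma eq_pathOrderedExp {K X : ℝ → A} (hK : ContinuousOn K (Icc 0 1))
    (hX : ∀ t ∈ Icc (0 : ℝ) 1, HasDerivWithinAt X (K t * X t) (Icc 0 1) t) (h0 : X 0 = 1) :
    ∀ t ∈ Icc (0 : ℝ) 1, X t = pathOrderedExp K t := by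
  obtain ⟨C, hC⟩ := isCompact_Icc.exists_bound_of_continuousOn hK
  refine ode_unique_unitInterval (v := fun t x => K t * x) (C := C) ?_ hX
    (fun t ht => hasDerivWithinAt_pathOrderedExp hK ht) (by rw [h0, pathOrderedExp_zero])
  intro t ht x y
  rw [← mul_sub]
  exact (norm_mul_le _ _).trans (mul_le_mul_of_nonneg_right (hC t ht) (norm_nonneg _))

end PathOrderedExp

section SuperopODE

open Set

variable {n : Type} [Fintype n] [DecidableEq n]

lemma hasDerivWithinAt_superop_apply {U : ℝ → Superop n} {U' : Superop n} {s : Set ℝ} {t : ℝ}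
    (hU : HasDerivWithinAt U U' s t) (ρ : Matrix n n ℂ) :
    HasDerivWithinAt (fun r => U r ρ) (U' ρ) s t :=
  ((ContinuousLinearMap.apply ℂ (Matrix n n ℂ) ρ).restrictScalars
    ℝ).hasFDerivAt.comp_hasDerivWithinAt t hU

/-- A path-ordered exponential of superoperators propagates the solutions of the corresponding
linear differential equation. -/
lemma pathOrderedExp_apply_eq {K : ℝ → Superop n} (hK : ContinuousOn K (Icc 0 1))
    {w : ℝ → Matrix n n ℂ}
    (hw : ∀ t ∈ Icc (0 : ℝ) 1, HasDerivWithinAt w (K t (w t)) (Icc 0 1) t) :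
    ∀ t ∈ Icc (0 : ℝ) 1, pathOrderedExp K t (w 0) = w t := by
  obtain ⟨C, hC⟩ := isCompact_Icc.exists_bound_of_continuousOn hK
  refine ode_unique_unitInterval (v := fun t x => K t x) (C := C) ?_
    (fun t ht => ?_) hw
    (by rw [pathOrderedExp_zero]; rfl)
  swap
  · have h := hasDerivWithinAt_pathOrderedExp (A := Superop n) hK ht
    exact hasDerivWithinAt_superop_apply h (w 0)
  intro t ht x y
  rw [← map_sub]
  exact (ContinuousLinearMap.le_opNorm _ _).trans
    (mul_le_mul_of_nonneg_right (hC t ht) (norm_nonneg _))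

end SuperopODE

/-! ### Conserved quantities dual to a basis -/

section Dual

variable {n ι : Type} [Fintype n] [DecidableEq n] [Fintype ι] [DecidableEq ι] {𝓛 : Superop n}
  {Ψ J : ι → Matrix n n ℂ}

lemma IsConservedDual.asymptoticProjection_eq (hL : IsLindbladian 𝓛) (hst : IsSteady 𝓛)
    (hΨ : IsSteadyBasis 𝓛 Ψ) (hJ : IsConservedDual 𝓛 Ψ J) (ρ : Matrix n n ℂ) :
    asymptoticProjection 𝓛 ρ = ∑ μ, hs (J μ) ρ • Ψ μ := by
  have h1 := asymptoticProjection_mem hL hst ρ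
  rw [← hΨ.2, Submodule.mem_span_range_iff_exists_fun] at h1
  obtain ⟨c, hc⟩ := h1
  rw [← hc]
  refine Finset.sum_congr rfl fun μ _ => ?_
  rw [← hs_asymptoticProjection hL hst (hJ.1 μ), ← hc, hs_sum_right]
  simp [hs_smul_right, hJ.2]

lemma IsConservedDual.minimalProjection_eq (hL : IsLindbladian 𝓛) (hst : IsSteady 𝓛)
    (hΨ : IsSteadyBasis 𝓛 Ψ) (hJ : IsConservedDual 𝓛 Ψ J) (ρ : Matrix n n ℂ) :
    minimalProjection 𝓛 ρ = ∑ μ, hs (upperLeft 𝓛 (J μ)) ρ • Ψ μ := by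
  rw [minimalProjection_apply, hJ.asymptoticProjection_eq hL hst hΨ]
  simp only [hs_upperLeft]

/-- The dual conserved quantities represent the functionals that read off the coordinates of the
asymptotic part of an operator. -/
lemma IsSteadyBasis.existsUnique_dual (hL : IsLindbladian 𝓛) (hst : IsSteady 𝓛)
    (hΨ : IsSteadyBasis 𝓛 Ψ) : ∃! J : ι → Matrix n n ℂ, IsConservedDual 𝓛 Ψ J := by
  have hmem : ∀ ρ, asymptoticProjection 𝓛 ρ ∈ Submodule.span ℂ (Set.range Ψ) := fun ρ => by
    rw [hΨ.2]; exact asymptoticProjection_mem hL hst ρ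
  let f : ι → Matrix n n ℂ →ₗ[ℂ] ℂ := fun μ => Finsupp.lapply μ ∘ₗ
    (hΨ.1.repr : _ →ₗ[ℂ] (ι →₀ ℂ)) ∘ₗ LinearMap.codRestrict _
      (asymptoticProjection 𝓛 : Matrix n n ℂ →ₗ[ℂ] Matrix n n ℂ) hmem
  have hf : ∀ μ ρ, f μ ρ = hΨ.1.repr ⟨asymptoticProjection 𝓛 ρ, hmem ρ⟩ μ := fun μ ρ => rfl
  choose J hJ using fun μ => exists_hs_eq (f μ)
  have hJd : IsConservedDual 𝓛 Ψ J := by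
    refine ⟨fun μ σ => ?_, fun μ ν => ?_⟩
    · have h0 : (⟨asymptoticProjection 𝓛 (𝓛 σ), hmem (𝓛 σ)⟩ :
          Submodule.span ℂ (Set.range Ψ)) = 0 :=
        Subtype.ext (asymptoticProjection_generator hL hst σ)
      rw [hJ, hf, h0, map_zero]
      rfl
    · have hν : Ψ ν ∈ asymptoticSubspace 𝓛 := by
        rw [← hΨ.2]; exact Submodule.subset_span ⟨ν, rfl⟩
      rw [hJ, hf, hΨ.1.repr_eq_single ν _ (asymptoticProjection_of_mem hL hst hν),
        Finsupp.single_apply]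
      simp only [eq_comm]
  refine ⟨J, hJd, fun J' hJ' => ?_⟩
  funext μ
  refine eq_of_forall_hs fun ρ => ?_
  have h1 := hJ'.asymptoticProjection_eq hL hst hΨ ρ
  rw [hJd.asymptoticProjection_eq hL hst hΨ ρ, ← sub_eq_zero, ← Finset.sum_sub_distrib] at h1
  simp only [← sub_smul] at h1
  exact (sub_eq_zero.1 (Fintype.linearIndependent_iff.1 hΨ.1 _ h1 μ)).symm

end Dual

/-! ### Calculus of matrix and superoperator valued functions -/

section Calculus

open Set

variable {n : Type} [Fintype n] [DecidableEq n]

lemma hasDerivWithinAt_linear_comp {E G : Type*} [NormedAddCommGroup E] [NormedSpace ℝ E]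
    [FiniteDimensional ℝ E] [NormedAddCommGroup G] [NormedSpace ℝ G] (f : E →ₗ[ℝ] G) {u : ℝ → E}
    {u' : E} {s : Set ℝ} {t : ℝ} (hu : HasDerivWithinAt u u' s t) :
    HasDerivWithinAt (fun r => f (u r)) (f u') s t :=
  (LinearMap.toContinuousLinearMap f).hasFDerivAt.comp_hasDerivWithinAt t hu

lemma fderiv_linear_comp {X E G : Type*} [NormedAddCommGroup X] [NormedSpace ℝ X]
    [NormedAddCommGroup E] [NormedSpace ℝ E]
    [FiniteDimensional ℝ E] [NormedAddCommGroup G] [NormedSpace ℝ G] (f : E →ₗ[ℝ] G) {u : X → E}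
    {x : X} (hu : DifferentiableAt ℝ u x) (e : X) :
    fderiv ℝ (fun y => f (u y)) x e = f (fderiv ℝ u x e) := by
  have := ((LinearMap.toContinuousLinearMap f).hasFDerivAt.comp x hu.hasFDerivAt).fderiv
  exact congrArg (fun T => T e) this

lemma continuousOn_linear_comp {X E G : Type*} [TopologicalSpace X]
    [NormedAddCommGroup E] [NormedSpace ℝ E]
    [FiniteDimensional ℝ E] [NormedAddCommGroup G] [NormedSpace ℝ G] (f : E →ₗ[ℝ] G) {u : X → E}
    {s : Set X} (hu : ContinuousOn u s) : ContinuousOn (fun y => f (u y)) s :=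
  (LinearMap.toContinuousLinearMap f).continuous.comp_continuousOn hu

/-- A nonnegative function has vanishing derivative at its zeros. -/
lemma fderiv_eq_zero_of_eventually_nonneg {X : Type*} [NormedAddCommGroup X] [NormedSpace ℝ X]
    {f : X → ℂ} {x : X} (hf : DifferentiableAt ℝ f x) (hpos : ∀ᶠ y in nhds x, 0 ≤ f y)
    (hzero : f x = 0) : fderiv ℝ f x = 0 := by
  have hre : fderiv ℝ (fun y => Complex.reLm (f y)) x = 0 := by
    refine IsLocalMin.fderiv_eq_zero ?_
    filter_upwards [hpos] with y hy
    change (f x).re ≤ (f y).re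
    rw [hzero]
    exact (Complex.le_def.1 hy).1
  have him : fderiv ℝ (fun y => Complex.imLm (f y)) x = 0 := by
    have : (fun y => Complex.imLm (f y)) =ᶠ[nhds x] fun _ => 0 := by
      filter_upwards [hpos] with y hy
      exact (Complex.le_def.1 hy).2.symm
    rw [this.fderiv_eq]
    simp
  ext e
  have hre' := fderiv_linear_comp Complex.reLm hf e
  have him' := fderiv_linear_comp Complex.imLm hf e
  rw [hre] at hre'
  rw [him] at him'
  exact Complex.ext hre'.symm him'.symm

lemma contDiffOn_linear_comp {X E G : Type*} [NormedAddCommGroup X] [NormedSpace ℝ X]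
    [NormedAddCommGroup E] [NormedSpace ℝ E]
    [FiniteDimensional ℝ E] [NormedAddCommGroup G] [NormedSpace ℝ G] (f : E →ₗ[ℝ] G) {u : X → E}
    {s : Set X} {k : WithTop ℕ∞} (hu : ContDiffOn ℝ k u s) :
    ContDiffOn ℝ k (fun y => f (u y)) s :=
  (LinearMap.toContinuousLinearMap f).contDiff.comp_contDiffOn hu

/-- Superoperators as real-linear maps. -/
def superopReal : Superop n →L[ℝ] (Matrix n n ℂ →L[ℝ] Matrix n n ℂ) :=
  ContinuousLinearMap.restrictScalarsL ℂ (Matrix n n ℂ) (Matrix n n ℂ) ℝ ℝ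

lemma hasDerivWithinAt_superop_apply_apply {U : ℝ → Superop n} {U' : Superop n}
    {w : ℝ → Matrix n n ℂ} {w' : Matrix n n ℂ} {s : Set ℝ} {t : ℝ}
    (hU : HasDerivWithinAt U U' s t) (hw : HasDerivWithinAt w w' s t) :
    HasDerivWithinAt (fun r => U r (w r)) (U' (w t) + U t w') s t := by
  have h1 : HasDerivWithinAt (fun r => superopReal (U r)) (superopReal U') s t :=
    HasFDerivAt.comp_hasDerivWithinAt (F := Superop n) (E := Matrix n n ℂ →L[ℝ] Matrix n n ℂ) t
      superopReal.hasFDerivAt hU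
  exact h1.clm_apply hw

lemma differentiableAt_superop_apply {X : Type*} [NormedAddCommGroup X] [NormedSpace ℝ X]
    {U : X → Superop n} {x : X} (hU : DifferentiableAt ℝ U x) (ρ : Matrix n n ℂ) :
    DifferentiableAt ℝ (fun y => U y ρ) x := by
  have h1 : HasFDerivAt (fun y => superopReal (U y)) (superopReal.comp (fderiv ℝ U x)) x :=
    HasFDerivAt.comp (F := Superop n) (G := Matrix n n ℂ →L[ℝ] Matrix n n ℂ) x
      superopReal.hasFDerivAt hU.hasFDerivAt
  exact (h1.clm_apply (hasFDerivAt_const ρ x)).differentiableAt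

lemma fderiv_superop_apply_apply {X : Type*} [NormedAddCommGroup X] [NormedSpace ℝ X]
    {U : X → Superop n} {w : X → Matrix n n ℂ} {x : X}
    (hU : DifferentiableAt ℝ U x) (hw : DifferentiableAt ℝ w x) (e : X) :
    fderiv ℝ (fun y => U y (w y)) x e = fderiv ℝ U x e (w x) + U x (fderiv ℝ w x e) := by
  have h1 : HasFDerivAt (fun y => superopReal (U y)) (superopReal.comp (fderiv ℝ U x)) x :=
    HasFDerivAt.comp (F := Superop n) (G := Matrix n n ℂ →L[ℝ] Matrix n n ℂ) x
      superopReal.hasFDerivAt hU.hasFDerivAt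
  have h2 := (h1.clm_apply hw.hasFDerivAt).fderiv
  have h3 := congrArg (fun T => T e) h2
  refine Eq.trans h3 ?_
  rw [add_comm]
  rfl

lemma hasDerivWithinAt_matrix {ι ι' : Type} [Fintype ι] [DecidableEq ι] [Fintype ι']
    [DecidableEq ι'] {X : ℝ → Matrix ι ι' ℂ} {X' : Matrix ι ι' ℂ} {s : Set ℝ} {t : ℝ}
    (h : ∀ i j, HasDerivWithinAt (fun r => X r i j) (X' i j) s t) : HasDerivWithinAt X X' s t := by
  have h1 : HasDerivWithinAt (fun r i j => X r i j) (fun i j => X' i j) s t :=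
    hasDerivWithinAt_pi.2 fun i => hasDerivWithinAt_pi.2 fun j => h i j
  exact hasDerivWithinAt_linear_comp
    (Matrix.ofLinearEquiv ℝ : (ι → ι' → ℂ) ≃ₗ[ℝ] Matrix ι ι' ℂ).toLinearMap h1

lemma hasDerivWithinAt_entry {ι ι' : Type} [Fintype ι] [DecidableEq ι] [Fintype ι']
    [DecidableEq ι'] {X : ℝ → Matrix ι ι' ℂ} {X' : Matrix ι ι' ℂ} {s : Set ℝ} {t : ℝ}
    (h : HasDerivWithinAt X X' s t) (i : ι) (j : ι') :
    HasDerivWithinAt (fun r => X r i j) (X' i j) s t :=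
  hasDerivWithinAt_linear_comp (Matrix.entryLinearMap ℝ ℂ i j) h

lemma continuousOn_matrix {X : Type*} [TopologicalSpace X] {ι ι' : Type} {f : X → Matrix ι ι' ℂ}
    {s : Set X} (h : ∀ i j, ContinuousOn (fun x => f x i j) s) : ContinuousOn f s :=
  continuousOn_pi.2 fun i => continuousOn_pi.2 fun j => h i j

lemma continuousOn_hs {X : Type*} [TopologicalSpace X] {f g : X → Matrix n n ℂ} {s : Set X}
    (hf : ContinuousOn f s) (hg : ContinuousOn g s) : ContinuousOn (fun x => hs (f x) (g x)) s := by
  have h1 : ContinuousOn (fun x => ((f x)ᴴ * g x).trace) s := by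
    have := hf.star
    fun_prop
  exact h1

end Calculus

section Paths

open Set

variable {m : ℕ} {M : Set (Fin m → ℝ)} {γ : ℝ → Fin m → ℝ}

lemma IsPath.hasDerivWithinAt (hγ : IsPath M γ) {t : ℝ} (ht : t ∈ Icc (0 : ℝ) 1) :
    HasDerivWithinAt γ (fun α => velocity γ α t) (Icc 0 1) t :=
  ((hγ.1.differentiableOn one_ne_zero) t ht).hasDerivWithinAt

lemma IsPath.continuousOn_velocity (hγ : IsPath M γ) (α : Fin m) :
    ContinuousOn (velocity γ α) (Icc 0 1) :=
  continuousOn_pi.1 (hγ.1.continuousOn_derivWithin (uniqueDiffOn_Icc zero_lt_one) le_rfl) α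

/-- The total derivative as the sum of the coordinate derivatives. -/
lemma fderiv_eq_sum_pd {V : Type*} [NormedAddCommGroup V] [NormedSpace ℝ V]
    (f : (Fin m → ℝ) → V) (x v : Fin m → ℝ) : fderiv ℝ f x v = ∑ α, v α • pd α f x := by
  conv_lhs => rw [pi_eq_sum_univ' v]
  rw [map_sum]
  refine Finset.sum_congr rfl fun α _ => ?_
  rw [map_smul, pd]

/-- The chain rule along a path. -/
lemma IsPath.hasDerivWithinAt_comp {V : Type*} [NormedAddCommGroup V] [NormedSpace ℝ V]
    (hγ : IsPath M γ) {f : (Fin m → ℝ) → V} {t : ℝ} (ht : t ∈ Icc (0 : ℝ) 1)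
    (hf : DifferentiableAt ℝ f (γ t)) :
    HasDerivWithinAt (fun r => f (γ r)) (∑ α, velocity γ α t • pd α f (γ t)) (Icc 0 1) t := by
  rw [← fderiv_eq_sum_pd f (γ t) fun α => velocity γ α t]
  exact hf.hasFDerivAt.comp_hasDerivWithinAt t (hγ.hasDerivWithinAt ht)

lemma differentiableAt_of_contDiffOn {V : Type*} [NormedAddCommGroup V] [NormedSpace ℝ V]
    (hM : IsOpen M) {f : (Fin m → ℝ) → V} (hf : ContDiffOn ℝ 1 f M) {x : Fin m → ℝ} (hx : x ∈ M) :
    DifferentiableAt ℝ f x :=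
  (hf.differentiableOn one_ne_zero).differentiableAt (hM.mem_nhds hx)

lemma continuousOn_pd {V : Type*} [NormedAddCommGroup V] [NormedSpace ℝ V]
    (hM : IsOpen M) {f : (Fin m → ℝ) → V} (hf : ContDiffOn ℝ 1 f M) (α : Fin m) :
    ContinuousOn (pd α f) M :=
  (hf.continuousOn_fderiv_of_isOpen hM le_rfl).clm_apply continuousOn_const

lemma IsPath.continuousOn_comp {V : Type*} [TopologicalSpace V]
    (hγ : IsPath M γ) {f : (Fin m → ℝ) → V} (hf : ContinuousOn f M) :
    ContinuousOn (fun t => f (γ t)) (Icc 0 1) :=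
  hf.comp hγ.1.continuousOn hγ.2

/-- The generator of a coordinate holonomy is continuous along the path. -/
lemma IsPath.continuousOn_generator {ι : Type} [Fintype ι] [DecidableEq ι] (hγ : IsPath M γ) (c : ℂ)
    {A : Fin m → (Fin m → ℝ) → Matrix ι ι ℂ} (hA : ∀ α, ContinuousOn (A α) M) :
    ContinuousOn (fun r => c • ∑ α, (velocity γ α r : ℂ) • A α (γ r)) (Icc 0 1) := by
  refine ContinuousOn.const_smul (continuousOn_finsetSum _ fun α _ => ?_) c
  exact (Complex.continuous_ofReal.comp_continuousOn (hγ.continuousOn_velocity α)).smul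
    (hγ.continuousOn_comp (hA α))

end Paths

/-! ### Derivatives of asymptotic operators and parallel transport -/

section Transport

open Set

variable {n : Type} [Fintype n] [DecidableEq n] {m : ℕ} {M : Set (Fin m → ℝ)}
  {𝓛 : (Fin m → ℝ) → Superop n}

/-- The lower-right corner of the derivative of the asymptotic projection vanishes: for positive
`σ` and `B` the function `y ↦ ⟨⟨B| Q (𝒫_∞(y) σ) Q⟩⟩` is nonnegative and attains the value zero at
`x`, whatever the rank of the non-decaying projection does near `x`. -/
lemma corner_fderiv_asymptoticProjection (hM : IsOpen M) (hL : ∀ x ∈ M, IsLindbladian (𝓛 x))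
    (hst : ∀ x ∈ M, IsSteady (𝓛 x)) {x : Fin m → ℝ} (hx : x ∈ M)
    (hd : DifferentiableAt ℝ (fun y => asymptoticProjection (𝓛 y)) x) (e : Fin m → ℝ)
    (σ : Matrix n n ℂ) :
    (1 - nonDecayingProj (𝓛 x)) * (fderiv ℝ (fun y => asymptoticProjection (𝓛 y)) x e σ) *
      (1 - nonDecayingProj (𝓛 x)) = 0 := by
  set Q := 1 - nonDecayingProj (𝓛 x) with hQ
  have hQh : Qᴴ = Q := by
    rw [hQ, Matrix.conjTranspose_sub, Matrix.conjTranspose_one, (nonDecayingProj_isHermitian _).eq]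
  refine posSemidef_span_induction (p := fun σ => Q * (fderiv ℝ
    (fun y => asymptoticProjection (𝓛 y)) x e σ) * Q = 0) ?_ ?_ ?_ σ
  · intro σ hσ
    refine eq_zero_of_forall_posSemidef_hs fun B hB => ?_
    let T : Matrix n n ℂ →ₗ[ℝ] ℂ := (hsLinear B ∘ₗ LinearMap.mulRight ℂ Q ∘ₗ
      LinearMap.mulLeft ℂ Q).restrictScalars ℝ
    have hpos : ∀ y ∈ M, 0 ≤ T (asymptoticProjection (𝓛 y) σ) := by
      intro y hy
      refine hs_nonneg_of_posSemidef hB ?_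
      have := (asymptoticProjection_posSemidef (hL y hy) (hst y hy) hσ).mul_mul_conjTranspose_same Q
      rwa [hQh] at this
    have hzero : T (asymptoticProjection (𝓛 x) σ) = 0 := by
      have h1 : Q * asymptoticProjection (𝓛 x) σ = 0 := by
        rw [hQ, Matrix.sub_mul,
          nonDecayingProj_mul (asymptoticProjection_mem (hL x hx) (hst x hx) σ), Matrix.one_mul,
          sub_self]
      change hs B (Q * asymptoticProjection (𝓛 x) σ * Q) = 0
      rw [h1, Matrix.zero_mul, hs_zero_right]
    have hσd := differentiableAt_superop_apply hd σ
    have hDσ : fderiv ℝ (fun y => asymptoticProjection (𝓛 y) σ) x e =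
        fderiv ℝ (fun y => asymptoticProjection (𝓛 y)) x e σ := by
      simpa using fderiv_superop_apply_apply hd (differentiableAt_const σ) e
    have hTd : DifferentiableAt ℝ (fun y => T (asymptoticProjection (𝓛 y) σ)) x :=
      (LinearMap.toContinuousLinearMap T).differentiableAt.comp x hσd
    have h1 := fderiv_linear_comp T hσd e
    rw [fderiv_eq_zero_of_eventually_nonneg hTd
      (Filter.eventually_of_mem (hM.mem_nhds hx) hpos) hzero, hDσ] at h1
    exact h1.symm
  · intro A B hA hB
    rw [map_add, Matrix.mul_add, Matrix.add_mul, hA, hB, add_zero]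
  · intro c A hA
    rw [map_smul, Matrix.mul_smul, Matrix.smul_mul, hA, smul_zero]

/-- Differentiating `w = 𝒫_∞ w` shows that asymptotic operators move without a lower-right
corner. -/
lemma corner_fderiv_of_mem (hM : IsOpen M) (hL : ∀ x ∈ M, IsLindbladian (𝓛 x))
    (hst : ∀ x ∈ M, IsSteady (𝓛 x))
    (hdiff : ContDiffOn ℝ 1 (fun x => asymptoticProjection (𝓛 x)) M)
    {w : (Fin m → ℝ) → Matrix n n ℂ} (hw : ∀ x ∈ M, w x ∈ asymptoticSubspace (𝓛 x))
    {x : Fin m → ℝ} (hx : x ∈ M) (hwd : DifferentiableAt ℝ w x) (e : Fin m → ℝ) :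
    (1 - nonDecayingProj (𝓛 x)) * fderiv ℝ w x e * (1 - nonDecayingProj (𝓛 x)) = 0 := by
  have hd := differentiableAt_of_contDiffOn hM hdiff hx
  have h1 : w =ᶠ[nhds x] fun y => asymptoticProjection (𝓛 y) (w y) := by
    filter_upwards [hM.mem_nhds hx] with y hy
    exact (asymptoticProjection_of_mem (hL y hy) (hst y hy) (hw y hy)).symm
  have h2 : fderiv ℝ w x e = fderiv ℝ (fun y => asymptoticProjection (𝓛 y)) x e (w x) +
      asymptoticProjection (𝓛 x) (fderiv ℝ w x e) := by
    rw [← fderiv_superop_apply_apply hd hwd e, ← h1.fderiv_eq]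
  rw [h2, Matrix.mul_add, Matrix.add_mul,
    corner_fderiv_asymptoticProjection hM hL hst hx hd e (w x), zero_add, Matrix.sub_mul,
    nonDecayingProj_mul (asymptoticProjection_mem (hL x hx) (hst x hx) _), Matrix.one_mul, sub_self,
    Matrix.zero_mul]

variable {Q : (Fin m → ℝ) → Superop n} {γ : ℝ → Fin m → ℝ}

lemma IsPath.hasDerivWithinAt_superop (hM : IsOpen M) (hQ : ContDiffOn ℝ 1 Q M) (hγ : IsPath M γ)
    {t : ℝ} (ht : t ∈ Icc (0 : ℝ) 1) :
    HasDerivWithinAt (fun r => Q (γ r)) (derivWithin (fun r => Q (γ r)) (Icc 0 1) t) (Icc 0 1) t :=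
  ((hγ.hasDerivWithinAt_comp ht
    (differentiableAt_of_contDiffOn hM hQ (hγ.2 t ht))).differentiableWithinAt).hasDerivWithinAt

lemma IsPath.continuousOn_superop_generator (hQ : ContDiffOn ℝ 1 Q M)
    (hγ : IsPath M γ) : ContinuousOn
      (fun r => derivWithin (fun t => Q (γ t)) (Icc 0 1) r * Q (γ r)) (Icc 0 1) := by
  have h1 : ContDiffOn ℝ 1 (fun t => Q (γ t)) (Icc 0 1) := hQ.comp hγ.1 hγ.2
  exact (h1.continuousOn_derivWithin (uniqueDiffOn_Icc zero_lt_one) le_rfl).mul h1.continuousOn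

/-- The operator holonomy of a family `Q` is parallel transport: it carries a curve `w` with
`Q w = w` and `Q w' = 0` from its initial to its current value. -/
lemma operatorHolonomy_apply_eq (hM : IsOpen M) (hQ : ContDiffOn ℝ 1 Q M) (hγ : IsPath M γ)
    {w w' : ℝ → Matrix n n ℂ}
    (hw : ∀ t ∈ Icc (0 : ℝ) 1, HasDerivWithinAt w (w' t) (Icc 0 1) t)
    (hfix : ∀ t ∈ Icc (0 : ℝ) 1, Q (γ t) (w t) = w t)
    (hhor : ∀ t ∈ Icc (0 : ℝ) 1, Q (γ t) (w' t) = 0) :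
    ∀ t ∈ Icc (0 : ℝ) 1, operatorHolonomy Q γ t (w 0) = w t := by
  refine pathOrderedExp_apply_eq (hγ.continuousOn_superop_generator hQ) fun t ht => ?_
  have h1 := hasDerivWithinAt_superop_apply_apply (hγ.hasDerivWithinAt_superop hM hQ ht) (hw t ht)
  rw [hhor t ht, add_zero] at h1
  have h2 := h1.congr (fun r hr => (hfix r hr).symm) (hfix t ht).symm
  rw [mul_apply_eq_comp, hfix t ht]
  exact h2

/-- The operator holonomy of a family of projections, as a differential equation. The transported
operators stay in the range of the projections and move horizontally. -/
lemma operatorHolonomy_horizontal (hM : IsOpen M) (hQ : ContDiffOn ℝ 1 Q M) (hγ : IsPath M γ)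
    (hproj : ∀ x ∈ M, ∀ ρ, Q x (Q x ρ) = Q x ρ) {ρ : Matrix n n ℂ} (hρ : Q (γ 0) ρ = ρ) :
    ∃ w' : ℝ → Matrix n n ℂ, ∀ t ∈ Icc (0 : ℝ) 1,
      HasDerivWithinAt (fun r => operatorHolonomy Q γ r ρ) (w' t) (Icc 0 1) t ∧
      Q (γ t) (operatorHolonomy Q γ t ρ) = operatorHolonomy Q γ t ρ ∧ Q (γ t) (w' t) = 0 := by
  set D : ℝ → Superop n := derivWithin (fun r => Q (γ r)) (Icc 0 1) with hD
  set w : ℝ → Matrix n n ℂ := fun r => operatorHolonomy Q γ r ρ with hw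
  have hQd : ∀ t ∈ Icc (0 : ℝ) 1, HasDerivWithinAt (fun r => Q (γ r)) (D t) (Icc 0 1) t :=
    fun t ht => hγ.hasDerivWithinAt_superop hM hQ ht
  have hwd : ∀ t ∈ Icc (0 : ℝ) 1, HasDerivWithinAt w (D t (Q (γ t) (w t))) (Icc 0 1) t := by
    intro t ht
    have h1 := hasDerivWithinAt_pathOrderedExp (A := Superop n)
      (hγ.continuousOn_superop_generator hQ) ht
    exact hasDerivWithinAt_superop_apply h1 ρ
  -- `Q' Q + Q Q' = Q'`, whence `Q Q' Q = 0`
  have hQDQ : ∀ t ∈ Icc (0 : ℝ) 1, ∀ τ, Q (γ t) (τ) = τ → Q (γ t) (D t τ) = 0 := by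
    intro t ht τ hτ
    have h1 := hasDerivWithinAt_superop_apply (hQd t ht) τ
    have h2 := hasDerivWithinAt_superop_apply_apply (hQd t ht) h1
    have h3 := h2.congr (fun r hr => (hproj _ (hγ.2 r hr) τ).symm) (hproj _ (hγ.2 t ht) τ).symm
    have h4 := (uniqueDiffOn_Icc zero_lt_one t ht).eq_deriv _ h1 h3
    rw [hτ] at h4
    exact left_eq_add.1 h4
  -- `z = w - Q w` solves `z' = -Q' z` with `z 0 = 0`
  have hz : ∀ t ∈ Icc (0 : ℝ) 1, w t - Q (γ t) (w t) = 0 := by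
    have hcont : ContinuousOn D (Icc 0 1) := by
      have h1 : ContDiffOn ℝ 1 (fun t => Q (γ t)) (Icc 0 1) := hQ.comp hγ.1 hγ.2
      exact h1.continuousOn_derivWithin (uniqueDiffOn_Icc zero_lt_one) le_rfl
    obtain ⟨C, hC⟩ := isCompact_Icc.exists_bound_of_continuousOn hcont
    refine ode_unique_unitInterval (v := fun t x => -(D t x)) (C := C) (g := fun _ => 0) ?_ ?_ ?_ ?_
    · intro t ht x y
      rw [neg_sub_neg, ← map_sub, norm_sub_rev x y]
      exact (ContinuousLinearMap.le_opNorm _ _).trans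
        (mul_le_mul_of_nonneg_right (hC t ht) (norm_nonneg _))
    · intro t ht
      have h1 := (hwd t ht).sub (hasDerivWithinAt_superop_apply_apply (hQd t ht) (hwd t ht))
      refine h1.congr_deriv ?_
      rw [hQDQ t ht _ (hproj _ (hγ.2 t ht) _), map_sub]
      abel
    · intro t _
      simpa using hasDerivWithinAt_const t (Icc (0 : ℝ) 1) (0 : Matrix n n ℂ)
    · have h0 : w 0 = ρ := by
        simp only [hw, operatorHolonomy, pathOrderedExp_zero]
        rfl
      change w 0 - Q (γ 0) (w 0) = 0
      rw [h0, hρ, sub_self]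
  refine ⟨fun t => D t (Q (γ t) (w t)), fun t ht => ⟨hwd t ht, ?_, ?_⟩⟩
  · exact (sub_eq_zero.1 (hz t ht)).symm
  · exact hQDQ t ht _ (hproj _ (hγ.2 t ht) _)

/-- Along horizontal curves the asymptotic and the minimal projection agree, so both transport the
same way. -/
lemma operatorHolonomy_minimalProjection (hM : IsOpen M) (hL : ∀ x ∈ M, IsLindbladian (𝓛 x))
    (hst : ∀ x ∈ M, IsSteady (𝓛 x))
    (hdiff : ContDiffOn ℝ 1 (fun x => asymptoticProjection (𝓛 x)) M)
    (hmin : ContDiffOn ℝ 1 (fun x => minimalProjection (𝓛 x)) M) (hγ : IsPath M γ) {s : ℝ}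
    (hs : s ∈ Icc (0 : ℝ) 1) {ρ : Matrix n n ℂ} (hρ : ρ ∈ asymptoticSubspace (𝓛 (γ 0))) :
    operatorHolonomy (fun x => asymptoticProjection (𝓛 x)) γ s ρ =
      operatorHolonomy (fun x => minimalProjection (𝓛 x)) γ s ρ := by
  have h0 : (0 : ℝ) ∈ Icc (0 : ℝ) 1 := ⟨le_rfl, zero_le_one⟩
  obtain ⟨w', hw'⟩ := operatorHolonomy_horizontal hM hdiff hγ
    (fun x hx ρ => asymptoticProjection_of_mem (hL x hx) (hst x hx)
      (asymptoticProjection_mem (hL x hx) (hst x hx) ρ))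
    (asymptoticProjection_of_mem (hL _ (hγ.2 0 h0)) (hst _ (hγ.2 0 h0)) hρ)
  set w : ℝ → Matrix n n ℂ := fun r => operatorHolonomy (fun x => asymptoticProjection (𝓛 x)) γ r ρ
    with hw
  have hmem : ∀ t ∈ Icc (0 : ℝ) 1, w t ∈ asymptoticSubspace (𝓛 (γ t)) := fun t ht => by
    change operatorHolonomy (fun x => asymptoticProjection (𝓛 x)) γ t ρ ∈ _
    rw [← (hw' t ht).2.1]
    exact asymptoticProjection_mem (hL _ (hγ.2 t ht)) (hst _ (hγ.2 t ht)) _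
  have hw0 : w 0 = ρ := by
    simp only [hw, operatorHolonomy, pathOrderedExp_zero]
    rfl
  have key := operatorHolonomy_apply_eq hM hmin hγ (w := w) (w' := w')
    (fun t ht => (hw' t ht).1)
    (fun t ht => minimalProjection_of_mem (hL _ (hγ.2 t ht)) (hst _ (hγ.2 t ht)) (hmem t ht))
    ?_ s hs
  · rw [hw0] at key
    exact key.symm
  · intro t ht
    have hx := hγ.2 t ht
    have hd := differentiableAt_of_contDiffOn hM hdiff hx
    rw [minimalProjection_eq (hL _ hx) (hst _ hx), (hw' t ht).2.2]
    have h1 := hasDerivWithinAt_superop_apply_apply (hγ.hasDerivWithinAt_comp ht hd) (hw' t ht).1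
    have h2 := h1.congr (fun r hr => (hw' r hr).2.1.symm) (hw' t ht).2.1.symm
    have h3 := (uniqueDiffOn_Icc zero_lt_one t ht).eq_deriv _ (hw' t ht).1 h2
    rw [(hw' t ht).2.2, add_zero, ← fderiv_eq_sum_pd _ _ fun α => velocity γ α t] at h3
    rw [h3]
    exact corner_fderiv_asymptoticProjection hM hL hst hx hd _ _

end Transport

section Coordinate

open Set

variable {n ι : Type} [Fintype n] [DecidableEq n] [Fintype ι] [DecidableEq ι] {m : ℕ}
  {M : Set (Fin m → ℝ)} {𝓛 : (Fin m → ℝ) → Superop n} {Ψ J : (Fin m → ℝ) → ι → Matrix n n ℂ}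

/-- Coordinates of a moving vector in a moving basis, computed from the Gram matrix, depend
continuously on the parameters. -/
lemma continuousOn_coordinates {X : Type*} [TopologicalSpace X] {s : Set X}
    {Ψ : X → ι → Matrix n n ℂ} {c : X → ι → ℂ}
    (hli : ∀ x ∈ s, LinearIndependent ℂ (Ψ x)) (hΨ : ∀ μ, ContinuousOn (fun x => Ψ x μ) s)
    (hc : ContinuousOn (fun x => ∑ μ, c x μ • Ψ x μ) s) (μ : ι) :
    ContinuousOn (fun x => c x μ) s := by
  let G : X → Matrix ι ι ℂ := fun x => Matrix.of fun κ ν => hs (Ψ x κ) (Ψ x ν)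
  have hdet : ∀ x ∈ s, (G x).det ≠ 0 := by
    intro x hx h0
    obtain ⟨v, hv, hGv⟩ := Matrix.exists_mulVec_eq_zero_iff.2 h0
    have h1 : ∑ ν, v ν • Ψ x ν = 0 := by
      refine eq_zero_of_hs_self ?_
      rw [hs_sum_left]
      refine Finset.sum_eq_zero fun κ _ => ?_
      have h2 := congrFun hGv κ
      rw [hs_smul_left, hs_sum_right]
      simp only [hs_smul_right]
      simp only [Matrix.mulVec, dotProduct, G, Matrix.of_apply, Pi.zero_apply] at h2
      have h3 : ∑ ν, v ν * hs (Ψ x κ) (Ψ x ν) = 0 := by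
        rw [← h2]
        exact Finset.sum_congr rfl fun ν _ => mul_comm _ _
      rw [h3, mul_zero]
    exact hv (funext (Fintype.linearIndependent_iff.1 (hli x hx) v h1))
  have hGc : ∀ x, G x *ᵥ c x = fun κ => hs (Ψ x κ) (∑ ν, c x ν • Ψ x ν) := by
    intro x
    funext κ
    rw [hs_sum_right]
    simp only [hs_smul_right, Matrix.mulVec, dotProduct, G, Matrix.of_apply]
    exact Finset.sum_congr rfl fun ν _ => mul_comm _ _
  have hsol : ∀ x ∈ s, c x μ = ((G x).det)⁻¹ * ∑ κ, (G x).adjugate μ κ *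
      hs (Ψ x κ) (∑ ν, c x ν • Ψ x ν) := by
    intro x hx
    have h1 := congrArg (fun v => ((G x).adjugate *ᵥ v) μ) (hGc x)
    simp only [Matrix.mulVec_mulVec, Matrix.adjugate_mul, Matrix.smul_mulVec, Matrix.one_mulVec,
      Pi.smul_apply, smul_eq_mul] at h1
    have h2 : ((G x).det)⁻¹ * ((G x).det * c x μ) = c x μ := by
      rw [← mul_assoc, inv_mul_cancel₀ (hdet x hx), one_mul]
    rw [← h2, h1]
    rfl
  have hG : ContinuousOn G s := continuousOn_matrix fun κ ν => continuousOn_hs (hΨ κ) (hΨ ν)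
  have hGdet : ContinuousOn (fun x => (G x).det) s :=
    (continuous_id.matrix_det).comp_continuousOn hG
  have hGadj : ∀ κ, ContinuousOn (fun x => (G x).adjugate μ κ) s := fun κ =>
    ((continuous_id.matrix_adjugate).matrix_elem μ κ).comp_continuousOn hG
  refine ContinuousOn.congr ?_ hsol
  exact (hGdet.inv₀ hdet).mul (continuousOn_finsetSum _ fun κ _ =>
    (hGadj κ).mul (continuousOn_hs (hΨ κ) hc))

lemma continuousOn_superop_apply {X : Type*} [TopologicalSpace X] {s : Set X} {U : X → Superop n}
    {w : X → Matrix n n ℂ} (hU : ContinuousOn U s) (hw : ContinuousOn w s) :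
    ContinuousOn (fun x => U x (w x)) s :=
  hU.clm_apply hw

/-- The entries of the connection are the coordinates of `𝒫_∞ ∂_α Ψ_ν` in the basis `Ψ`, so they are
continuous although nothing is assumed about how the conserved quantities vary. -/
lemma continuousOn_adiabaticConnection (hM : IsOpen M) (hL : ∀ x ∈ M, IsLindbladian (𝓛 x))
    (hst : ∀ x ∈ M, IsSteady (𝓛 x))
    (hdiff : ContDiffOn ℝ 1 (fun x => asymptoticProjection (𝓛 x)) M)
    (hΨ : ∀ x ∈ M, IsSteadyBasis (𝓛 x) (Ψ x)) (hΨd : ∀ μ, ContDiffOn ℝ 1 (fun x => Ψ x μ) M)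
    (hJ : ∀ x ∈ M, IsConservedDual (𝓛 x) (Ψ x) (J x)) (α : Fin m) :
    ContinuousOn (adiabaticConnection J Ψ α) M := by
  refine continuousOn_matrix fun μ ν => ?_
  refine continuousOn_coordinates (Ψ := Ψ) (c := fun x μ => adiabaticConnection J Ψ α x μ ν)
    (fun x hx => (hΨ x hx).1) (fun μ => (hΨd μ).continuousOn) ?_ μ
  refine (continuousOn_superop_apply hdiff.continuousOn (continuousOn_pd hM (hΨd ν) α)).congr ?_
  intro x hx
  exact ((hJ x hx).asymptoticProjection_eq (hL x hx) (hst x hx) (hΨ x hx) _).symm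

/-- The coordinate holonomy solves its defining differential equation. -/
lemma hasDerivWithinAt_coordinateHolonomy {γ : ℝ → Fin m → ℝ} (hγ : IsPath M γ) (c : ℂ)
    {A : Fin m → (Fin m → ℝ) → Matrix ι ι ℂ} (hA : ∀ α, ContinuousOn (A α) M) {t : ℝ}
    (ht : t ∈ Icc (0 : ℝ) 1) :
    HasDerivWithinAt (coordinateHolonomy c A γ)
      ((c • ∑ α, (velocity γ α t : ℂ) • A α (γ t)) * coordinateHolonomy c A γ t) (Icc 0 1) t :=
  hasDerivWithinAt_pathOrderedExp (hγ.continuousOn_generator c hA) ht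

/-- The coordinate form of the holonomy is the matrix of its operator form. -/
lemma operatorHolonomy_basis (hM : IsOpen M) (hL : ∀ x ∈ M, IsLindbladian (𝓛 x))
    (hst : ∀ x ∈ M, IsSteady (𝓛 x))
    (hdiff : ContDiffOn ℝ 1 (fun x => asymptoticProjection (𝓛 x)) M)
    (hΨ : ∀ x ∈ M, IsSteadyBasis (𝓛 x) (Ψ x)) (hΨd : ∀ μ, ContDiffOn ℝ 1 (fun x => Ψ x μ) M)
    (hJ : ∀ x ∈ M, IsConservedDual (𝓛 x) (Ψ x) (J x)) {γ : ℝ → Fin m → ℝ} (hγ : IsPath M γ)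
    {s : ℝ} (hs' : s ∈ Icc (0 : ℝ) 1) (ν : ι) :
    operatorHolonomy (fun x => asymptoticProjection (𝓛 x)) γ s (Ψ (γ 0) ν) =
      ∑ μ, coordinateHolonomy (-1) (adiabaticConnection J Ψ) γ s μ ν • Ψ (γ s) μ := by
  set B := coordinateHolonomy (-1) (adiabaticConnection J Ψ) γ with hB
  set K : ℝ → Matrix ι ι ℂ := fun t =>
    (-1 : ℂ) • ∑ α, (velocity γ α t : ℂ) • adiabaticConnection J Ψ α (γ t) with hK
  set dΨ : ι → ℝ → Matrix n n ℂ := fun μ t =>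
    ∑ α, velocity γ α t • pd α (fun x => Ψ x μ) (γ t) with hdΨ
  have hA := continuousOn_adiabaticConnection hM hL hst hdiff hΨ hΨd hJ
  have hBd : ∀ t ∈ Icc (0 : ℝ) 1, HasDerivWithinAt B (K t * B t) (Icc 0 1) t := fun t ht =>
    hasDerivWithinAt_coordinateHolonomy hγ (-1) hA ht
  have hB0 : B 0 = 1 := pathOrderedExp_zero _
  -- the connection measures the vertical part of the motion of the basis
  have hPΨ : ∀ t ∈ Icc (0 : ℝ) 1, ∀ μ,
      asymptoticProjection (𝓛 (γ t)) (dΨ μ t) = -∑ κ, K t κ μ • Ψ (γ t) κ := by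
    intro t ht μ
    have hx := hγ.2 t ht
    rw [(hJ _ hx).asymptoticProjection_eq (hL _ hx) (hst _ hx) (hΨ _ hx), ← Finset.sum_neg_distrib]
    refine Finset.sum_congr rfl fun κ _ => ?_
    rw [← neg_smul]
    congr 1
    simp only [hdΨ, hK, hs_sum_right, Matrix.smul_apply, Matrix.sum_apply, adiabaticConnection,
      Matrix.of_apply, smul_eq_mul, neg_mul, one_mul, neg_neg]
    refine Finset.sum_congr rfl fun α _ => ?_
    rw [← Complex.coe_smul, hs_smul_right]
  have key := operatorHolonomy_apply_eq hM hdiff hγ (w := fun t => ∑ μ, B t μ ν • Ψ (γ t) μ)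
    (w' := fun t => ∑ μ, (B t μ ν • dΨ μ t + (K t * B t) μ ν • Ψ (γ t) μ)) ?_ ?_ ?_ s hs'
  · rw [← key, hB0]
    congr 1
    rw [Finset.sum_eq_single ν]
    · simp
    · intro κ _ hκ
      rw [Matrix.one_apply_ne hκ, zero_smul]
    · simp
  · intro t ht
    refine HasDerivWithinAt.fun_sum fun μ _ => ?_
    exact (hasDerivWithinAt_entry (hBd t ht) μ ν).smul
      (hγ.hasDerivWithinAt_comp ht (differentiableAt_of_contDiffOn hM (hΨd μ) (hγ.2 t ht)))
  · intro t ht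
    have hx := hγ.2 t ht
    refine asymptoticProjection_of_mem (hL _ hx) (hst _ hx) ?_
    refine Submodule.sum_mem _ fun μ _ => Submodule.smul_mem _ _ ?_
    rw [← (hΨ _ hx).2]
    exact Submodule.subset_span ⟨μ, rfl⟩
  · intro t ht
    have hx := hγ.2 t ht
    have hfix : ∀ μ, asymptoticProjection (𝓛 (γ t)) (Ψ (γ t) μ) = Ψ (γ t) μ := fun μ =>
      asymptoticProjection_of_mem (hL _ hx) (hst _ hx) (by
        rw [← (hΨ _ hx).2]; exact Submodule.subset_span ⟨μ, rfl⟩)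
    simp only [map_sum, map_add, map_smul, hPΨ t ht, hfix, Matrix.mul_apply, Finset.sum_add_distrib,
      smul_neg, Finset.smul_sum, Finset.sum_smul, smul_smul, Finset.sum_neg_distrib]
    rw [Finset.sum_comm, neg_add_eq_zero]
    refine Finset.sum_congr rfl fun κ _ => Finset.sum_congr rfl fun μ _ => ?_
    rw [mul_comm]

end Coordinate

/-! ### Block operators and partial traces -/

section Blocks

variable {b : ℕ} {d a : Fin b → ℕ} {q : ℕ} {n : Type} [Fintype n] [DecidableEq n]

/-- The diagonal block `κ` of an operator on the reference space. -/
def diagBlock (κ : Fin b) (Z : Matrix (RefIndex d a q) (RefIndex d a q) ℂ) :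
    Matrix (Fin (d κ) × Fin (a κ)) (Fin (d κ) × Fin (a κ)) ℂ :=
  Z.submatrix (fun p => Sum.inl ⟨κ, p⟩) (fun p => Sum.inl ⟨κ, p⟩)

/-- The partial trace over the second tensor factor. -/
def partialTrace {k l : ℕ} (W : Matrix (Fin k × Fin l) (Fin k × Fin l) ℂ) :
    Matrix (Fin k) (Fin k) ℂ :=
  Matrix.of fun i j => ∑ p, W (i, p) (j, p)

lemma traceAx_eq_partialTrace (κ : Fin b) (Z : Matrix (RefIndex d a q) (RefIndex d a q) ℂ) :
    traceAx κ Z = partialTrace (diagBlock κ Z) := rfl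

lemma partialTrace_conjTranspose {k l : ℕ} (W : Matrix (Fin k × Fin l) (Fin k × Fin l) ℂ) :
    partialTrace Wᴴ = (partialTrace W)ᴴ := by
  ext i j
  simp [partialTrace, Matrix.conjTranspose_apply]

lemma diagBlock_conjTranspose (κ : Fin b) (Z : Matrix (RefIndex d a q) (RefIndex d a q) ℂ) :
    diagBlock κ Zᴴ = (diagBlock κ Z)ᴴ := rfl

/-- Operators on the traced-out factor are cyclic under the partial trace. -/
lemma partialTrace_one_kronecker_mul_comm {k l : ℕ} (R : Matrix (Fin l) (Fin l) ℂ)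
    (W : Matrix (Fin k × Fin l) (Fin k × Fin l) ℂ) :
    partialTrace (((1 : Matrix (Fin k) (Fin k) ℂ) ⊗ₖ R) * W) =
      partialTrace (W * ((1 : Matrix (Fin k) (Fin k) ℂ) ⊗ₖ R)) := by
  ext i j
  simp only [partialTrace, Matrix.of_apply, Matrix.mul_apply, Fintype.sum_prod_type,
    Matrix.kroneckerMap_apply, Matrix.one_apply, ite_mul, one_mul, zero_mul, mul_ite, mul_zero]
  have h1 : ∀ (i : Fin k) (f : Fin k → ℂ), ∑ x, (if i = x then f x else 0) = f i := by simp
  have h2 : ∀ (i : Fin k) (f : Fin k → ℂ), ∑ x, (if x = i then f x else 0) = f i := by simp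
  have h3 : ∀ p : Fin l, ∑ x, ∑ y, (if i = x then R p y * W (x, y) (j, p) else 0) =
      ∑ y, R p y * W (i, y) (j, p) := by
    intro p
    rw [Finset.sum_comm]
    exact Finset.sum_congr rfl fun y _ => h1 i fun x => R p y * W (x, y) (j, p)
  have h4 : ∀ p : Fin l, ∑ x, ∑ y, (if x = j then W (i, p) (x, y) * R y p else 0) =
      ∑ y, W (i, p) (j, y) * R y p := by
    intro p
    rw [Finset.sum_comm]
    exact Finset.sum_congr rfl fun y _ => h2 j fun x => W (i, p) (x, y) * R y p
  simp only [h3, h4]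
  rw [Finset.sum_comm]
  exact Finset.sum_congr rfl fun y _ => Finset.sum_congr rfl fun p _ => mul_comm _ _

lemma trace_kronecker_one_mul {k l : ℕ} (X : Matrix (Fin k) (Fin k) ℂ)
    (W : Matrix (Fin k × Fin l) (Fin k × Fin l) ℂ) :
    ((X ⊗ₖ (1 : Matrix (Fin l) (Fin l) ℂ)) * W).trace = (X * partialTrace W).trace := by
  simp only [partialTrace, Matrix.trace, Matrix.diag_apply, Matrix.of_apply, Matrix.mul_apply,
    Fintype.sum_prod_type, Matrix.kroneckerMap_apply, Matrix.one_apply, mul_ite, mul_one, mul_zero,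
    ite_mul, zero_mul, Finset.sum_ite_eq, Finset.mem_univ, if_true, Finset.mul_sum]
  exact Finset.sum_congr rfl fun i _ => Finset.sum_comm

/-- The partial trace against `R` computes expectation values of `X ⊗ R`. -/
lemma trace_kronecker_mul {k l : ℕ} (X : Matrix (Fin k) (Fin k) ℂ) (R : Matrix (Fin l) (Fin l) ℂ)
    (W : Matrix (Fin k × Fin l) (Fin k × Fin l) ℂ) :
    ((X ⊗ₖ R) * W).trace =
      (X * partialTrace (((1 : Matrix (Fin k) (Fin k) ℂ) ⊗ₖ R) * W)).trace := by
  rw [← trace_kronecker_one_mul, ← Matrix.mul_assoc, ← Matrix.mul_kronecker_mul, Matrix.mul_one,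
    Matrix.one_mul]

lemma blockOp_mul (Y Z : ∀ κ, Matrix (Fin (d κ) × Fin (a κ)) (Fin (d κ) × Fin (a κ)) ℂ) :
    blockOp (q := q) Y * blockOp Z = blockOp fun κ => Y κ * Z κ := by
  simp [blockOp, Matrix.fromBlocks_multiply, Matrix.blockDiagonal'_mul]

lemma blockOp_conjTranspose (Y : ∀ κ, Matrix (Fin (d κ) × Fin (a κ)) (Fin (d κ) × Fin (a κ)) ℂ) :
    (blockOp (q := q) Y)ᴴ = blockOp fun κ => (Y κ)ᴴ := by
  simp [blockOp, Matrix.fromBlocks_conjTranspose, Matrix.blockDiagonal'_conjTranspose]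

lemma diagBlock_blockOp_mul (Y : ∀ κ, Matrix (Fin (d κ) × Fin (a κ)) (Fin (d κ) × Fin (a κ)) ℂ)
    (Z : Matrix (RefIndex d a q) (RefIndex d a q) ℂ) (κ : Fin b) :
    diagBlock κ (blockOp Y * Z) = Y κ * diagBlock κ Z := by
  ext i j
  simp only [diagBlock, Matrix.submatrix_apply, Matrix.mul_apply, Fintype.sum_sum_type, blockOp,
    Matrix.fromBlocks_apply₁₁, Matrix.fromBlocks_apply₁₂, Matrix.zero_apply, zero_mul,
    Finset.sum_const_zero, add_zero]
  rw [Fintype.sum_sigma, Finset.sum_eq_single κ]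
  · simp only [Matrix.blockDiagonal'_apply_eq]
  · intro κ' _ hκ
    refine Finset.sum_eq_zero fun p _ => ?_
    rw [Matrix.blockDiagonal'_apply_ne _ _ _ hκ.symm, zero_mul]
  · simp

lemma trace_blockOp_mul (Y : ∀ κ, Matrix (Fin (d κ) × Fin (a κ)) (Fin (d κ) × Fin (a κ)) ℂ)
    (Z : Matrix (RefIndex d a q) (RefIndex d a q) ℂ) :
    (blockOp Y * Z).trace = ∑ κ, (Y κ * diagBlock κ Z).trace := by
  simp only [← diagBlock_blockOp_mul]
  simp only [Matrix.trace, Fintype.sum_sum_type, Fintype.sum_sigma, Matrix.diag_apply]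
  have h : ∑ x : Fin q, (blockOp (q := q) Y * Z : Matrix (RefIndex d a q) (RefIndex d a q) ℂ)
      (Sum.inr x) (Sum.inr x) = 0 := by
    refine Finset.sum_eq_zero fun x _ => ?_
    simp [Matrix.mul_apply, blockOp]
  rw [h, add_zero]
  rfl

lemma diagBlock_blockOp (Y : ∀ κ, Matrix (Fin (d κ) × Fin (a κ)) (Fin (d κ) × Fin (a κ)) ℂ)
    (κ : Fin b) : diagBlock κ (blockOp (q := q) Y) = Y κ := by
  ext i j
  simp [diagBlock, blockOp]

lemma inFrame_conjTranspose (S : Matrix n (RefIndex d a q) ℂ)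
    (Y : ∀ κ, Matrix (Fin (d κ) × Fin (a κ)) (Fin (d κ) × Fin (a κ)) ℂ) :
    (inFrame S Y)ᴴ = inFrame S fun κ => (Y κ)ᴴ := by
  simp only [inFrame, Matrix.conjTranspose_mul, Matrix.conjTranspose_conjTranspose,
    blockOp_conjTranspose, Matrix.mul_assoc]

lemma inFrame_mul {S : Matrix n (RefIndex d a q) ℂ} (hS : Sᴴ * S = 1)
    (Y Z : ∀ κ, Matrix (Fin (d κ) × Fin (a κ)) (Fin (d κ) × Fin (a κ)) ℂ) :
    inFrame S Y * inFrame S Z = inFrame S fun κ => Y κ * Z κ := by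
  simp only [inFrame, ← blockOp_mul]
  calc S * blockOp (q := q) Y * Sᴴ * (S * blockOp (q := q) Z * Sᴴ)
      = S * blockOp (q := q) Y * (Sᴴ * S) * blockOp (q := q) Z * Sᴴ := by
        simp only [Matrix.mul_assoc]
    _ = S * (blockOp (q := q) Y * blockOp (q := q) Z) * Sᴴ := by
        rw [hS]; simp only [Matrix.mul_assoc, Matrix.one_mul]

/-- The map `Y ↦ S ((⊕ Y_κ) ⊕ 0) S†` is linear. -/
def inFrameLinear (S : Matrix n (RefIndex d a q) ℂ) :
    (∀ κ, Matrix (Fin (d κ) × Fin (a κ)) (Fin (d κ) × Fin (a κ)) ℂ) →ₗ[ℂ] Matrix n n ℂ where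
  toFun := inFrame S
  map_add' Y Z := by
    have : blockOp (q := q) (Y + Z) = blockOp Y + blockOp Z := by
      simp [blockOp, Matrix.fromBlocks_add, Matrix.blockDiagonal'_add]
    simp only [inFrame, this, Matrix.mul_add, Matrix.add_mul]
  map_smul' c Y := by
    have : blockOp (q := q) (c • Y) = c • blockOp Y := by
      simp [blockOp, Matrix.fromBlocks_smul, Matrix.blockDiagonal'_smul]
    simp only [inFrame, this, Matrix.mul_smul, Matrix.smul_mul, RingHom.id_apply]

lemma inFrameLinear_apply (S : Matrix n (RefIndex d a q) ℂ)
    (Y : ∀ κ, Matrix (Fin (d κ) × Fin (a κ)) (Fin (d κ) × Fin (a κ)) ℂ) :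
    inFrameLinear S Y = inFrame S Y := rfl

lemma hs_inFrame (S : Matrix n (RefIndex d a q) ℂ)
    (Y : ∀ κ, Matrix (Fin (d κ) × Fin (a κ)) (Fin (d κ) × Fin (a κ)) ℂ) (ρ : Matrix n n ℂ) :
    hs (inFrame S Y) ρ = ∑ κ, ((Y κ)ᴴ * diagBlock κ (Sᴴ * ρ * S)).trace := by
  rw [← trace_blockOp_mul, hs, inFrame_conjTranspose, inFrame, Matrix.mul_assoc, Matrix.mul_assoc,
    Matrix.trace_mul_comm]
  simp only [Matrix.mul_assoc]

lemma hs_inFrame_inFrame {S : Matrix n (RefIndex d a q) ℂ} (hS : Sᴴ * S = 1)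
    (Y Z : ∀ κ, Matrix (Fin (d κ) × Fin (a κ)) (Fin (d κ) × Fin (a κ)) ℂ) :
    hs (inFrame S Y) (inFrame S Z) = ∑ κ, ((Y κ)ᴴ * Z κ).trace := by
  rw [hs_inFrame]
  have h : Sᴴ * inFrame S Z * S = blockOp Z := by
    rw [inFrame]
    calc Sᴴ * (S * blockOp (q := q) Z * Sᴴ) * S = (Sᴴ * S) * blockOp (q := q) Z * (Sᴴ * S) := by
          simp only [Matrix.mul_assoc]
      _ = blockOp Z := by rw [hS, Matrix.one_mul, Matrix.mul_one]
  simp only [h, diagBlock_blockOp]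

end Blocks

/-! ### Orthonormal operator bases -/

section OperatorBasis

variable {k : ℕ} {B : Fin (k ^ 2) → Matrix (Fin k) (Fin k) ℂ}

/-- An orthonormal family of `k²` operators is a basis. -/
lemma orthonormal_expand (hB : ∀ μ ν, hs (B μ) (B ν) = if μ = ν then 1 else 0)
    (X : Matrix (Fin k) (Fin k) ℂ) : ∑ μ, hs (B μ) X • B μ = X := by
  have hc : ∀ (c : Fin (k ^ 2) → ℂ) (μ), hs (B μ) (∑ ν, c ν • B ν) = c μ := by
    intro c μ
    rw [hs_sum_right]
    simp [hs_smul_right, hB]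
  have hli : LinearIndependent ℂ B := by
    rw [Fintype.linearIndependent_iff]
    intro c h μ
    rw [← hc c μ, h, hs_zero_right]
  have hspan : Submodule.span ℂ (Set.range B) = ⊤ := by
    refine hli.span_eq_top_of_card_eq_finrank' ?_
    rw [Module.finrank_matrix]
    simp [sq]
  have hX : X ∈ Submodule.span ℂ (Set.range B) := by rw [hspan]; trivial
  rw [Submodule.mem_span_range_iff_exists_fun] at hX
  obtain ⟨c, rfl⟩ := hX
  simp only [hc]

/-- The matrix of `-i[W, ·]` acts on coordinates as the commutator does on operators. -/
lemma sum_hamMatrix_mul (hB : ∀ μ ν, hs (B μ) (B ν) = if μ = ν then 1 else 0)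
    (W Z : Matrix (Fin k) (Fin k) ℂ) (μ : Fin (k ^ 2)) :
    ∑ ν, hamMatrix B W μ ν * hs (B ν) Z = hs (B μ) (-Complex.I • (W * Z - Z * W)) := by
  conv_rhs => rw [← orthonormal_expand hB Z]
  simp only [Finset.mul_sum, Finset.sum_mul, ← Finset.sum_sub_distrib, Finset.smul_sum,
    hs_sum_right, hamMatrix, Matrix.of_apply]
  refine Finset.sum_congr rfl fun ν _ => ?_
  rw [Matrix.mul_smul, Matrix.smul_mul, ← smul_sub, smul_comm, hs_smul_right _ _ (_ • _), mul_comm]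

/-- Parseval's identity. -/
lemma sum_hs_mul_hs (hB : ∀ μ ν, hs (B μ) (B ν) = if μ = ν then 1 else 0)
    (Y Z : Matrix (Fin k) (Fin k) ℂ) : ∑ ν, hs Y (B ν) * hs (B ν) Z = hs Y Z := by
  conv_rhs => rw [← orthonormal_expand hB Z, hs_sum_right]
  refine Finset.sum_congr rfl fun ν _ => ?_
  rw [hs_smul_right, mul_comm]

lemma conjMatrix_one (hB : ∀ μ ν, hs (B μ) (B ν) = if μ = ν then 1 else 0) :
    conjMatrix B 1 = 1 := by
  ext μ ν
  simp [conjMatrix, hB, Matrix.one_apply]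

lemma conjMatrix_mul (hB : ∀ μ ν, hs (B μ) (B ν) = if μ = ν then 1 else 0)
    (U V : Matrix (Fin k) (Fin k) ℂ) : conjMatrix B U * conjMatrix B V = conjMatrix B (U * V) := by
  ext μ ν
  simp only [Matrix.mul_apply, conjMatrix, Matrix.of_apply]
  have h1 : ∀ ν, hs (B μ) (U * B ν * Uᴴ) = hs (Uᴴ * B μ * U) (B ν) := fun ν => by
    rw [hs_mul_mul, Matrix.conjTranspose_conjTranspose]
  have h2 : U * V * B ν * (U * V)ᴴ = U * (V * B ν * Vᴴ) * Uᴴ := by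
    rw [Matrix.conjTranspose_mul]
    simp only [Matrix.mul_assoc]
  have h3 : hs (Uᴴ * B μ * U) (V * B ν * Vᴴ) = hs (B μ) (U * (V * B ν * Vᴴ) * Uᴴ) := by
    rw [hs_mul_mul (B μ) _ U, Matrix.conjTranspose_conjTranspose]
  simp only [h1]
  rw [sum_hs_mul_hs hB, h2, h3]

lemma conjMatrix_conjTranspose (B : Fin (k ^ 2) → Matrix (Fin k) (Fin k) ℂ)
    (U : Matrix (Fin k) (Fin k) ℂ) : (conjMatrix B U)ᴴ = conjMatrix B Uᴴ := by
  ext μ ν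
  simp only [conjMatrix, Matrix.conjTranspose_apply, Matrix.of_apply]
  rw [star_hs, hs_mul_mul (B μ), Matrix.conjTranspose_conjTranspose]

lemma conjMatrix_mem_unitaryGroup (hB : ∀ μ ν, hs (B μ) (B ν) = if μ = ν then 1 else 0)
    {U : Matrix (Fin k) (Fin k) ℂ} (hU : U ∈ Matrix.unitaryGroup (Fin k) ℂ) :
    conjMatrix B U ∈ Matrix.unitaryGroup (Fin (k ^ 2)) ℂ := by
  rw [Matrix.mem_unitaryGroup_iff, Matrix.star_eq_conjTranspose, conjMatrix_conjTranspose,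
    conjMatrix_mul hB, ← Matrix.star_eq_conjTranspose, Matrix.mem_unitaryGroup_iff.1 hU,
    conjMatrix_one hB]

/-- The matrix of `-i[W, ·]` depends linearly on `W`. -/
def hamMatrixLinear (B : Fin (k ^ 2) → Matrix (Fin k) (Fin k) ℂ) :
    Matrix (Fin k) (Fin k) ℂ →ₗ[ℂ] Matrix (Fin (k ^ 2)) (Fin (k ^ 2)) ℂ where
  toFun := hamMatrix B
  map_add' W Z := by
    ext μ ν
    simp only [hamMatrix, Matrix.of_apply, Matrix.add_apply, ← hs_add_right, ← smul_add]
    congr 2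
    noncomm_ring
  map_smul' c W := by
    ext μ ν
    simp only [hamMatrix, Matrix.of_apply, Matrix.smul_apply, RingHom.id_apply, smul_eq_mul,
      ← hs_smul_right, Matrix.smul_mul, Matrix.mul_smul, ← smul_sub]
    rw [smul_comm]

lemma hamMatrixLinear_apply (W : Matrix (Fin k) (Fin k) ℂ) :
    hamMatrixLinear B W = hamMatrix B W := rfl

/-- The commutator of the superoperators `-i[W, ·]` and `-i[Z, ·]`. -/
lemma hamMatrix_commutator (hB : ∀ μ ν, hs (B μ) (B ν) = if μ = ν then 1 else 0)
    (W Z : Matrix (Fin k) (Fin k) ℂ) :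
    hamMatrix B W * hamMatrix B Z - hamMatrix B Z * hamMatrix B W =
      hamMatrix B (-Complex.I • (W * Z - Z * W)) := by
  have h : ∀ W Z μ ν, (hamMatrix B W * hamMatrix B Z) μ ν =
      hs (B μ) (-Complex.I • (W * (-Complex.I • (Z * B ν - B ν * Z)) -
        (-Complex.I • (Z * B ν - B ν * Z)) * W)) := fun W Z μ ν => by
    rw [← sum_hamMatrix_mul hB, Matrix.mul_apply]
    rfl
  ext μ ν
  rw [Matrix.sub_apply, h, h, ← hs_sub_right]
  simp only [hamMatrix, Matrix.of_apply]
  congr 1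
  simp only [Matrix.mul_smul, Matrix.smul_mul, Matrix.mul_sub, Matrix.sub_mul, Matrix.mul_assoc]
  module

end OperatorBasis

/-! ### Noiseless-subsystem structure at a single parameter value -/

section Frame

variable {b : ℕ} {d a : Fin b → ℕ} {q : ℕ} {n : Type} [Fintype n] [DecidableEq n]

/-- An asymptotic subspace of the form `S ((⊕ Op ⊗ r_κ) ⊕ 0) S†` with an isometry `S` and density
matrices `r_κ`. -/
structure IsNSFrame (𝓛 : Superop n) (S : Matrix n (RefIndex d a q) ℂ)
    (r : ∀ κ, Matrix (Fin (a κ)) (Fin (a κ)) ℂ) : Prop where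
  isometry : Sᴴ * S = 1
  posSemidef : ∀ κ, (r κ).PosSemidef
  trace_one : ∀ κ, (r κ).trace = 1
  asymptotic : ∀ ρ, ρ ∈ asymptoticSubspace 𝓛 ↔
    ∃ X : ∀ κ, Matrix (Fin (d κ)) (Fin (d κ)) ℂ, ρ = inFrame S fun κ => X κ ⊗ₖ r κ

variable {𝓛 : Superop n} {S : Matrix n (RefIndex d a q) ℂ}
  {r : ∀ κ, Matrix (Fin (a κ)) (Fin (a κ)) ℂ}

lemma trace_rangeProj_mul {k : ℕ} (R : Matrix (Fin k) (Fin k) ℂ) :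
    (rangeProj R * R).trace = R.trace := by rw [rangeProj_mul_self]

/-- The non-decaying projection is `S ((⊕ 1 ⊗ P_ax) ⊕ 0) S†`. -/
lemma IsNSFrame.nonDecayingProj_eq (h : IsNSFrame 𝓛 S r) : nonDecayingProj 𝓛 =
    inFrame S fun κ => (1 : Matrix (Fin (d κ)) (Fin (d κ)) ℂ) ⊗ₖ rangeProj (r κ) := by
  have hmem : (inFrame S fun κ => (1 : Matrix (Fin (d κ)) (Fin (d κ)) ℂ) ⊗ₖ r κ) ∈
      asymptoticSubspace 𝓛 := (h.asymptotic _).2 ⟨fun _ => 1, rfl⟩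
  rw [nonDecayingProj_eq_rangeProj hmem]
  · refine (eq_rangeProj ?_ ?_ ?_).symm
    · rw [Matrix.IsHermitian, inFrame_conjTranspose]
      simp only [Matrix.conjTranspose_kronecker, Matrix.conjTranspose_one,
        (rangeProj_isHermitian _).eq]
    · rw [inFrame_mul h.isometry]
      simp only [← Matrix.mul_kronecker_mul, Matrix.mul_one, rangeProj_mul_self]
    · choose R hR using fun κ => exists_rangeProj_eq_mul (r κ)
      refine ⟨inFrame S fun κ => 1 ⊗ₖ R κ, ?_⟩
      rw [inFrame_mul h.isometry]
      simp only [← Matrix.mul_kronecker_mul, Matrix.mul_one, ← hR]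
  · intro σ hσ
    obtain ⟨X, rfl⟩ := (h.asymptotic σ).1 hσ
    refine ⟨inFrame S fun κ => X κ ⊗ₖ 1, ?_⟩
    rw [inFrame_mul h.isometry]
    simp only [← Matrix.mul_kronecker_mul, Matrix.mul_one, Matrix.one_mul]

/-- The upper-left corner of a conserved quantity is `S ((⊕ X_κ ⊗ P_ax) ⊕ 0) S†`, obtained from its
product with the steady state `S ((⊕ 1 ⊗ r_κ) ⊕ 0) S†`. -/
lemma IsNSFrame.exists_upperLeft_eq (h : IsNSFrame 𝓛 S r) (hL : IsLindbladian 𝓛)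
    (hst : IsSteady 𝓛) {J : Matrix n n ℂ} (hJ : ∀ σ, hs J (𝓛 σ) = 0) :
    ∃ X : ∀ κ, Matrix (Fin (d κ)) (Fin (d κ)) ℂ,
      upperLeft 𝓛 J = inFrame S fun κ => X κ ⊗ₖ rangeProj (r κ) := by
  have hmem : (inFrame S fun κ => (1 : Matrix (Fin (d κ)) (Fin (d κ)) ℂ) ⊗ₖ r κ) ∈
      asymptoticSubspace 𝓛 := (h.asymptotic _).2 ⟨fun _ => 1, rfl⟩
  have hpos : (inFrame S fun κ => (1 : Matrix (Fin (d κ)) (Fin (d κ)) ℂ) ⊗ₖ r κ).PosSemidef := by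
    choose C hC using fun κ => PosSemidef.exists_eq_conjTranspose_mul_self (h.posSemidef κ)
    have h1 : (inFrame S fun κ => (1 : Matrix (Fin (d κ)) (Fin (d κ)) ℂ) ⊗ₖ r κ) =
        (inFrame S fun κ => (1 : Matrix (Fin (d κ)) (Fin (d κ)) ℂ) ⊗ₖ C κ)ᴴ *
          inFrame S fun κ => (1 : Matrix (Fin (d κ)) (Fin (d κ)) ℂ) ⊗ₖ C κ := by
      rw [inFrame_conjTranspose, inFrame_mul h.isometry]
      simp only [Matrix.conjTranspose_kronecker, ← Matrix.mul_kronecker_mul,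
        Matrix.conjTranspose_one, Matrix.mul_one, ← hC]
    rw [h1]
    exact Matrix.posSemidef_conjTranspose_mul_self _
  obtain ⟨X, hX⟩ := (h.asymptotic _).1 (conserved_mul_mem hL hst hJ hmem hpos)
  choose R hR using fun κ => exists_rangeProj_eq_mul (r κ)
  refine ⟨X, ?_⟩
  have hP : nonDecayingProj 𝓛 = (inFrame S fun κ => (1 : Matrix (Fin (d κ)) (Fin (d κ)) ℂ) ⊗ₖ r κ) *
      inFrame S fun κ => (1 : Matrix (Fin (d κ)) (Fin (d κ)) ℂ) ⊗ₖ R κ := by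
    rw [h.nonDecayingProj_eq, inFrame_mul h.isometry]
    simp only [← Matrix.mul_kronecker_mul, Matrix.mul_one, ← hR]
  rw [upperLeft_apply, conserved_mul_nonDecayingProj hL hst hJ, hP, ← Matrix.mul_assoc, hX,
    inFrame_mul h.isometry]
  simp only [← Matrix.mul_kronecker_mul, Matrix.mul_one, ← hR]

/-- The operators `S ((⊕ X_κ ⊗ P_ax) ⊕ 0) S†` pair with asymptotic operators through the
decoherence-free factors alone. -/
lemma hs_inFrame_kronecker (hS : Sᴴ * S = 1) (X Y : ∀ κ, Matrix (Fin (d κ)) (Fin (d κ)) ℂ)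
    (hr : ∀ κ, (r κ).trace = 1) :
    hs (inFrame S fun κ => X κ ⊗ₖ rangeProj (r κ)) (inFrame S fun κ => Y κ ⊗ₖ r κ) =
      ∑ κ, hs (X κ) (Y κ) := by
  rw [hs_inFrame_inFrame hS]
  refine Finset.sum_congr rfl fun κ _ => ?_
  rw [Matrix.conjTranspose_kronecker, ← Matrix.mul_kronecker_mul, Matrix.trace_kronecker,
    (rangeProj_isHermitian _).eq, trace_rangeProj_mul, hr, mul_one, hs]

lemma upperLeft_of_mem (hL : IsLindbladian 𝓛) (hst : IsSteady 𝓛) {σ : Matrix n n ℂ}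
    (hσ : σ ∈ asymptoticSubspace 𝓛) : upperLeft 𝓛 σ = σ := by
  rw [upperLeft_apply, nonDecayingProj_mul hσ, mul_nonDecayingProj hL hst hσ]

/-- The minimal projection is the blockwise partial trace over the support of the auxiliary
states. -/
lemma IsNSFrame.minimalProjection_eq (h : IsNSFrame 𝓛 S r) (hL : IsLindbladian 𝓛)
    (hst : IsSteady 𝓛) (ρ : Matrix n n ℂ) :
    minimalProjection 𝓛 ρ = inFrame S (fun κ =>
      traceAx κ (blockOp (q := q) (Pi.single κ
        ((1 : Matrix (Fin (d κ)) (Fin (d κ)) ℂ) ⊗ₖ rangeProj (r κ))) * (Sᴴ * ρ * S)) ⊗ₖ r κ) := by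
  set Y : ∀ κ, Matrix (Fin (d κ)) (Fin (d κ)) ℂ := fun κ => traceAx κ (blockOp (q := q)
    (Pi.single κ ((1 : Matrix (Fin (d κ)) (Fin (d κ)) ℂ) ⊗ₖ rangeProj (r κ))) *
      (Sᴴ * ρ * S)) with hY
  have hYeq : ∀ κ, Y κ = partialTrace (((1 : Matrix (Fin (d κ)) (Fin (d κ)) ℂ) ⊗ₖ
      rangeProj (r κ)) * diagBlock κ (Sᴴ * ρ * S)) := fun κ => by
    show traceAx κ _ = _
    rw [traceAx_eq_partialTrace, diagBlock_blockOp_mul, Pi.single_eq_same]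
  have hmem : (inFrame S fun κ => Y κ ⊗ₖ r κ) ∈ asymptoticSubspace 𝓛 :=
    (h.asymptotic _).2 ⟨Y, rfl⟩
  rw [minimalProjection_apply]
  refine Eq.trans (asymptoticProjection_eq_of_forall_hs hL hst fun J hJ => ?_)
    (asymptoticProjection_of_mem hL hst hmem)
  obtain ⟨X, hX⟩ := h.exists_upperLeft_eq hL hst hJ
  have h2 : hs J (inFrame S fun κ => Y κ ⊗ₖ r κ) = ∑ κ, hs (X κ) (Y κ) := by
    rw [← upperLeft_of_mem hL hst hmem, hs_upperLeft, hX,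
      hs_inFrame_kronecker h.isometry _ _ h.trace_one]
  rw [h2, hs_upperLeft, hX, hs_inFrame]
  refine Finset.sum_congr rfl fun κ _ => ?_
  rw [Matrix.conjTranspose_kronecker, (rangeProj_isHermitian _).eq, trace_kronecker_mul, ← hYeq, hs]

end Frame

section SteadyBasis

variable {b : ℕ} {d a : Fin b → ℕ} {q : ℕ} {n : Type} [Fintype n] [DecidableEq n] {m : ℕ}
  {M : Set (Fin m → ℝ)} {𝓛 : (Fin m → ℝ) → Superop n}
  {S : (Fin m → ℝ) → Matrix n (RefIndex d a q) ℂ}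
  {ϱ : ∀ κ, (Fin m → ℝ) → Matrix (Fin (a κ)) (Fin (a κ)) ℂ}
  {B : ∀ κ, Fin (d κ ^ 2) → Matrix (Fin (d κ)) (Fin (d κ)) ℂ}

lemma IsNSFamily.frame (h : IsNSFamily M 𝓛 S ϱ) {x : Fin m → ℝ} (hx : x ∈ M) :
    IsNSFrame (𝓛 x) (S x) fun κ => ϱ κ x where
  isometry := h.unitary_left x hx
  posSemidef := h.posSemidef x hx
  trace_one := h.trace_one x hx
  asymptotic := h.asymptotic x hx

lemma purity_pos {k : ℕ} {r : Matrix (Fin k) (Fin k) ℂ} (hr : r.PosSemidef) (ht : r.trace = 1) :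
    0 < (r * r).trace.re := by
  have h1 : (r * r).trace = hs r r := by rw [hs, hr.isHermitian.eq]
  have h2 : hs r r ≠ 0 := by
    intro h0
    rw [eq_zero_of_hs_self h0, Matrix.trace_zero] at ht
    exact zero_ne_one ht
  have h3 : 0 ≤ hs r r := hs_nonneg_of_posSemidef hr hr
  rw [h1]
  exact (Complex.lt_def.1 (lt_of_le_of_ne h3 h2.symm)).1

lemma IsNSFamily.axNorm_pos (h : IsNSFamily M 𝓛 S ϱ) {x : Fin m → ℝ} (hx : x ∈ M) (κ : Fin b) :
    0 < axNorm (ϱ κ) x :=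
  Real.sqrt_pos.2 (purity_pos (h.posSemidef x hx κ) (h.trace_one x hx κ))

lemma nsBasis_eq_kronecker (S : (Fin m → ℝ) → Matrix n (RefIndex d a q) ℂ)
    (ϱ : ∀ κ, (Fin m → ℝ) → Matrix (Fin (a κ)) (Fin (a κ)) ℂ)
    (B : ∀ κ, Fin (d κ ^ 2) → Matrix (Fin (d κ)) (Fin (d κ)) ℂ) (x : Fin m → ℝ)
    (i : Σ κ : Fin b, Fin (d κ ^ 2)) :
    nsBasis S ϱ B x i = inFrame (S x) fun κ =>
      (Pi.single i.1 (((axNorm (ϱ i.1) x : ℂ)⁻¹) • B i.1 i.2) :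
        ∀ κ, Matrix (Fin (d κ)) (Fin (d κ)) ℂ) κ ⊗ₖ ϱ κ x := by
  rw [nsBasis]
  congr 1
  funext κ
  by_cases hκ : κ = i.1
  · subst hκ
    rw [Pi.single_eq_same, Pi.single_eq_same, Matrix.smul_kronecker, Matrix.kronecker_smul]
  · rw [Pi.single_eq_of_ne hκ, Pi.single_eq_of_ne hκ, Matrix.zero_kronecker]

/-- Coordinates of an asymptotic operator in the basis `Ψ_{κμ}`. -/
lemma IsNSFamily.nsBasis_expand (h : IsNSFamily M 𝓛 S ϱ) (hB : IsHermitianBasis B)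
    {x : Fin m → ℝ} (hx : x ∈ M) (X : ∀ κ, Matrix (Fin (d κ)) (Fin (d κ)) ℂ) :
    inFrame (S x) (fun κ => X κ ⊗ₖ ϱ κ x) =
      ∑ i : Σ κ : Fin b, Fin (d κ ^ 2),
        ((axNorm (ϱ i.1) x : ℂ) * hs (B i.1 i.2) (X i.1)) • nsBasis S ϱ B x i := by
  have hn : ∀ κ, (axNorm (ϱ κ) x : ℂ) ≠ 0 := fun κ =>
    Complex.ofReal_ne_zero.2 (h.axNorm_pos hx κ).ne'
  simp only [nsBasis_eq_kronecker, ← inFrameLinear_apply, ← map_smul, ← map_sum]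
  congr 1
  funext κ
  rw [Finset.sum_apply, Fintype.sum_sigma, Finset.sum_eq_single κ]
  · simp only [Pi.smul_apply, Pi.single_eq_same]
    conv_lhs => rw [← orthonormal_expand (hB κ).2 (X κ)]
    ext i j
    simp only [Matrix.kroneckerMap_apply, Matrix.sum_apply, Matrix.smul_apply, smul_eq_mul,
      Finset.sum_mul]
    refine Finset.sum_congr rfl fun μ _ => ?_
    field_simp [hn κ]
  · intro κ' _ hκ
    refine Finset.sum_eq_zero fun μ _ => ?_
    simp only [Pi.smul_apply]
    rw [Pi.single_eq_of_ne hκ.symm, Matrix.zero_kronecker, smul_zero]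
  · simp

/-- The operators `S (B_{κμ} ⊗ P_ax) S†` are biorthogonal to the basis `Ψ_{κμ}` up to the auxiliary
norm. -/
lemma IsNSFamily.hs_kronecker_nsBasis (h : IsNSFamily M 𝓛 S ϱ) {x : Fin m → ℝ} (hx : x ∈ M)
    (X : ∀ κ, Matrix (Fin (d κ)) (Fin (d κ)) ℂ) (i : Σ κ : Fin b, Fin (d κ ^ 2)) :
    hs (inFrame (S x) fun κ => X κ ⊗ₖ rangeProj (ϱ κ x)) (nsBasis S ϱ B x i) =
      (axNorm (ϱ i.1) x : ℂ)⁻¹ * hs (X i.1) (B i.1 i.2) := by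
  rw [nsBasis_eq_kronecker, hs_inFrame_kronecker (h.unitary_left x hx) _ _ (h.trace_one x hx),
    Finset.sum_eq_single i.1]
  · rw [Pi.single_eq_same, hs_smul_right]
  · intro κ _ hκ
    rw [Pi.single_eq_of_ne hκ, hs_zero_right]
  · simp

lemma IsNSFamily.isSteadyBasis (h : IsNSFamily M 𝓛 S ϱ) (hB : IsHermitianBasis B)
    {x : Fin m → ℝ} (hx : x ∈ M) : IsSteadyBasis (𝓛 x) (nsBasis S ϱ B x) := by
  have hn : ∀ κ, (axNorm (ϱ κ) x : ℂ) ≠ 0 := fun κ =>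
    Complex.ofReal_ne_zero.2 (h.axNorm_pos hx κ).ne'
  refine ⟨?_, le_antisymm ?_ ?_⟩
  · rw [Fintype.linearIndependent_iff]
    rintro c hc ⟨κ, μ⟩
    have h1 := congrArg (hs (inFrame (S x) fun κ' => (Pi.single κ (B κ μ) :
      ∀ κ, Matrix (Fin (d κ)) (Fin (d κ)) ℂ) κ' ⊗ₖ rangeProj (ϱ κ' x))) hc
    rw [hs_zero_right, hs_sum_right] at h1
    simp only [hs_smul_right, h.hs_kronecker_nsBasis hx] at h1
    rw [Fintype.sum_sigma, Finset.sum_eq_single κ] at h1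
    · simp only [Pi.single_eq_same, (hB κ).2] at h1
      simpa [hn κ] using h1
    · intro κ' _ hκ
      refine Finset.sum_eq_zero fun ν _ => ?_
      simp only
      rw [Pi.single_eq_of_ne hκ, hs_zero_left, mul_zero, mul_zero]
    · simp
  · rw [Submodule.span_le]
    rintro _ ⟨i, rfl⟩
    rw [nsBasis_eq_kronecker]
    exact (h.asymptotic x hx _).2 ⟨_, rfl⟩
  · intro ρ hρ
    obtain ⟨X, rfl⟩ := (h.asymptotic x hx ρ).1 hρ
    rw [h.nsBasis_expand hB hx]
    exact Submodule.sum_mem _ fun i _ => Submodule.smul_mem _ _ (Submodule.subset_span ⟨i, rfl⟩)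

/-- The upper-left corner of the conserved quantity dual to `Ψ_{κμ}` is
`S (n_κ B_{κμ} ⊗ P_ax) S†`. -/
lemma IsNSFamily.upperLeft_dual (h : IsNSFamily M 𝓛 S ϱ) (hB : IsHermitianBasis B)
    {x : Fin m → ℝ} (hx : x ∈ M) (hL : IsLindbladian (𝓛 x)) (hst : IsSteady (𝓛 x))
    {J : (Σ κ : Fin b, Fin (d κ ^ 2)) → Matrix n n ℂ}
    (hJ : IsConservedDual (𝓛 x) (nsBasis S ϱ B x) J) (i : Σ κ : Fin b, Fin (d κ ^ 2)) :
    upperLeft (𝓛 x) (J i) = inFrame (S x) (Pi.single i.1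
      (((axNorm (ϱ i.1) x : ℂ) • B i.1 i.2) ⊗ₖ rangeProj (ϱ i.1 x))) := by
  have hn : ∀ κ, (axNorm (ϱ κ) x : ℂ) ≠ 0 := fun κ =>
    Complex.ofReal_ne_zero.2 (h.axNorm_pos hx κ).ne'
  obtain ⟨X, hX⟩ := (h.frame hx).exists_upperLeft_eq hL hst (hJ.1 i)
  have hcoord : ∀ j : Σ κ : Fin b, Fin (d κ ^ 2), hs (X j.1) (B j.1 j.2) =
      if i = j then (axNorm (ϱ j.1) x : ℂ) else 0 := by
    intro j
    have hmem : nsBasis S ϱ B x j ∈ asymptoticSubspace (𝓛 x) := by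
      rw [← (h.isSteadyBasis hB hx).2]
      exact Submodule.subset_span ⟨j, rfl⟩
    have h1 := hJ.2 i j
    rw [← upperLeft_of_mem hL hst hmem, hs_upperLeft, hX, h.hs_kronecker_nsBasis hx] at h1
    rw [inv_mul_eq_iff_eq_mul₀ (hn j.1)] at h1
    rw [h1, mul_ite, mul_one, mul_zero]
  have hXeq : X = Pi.single i.1 ((axNorm (ϱ i.1) x : ℂ) • B i.1 i.2) := by
    funext κ
    rw [← orthonormal_expand (hB κ).2 (X κ)]
    have h2 : ∀ μ, hs (B κ μ) (X κ) = if i = ⟨κ, μ⟩ then (axNorm (ϱ κ) x : ℂ) else 0 := by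
      intro μ
      rw [← star_hs, hcoord ⟨κ, μ⟩]
      split_ifs <;> simp
    simp only [h2]
    by_cases hκ : κ = i.1
    · subst hκ
      rw [Pi.single_eq_same, Finset.sum_eq_single i.2]
      · rw [if_pos rfl]
      · intro μ _ hμ
        rw [if_neg, zero_smul]
        rintro hi
        apply hμ
        rw [Sigma.ext_iff] at hi
        exact (eq_of_heq hi.2).symm
      · simp
    · rw [Pi.single_eq_of_ne hκ]
      refine Finset.sum_eq_zero fun μ _ => ?_
      rw [if_neg, zero_smul]
      rintro rfl
      exact hκ rfl
  rw [hX]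
  congr 1
  funext κ
  rw [hXeq]
  by_cases hκ : κ = i.1
  · subst hκ
    rw [Pi.single_eq_same, Pi.single_eq_same]
  · rw [Pi.single_eq_of_ne hκ, Pi.single_eq_of_ne hκ, Matrix.zero_kronecker]

end SteadyBasis

/-! ### Calculus of products of rectangular matrices -/

section MatrixCalculus

variable {i j k : Type} [Fintype i] [DecidableEq i] [Fintype j] [DecidableEq j] [Fintype k]
  [DecidableEq k] {m : ℕ}

/-- Multiplication of rectangular matrices as a continuous bilinear map. -/
def mulBilinear (i j k : Type) [Fintype i] [DecidableEq i] [Fintype j] [DecidableEq j] [Fintype k]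
    [DecidableEq k] : Matrix i j ℂ →L[ℝ] Matrix j k ℂ →L[ℝ] Matrix i k ℂ :=
  LinearMap.mkContinuous₂ (LinearMap.mk₂ ℝ (fun (A : Matrix i j ℂ) (B : Matrix j k ℂ) => A * B)
    Matrix.add_mul Matrix.smul_mul Matrix.mul_add fun c A B => Matrix.mul_smul A c B) 1
    fun A B => by rw [one_mul]; exact Matrix.l2_opNorm_mul A B

lemma contDiffOn_mul {X : Type*} [NormedAddCommGroup X] [NormedSpace ℝ X] {s : Set X}
    {r : WithTop ℕ∞} {f : X → Matrix i j ℂ} {g : X → Matrix j k ℂ} (hf : ContDiffOn ℝ r f s)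
    (hg : ContDiffOn ℝ r g s) : ContDiffOn ℝ r (fun x => f x * g x) s :=
  (mulBilinear i j k).isBoundedBilinearMap.contDiff.comp_contDiffOn (hf.prodMk hg)

/-- Differentiability of a product and the product rule. -/
lemma pd_mul {f : (Fin m → ℝ) → Matrix i j ℂ} {g : (Fin m → ℝ) → Matrix j k ℂ} {x : Fin m → ℝ}
    (hf : DifferentiableAt ℝ f x) (hg : DifferentiableAt ℝ g x) (α : Fin m) :
    DifferentiableAt ℝ (fun y => f y * g y) x ∧
    pd α (fun y => f y * g y) x = pd α f x * g x + f x * pd α g x := by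
  have h1 := (mulBilinear i j k).hasFDerivAt_of_bilinear hf.hasFDerivAt hg.hasFDerivAt
  refine ⟨h1.differentiableAt, ?_⟩
  have h2 := congrArg (fun T => T (Pi.single α (1 : ℝ))) h1.fderiv
  refine Eq.trans h2 ?_
  exact add_comm _ _

/-- The conjugate transpose as a real-linear map. -/
def conjTransposeReal (i j : Type) : Matrix i j ℂ →ₗ[ℝ] Matrix j i ℂ where
  toFun A := Aᴴ
  map_add' := Matrix.conjTranspose_add
  map_smul' c A := by
    ext
    simp

lemma contDiffOn_conjTranspose {X : Type*} [NormedAddCommGroup X] [NormedSpace ℝ X] {s : Set X}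
    {r : WithTop ℕ∞} {f : X → Matrix i j ℂ} (hf : ContDiffOn ℝ r f s) :
    ContDiffOn ℝ r (fun x => (f x)ᴴ) s :=
  contDiffOn_linear_comp (conjTransposeReal i j) hf

/-- Differentiability and the derivative of a function followed by a linear map. -/
lemma pd_linear_comp {E G : Type*} [NormedAddCommGroup E] [NormedSpace ℝ E]
    [FiniteDimensional ℝ E] [NormedAddCommGroup G] [NormedSpace ℝ G] (f : E →ₗ[ℝ] G)
    {u : (Fin m → ℝ) → E} {x : Fin m → ℝ} (hu : DifferentiableAt ℝ u x) (α : Fin m) :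
    DifferentiableAt ℝ (fun y => f (u y)) x ∧ pd α (fun y => f (u y)) x = f (pd α u x) :=
  ⟨(LinearMap.toContinuousLinearMap f).differentiableAt.comp x hu, fderiv_linear_comp f hu _⟩

lemma pd_conjTranspose {f : (Fin m → ℝ) → Matrix i j ℂ} {x : Fin m → ℝ}
    (hf : DifferentiableAt ℝ f x) (α : Fin m) : DifferentiableAt ℝ (fun y => (f y)ᴴ) x ∧
    pd α (fun y => (f y)ᴴ) x = (pd α f x)ᴴ :=
  pd_linear_comp (conjTransposeReal i j) hf α

lemma pd_congr {V : Type*} [NormedAddCommGroup V] [NormedSpace ℝ V] {M : Set (Fin m → ℝ)}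
    (hM : IsOpen M) {f g : (Fin m → ℝ) → V} (h : ∀ y ∈ M, f y = g y) {x : Fin m → ℝ} (hx : x ∈ M)
    (α : Fin m) : pd α f x = pd α g x := by
  have h1 : f =ᶠ[nhds x] g := Filter.eventually_of_mem (hM.mem_nhds hx) h
  rw [pd, pd, h1.fderiv_eq]

lemma pd_const {V : Type*} [NormedAddCommGroup V] [NormedSpace ℝ V] (c : V) (x : Fin m → ℝ)
    (α : Fin m) : pd α (fun _ => c) x = 0 := by
  simp [pd]

lemma contDiffOn_pd {V : Type*} [NormedAddCommGroup V] [NormedSpace ℝ V] {M : Set (Fin m → ℝ)}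
    (hM : IsOpen M) {f : (Fin m → ℝ) → V} {r k : WithTop ℕ∞} (hf : ContDiffOn ℝ k f M)
    (hr : r + 1 ≤ k) (α : Fin m) : ContDiffOn ℝ r (pd α f) M :=
  (hf.fderiv_of_isOpen hM hr).clm_apply contDiffOn_const

end MatrixCalculus

/-! ### Regularity of noiseless-subsystem data -/

section Regularity

variable {b : ℕ} {d a : Fin b → ℕ} {q : ℕ} {n : Type} [Fintype n] [DecidableEq n] {m : ℕ}
  {M : Set (Fin m → ℝ)} {𝓛 : (Fin m → ℝ) → Superop n}
  {S : (Fin m → ℝ) → Matrix n (RefIndex d a q) ℂ}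
  {ϱ : ∀ κ, (Fin m → ℝ) → Matrix (Fin (a κ)) (Fin (a κ)) ℂ}
  {B : ∀ κ, Fin (d κ ^ 2) → Matrix (Fin (d κ)) (Fin (d κ)) ℂ}

/-- The embedding `R ↦ X ⊗ R` into the block `κ` of the reference space. -/
def blockKronecker (a : Fin b → ℕ) (q : ℕ) (κ : Fin b) (X : Matrix (Fin (d κ)) (Fin (d κ)) ℂ) :
    Matrix (Fin (a κ)) (Fin (a κ)) ℂ →ₗ[ℂ] Matrix (RefIndex d a q) (RefIndex d a q) ℂ where
  toFun R := blockOp (q := q) (Pi.single κ (X ⊗ₖ R))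
  map_add' R R' := by
    rw [Matrix.kronecker_add, Pi.single_add]
    simp [blockOp, Matrix.fromBlocks_add, Matrix.blockDiagonal'_add]
  map_smul' c R := by
    rw [Matrix.kronecker_smul, Pi.single_smul]
    simp [blockOp, Matrix.fromBlocks_smul, Matrix.blockDiagonal'_smul]

lemma blockKronecker_apply (κ : Fin b) (X : Matrix (Fin (d κ)) (Fin (d κ)) ℂ)
    (R : Matrix (Fin (a κ)) (Fin (a κ)) ℂ) :
    blockKronecker a q κ X R = blockOp (q := q) (Pi.single κ (X ⊗ₖ R)) := rfl

/-- The partial trace of the block `κ` as a linear map. -/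
def traceAxLinear (κ : Fin b) :
    Matrix (RefIndex d a q) (RefIndex d a q) ℂ →ₗ[ℂ] Matrix (Fin (d κ)) (Fin (d κ)) ℂ where
  toFun := traceAx κ
  map_add' Y Z := by
    ext
    simp [traceAx, Finset.sum_add_distrib]
  map_smul' c Y := by
    ext
    simp [traceAx, Finset.mul_sum]

/-- The basis `Ψ_{κμ}` as a product of a scalar and of matrices that are linear in the data. -/
lemma nsBasis_eq_smul (S : (Fin m → ℝ) → Matrix n (RefIndex d a q) ℂ)
    (ϱ : ∀ κ, (Fin m → ℝ) → Matrix (Fin (a κ)) (Fin (a κ)) ℂ)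
    (B : ∀ κ, Fin (d κ ^ 2) → Matrix (Fin (d κ)) (Fin (d κ)) ℂ) (x : Fin m → ℝ)
    (i : Σ κ : Fin b, Fin (d κ ^ 2)) :
    nsBasis S ϱ B x i = (axNorm (ϱ i.1) x)⁻¹ •
      (S x * blockKronecker a q i.1 (B i.1 i.2) (ϱ i.1 x) * (S x)ᴴ) := by
  rw [nsBasis, inFrame, ← blockKronecker_apply, map_smul, Matrix.mul_smul, Matrix.smul_mul]
  ext
  simp

lemma IsNSFamily.contDiffOn_axNorm (h : IsNSFamily M 𝓛 S ϱ) {r : WithTop ℕ∞} {κ : Fin b}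
    (hr : ContDiffOn ℝ r (ϱ κ) M) : ContDiffOn ℝ r (axNorm (ϱ κ)) M := by
  have h1 : ContDiffOn ℝ r (fun x => (ϱ κ x * ϱ κ x).trace.re) M :=
    contDiffOn_linear_comp (Complex.reLm ∘ₗ Matrix.traceLinearMap (Fin (a κ)) ℝ ℂ)
      (contDiffOn_mul hr hr)
  exact h1.sqrt fun x hx => (purity_pos (h.posSemidef x hx κ) (h.trace_one x hx κ)).ne'

lemma IsNSFamily.contDiffOn_log_axNorm (h : IsNSFamily M 𝓛 S ϱ) {r : WithTop ℕ∞} {κ : Fin b}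
    (hr : ContDiffOn ℝ r (ϱ κ) M) : ContDiffOn ℝ r (fun x => Real.log (axNorm (ϱ κ) x)) M :=
  (h.contDiffOn_axNorm hr).log fun _ hx => (h.axNorm_pos hx κ).ne'

lemma IsNSFamily.contDiffOn_nsBasis (h : IsNSFamily M 𝓛 S ϱ) (i : Σ κ : Fin b, Fin (d κ ^ 2)) :
    ContDiffOn ℝ 1 (fun x => nsBasis S ϱ B x i) M := by
  simp only [nsBasis_eq_smul]
  refine ((h.contDiffOn_axNorm (h.contDiff_ϱ i.1)).inv fun x hx =>
    (h.axNorm_pos hx i.1).ne').smul ?_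
  exact contDiffOn_mul (contDiffOn_mul h.contDiff_S (contDiffOn_linear_comp
    ((blockKronecker a q i.1 (B i.1 i.2)).restrictScalars ℝ) (h.contDiff_ϱ i.1)))
    (contDiffOn_conjTranspose h.contDiff_S)

lemma contDiffOn_dfsHamiltonian {r : WithTop ℕ∞} {κ : Fin b} {α : Fin m}
    (hS : ContDiffOn ℝ r S M) (hdS : ContDiffOn ℝ r (pd α S) M) (hr : ContDiffOn ℝ r (ϱ κ) M) :
    ContDiffOn ℝ r (dfsHamiltonian S ϱ κ α) M := by
  refine contDiffOn_linear_comp ((traceAxLinear (a := a) (q := q) κ).restrictScalars ℝ)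
    (contDiffOn_mul (contDiffOn_linear_comp ((blockKronecker a q κ
      (1 : Matrix (Fin (d κ)) (Fin (d κ)) ℂ)).restrictScalars ℝ) hr) ?_)
  exact ContDiffOn.const_smul (f := fun x => (S x)ᴴ * pd α S x) Complex.I
    (contDiffOn_mul (contDiffOn_conjTranspose hS) hdS)

lemma IsNSFamily.continuousOn_dfsHamiltonian (h : IsNSFamily M 𝓛 S ϱ) (hM : IsOpen M) (κ : Fin b)
    (α : Fin m) : ContinuousOn (dfsHamiltonian S ϱ κ α) M :=
  contDiffOn_zero.1 (contDiffOn_dfsHamiltonian (contDiffOn_zero.2 h.contDiff_S.continuousOn)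
    (contDiffOn_zero.2 (continuousOn_pd hM h.contDiff_S α))
    (contDiffOn_zero.2 (h.contDiff_ϱ κ).continuousOn))

lemma IsNSFamily.continuousOn_dfsConnection (h : IsNSFamily M 𝓛 S ϱ) (hM : IsOpen M) (κ : Fin b)
    (α : Fin m) : ContinuousOn (dfsConnection S ϱ B κ α) M :=
  continuousOn_linear_comp ((hamMatrixLinear (B κ)).restrictScalars ℝ)
    (h.continuousOn_dfsHamiltonian hM κ α)

/-- Differentiating `S† S = 1` shows that the generator of motion is Hermitian. -/
lemma IsNSFamily.motionGen_isHermitian (h : IsNSFamily M 𝓛 S ϱ) (hM : IsOpen M) {x : Fin m → ℝ}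
    (hx : x ∈ M) (α : Fin m) : (motionGen S α x).IsHermitian := by
  have hS := differentiableAt_of_contDiffOn hM h.contDiff_S hx
  have h1 := pd_congr hM h.unitary_left hx α
  rw [pd_const, (pd_mul (pd_conjTranspose hS α).1 hS α).2, (pd_conjTranspose hS α).2] at h1
  rw [Matrix.IsHermitian, motionGen, Matrix.conjTranspose_smul, Matrix.conjTranspose_mul,
    Matrix.conjTranspose_conjTranspose, eq_neg_of_add_eq_zero_left h1, smul_neg]
  simp

lemma dfsHamiltonian_eq (S : (Fin m → ℝ) → Matrix n (RefIndex d a q) ℂ)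
    (ϱ : ∀ κ, (Fin m → ℝ) → Matrix (Fin (a κ)) (Fin (a κ)) ℂ) (κ : Fin b) (α : Fin m)
    (x : Fin m → ℝ) : dfsHamiltonian S ϱ κ α x = partialTrace
      (((1 : Matrix (Fin (d κ)) (Fin (d κ)) ℂ) ⊗ₖ ϱ κ x) * diagBlock κ (motionGen S α x)) := by
  rw [dfsHamiltonian, traceAx_eq_partialTrace, diagBlock_blockOp_mul, Pi.single_eq_same]

lemma IsNSFamily.dfsHamiltonian_isHermitian (h : IsNSFamily M 𝓛 S ϱ) (hM : IsOpen M)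
    {x : Fin m → ℝ} (hx : x ∈ M) (κ : Fin b) (α : Fin m) :
    (dfsHamiltonian S ϱ κ α x).IsHermitian := by
  rw [Matrix.IsHermitian, dfsHamiltonian_eq, ← partialTrace_conjTranspose, Matrix.conjTranspose_mul,
    Matrix.conjTranspose_kronecker, Matrix.conjTranspose_one, (h.posSemidef x hx κ).isHermitian.eq,
    ← diagBlock_conjTranspose, (h.motionGen_isHermitian hM hx α).eq,
    partialTrace_one_kronecker_mul_comm]

/-- The trace of the derivative of a density matrix over its support vanishes: the weight outside
the support is nonnegative and zero at `x`, even where the rank changes. -/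
lemma IsNSFamily.trace_rangeProj_mul_pd (h : IsNSFamily M 𝓛 S ϱ) (hM : IsOpen M) {x : Fin m → ℝ}
    (hx : x ∈ M) (κ : Fin b) (α : Fin m) : (rangeProj (ϱ κ x) * pd α (ϱ κ) x).trace = 0 := by
  have hd := differentiableAt_of_contDiffOn hM (h.contDiff_ϱ κ) hx
  have h1 : (pd α (ϱ κ) x).trace = 0 := by
    have := (pd_linear_comp (Matrix.traceLinearMap (Fin (a κ)) ℝ ℂ) hd α).2
    refine this.symm.trans ((pd_congr hM (g := fun _ => 1) (fun y hy => ?_) hx α).trans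
      (pd_const _ _ _))
    exact h.trace_one y hy κ
  set Q := 1 - rangeProj (ϱ κ x) with hQ
  have hQh : Qᴴ = Q := by
    rw [hQ, Matrix.conjTranspose_sub, Matrix.conjTranspose_one,
        (rangeProj_isHermitian _).eq]
  have hQQ : Q * Q = Q := by
    rw [hQ, Matrix.mul_sub, Matrix.sub_mul, Matrix.sub_mul, rangeProj_mul_rangeProj]
    simp
  have hQpos : Q.PosSemidef := by
    have := Matrix.posSemidef_conjTranspose_mul_self Q
    rwa [hQh, hQQ] at this
  have h2 := pd_linear_comp ((hsLinear Q).restrictScalars ℝ) hd α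
  have h3 : hs Q (pd α (ϱ κ) x) = 0 := by
    refine h2.2.symm.trans ?_
    rw [pd, fderiv_eq_zero_of_eventually_nonneg h2.1]
    · rfl
    · filter_upwards [hM.mem_nhds hx] with y hy
      exact hs_nonneg_of_posSemidef hQpos (h.posSemidef y hy κ)
    · change hs Q (ϱ κ x) = 0
      rw [hs, hQh, hQ, Matrix.sub_mul, rangeProj_mul_self, Matrix.one_mul, sub_self,
        Matrix.trace_zero]
  rw [hs, hQh, hQ, Matrix.sub_mul, Matrix.trace_sub, Matrix.one_mul, h1, zero_sub,
    neg_eq_zero] at h3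
  exact h3

end Regularity

/-! ### The adiabatic connection of noiseless subsystems -/

section Connection

variable {b : ℕ} {d a : Fin b → ℕ} {q : ℕ} {n : Type} [Fintype n] [DecidableEq n] {m : ℕ}
  {M : Set (Fin m → ℝ)} {𝓛 : (Fin m → ℝ) → Superop n}
  {S : (Fin m → ℝ) → Matrix n (RefIndex d a q) ℂ}
  {ϱ : ∀ κ, (Fin m → ℝ) → Matrix (Fin (a κ)) (Fin (a κ)) ℂ}
  {B : ∀ κ, Fin (d κ ^ 2) → Matrix (Fin (d κ)) (Fin (d κ)) ℂ}

/-- The derivative of a steady basis has no lower-right corner, so its connection is computed by the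
upper-left corners of the conserved quantities. -/
lemma adiabaticConnection_upperLeft {ι : Type} {Ψ J : (Fin m → ℝ) → ι → Matrix n n ℂ}
    [Fintype ι] [DecidableEq ι] (hM : IsOpen M)
    (hL : ∀ x ∈ M, IsLindbladian (𝓛 x)) (hst : ∀ x ∈ M, IsSteady (𝓛 x))
    (hdiff : ContDiffOn ℝ 1 (fun x => asymptoticProjection (𝓛 x)) M)
    (hΨ : ∀ x ∈ M, IsSteadyBasis (𝓛 x) (Ψ x)) (hΨd : ∀ μ, ContDiffOn ℝ 1 (fun x => Ψ x μ) M)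
    (hJ : ∀ x ∈ M, IsConservedDual (𝓛 x) (Ψ x) (J x)) {x : Fin m → ℝ} (hx : x ∈ M) (α : Fin m) :
    adiabaticConnection J Ψ α x =
      adiabaticConnection (fun y μ => upperLeft (𝓛 y) (J y μ)) Ψ α x := by
  ext μ ν
  refine (hs_upperLeft_conserved (hL x hx) (hst x hx) ((hJ x hx).1 μ) ?_).symm
  refine corner_fderiv_of_mem hM hL hst hdiff (fun y hy => ?_) hx
    (differentiableAt_of_contDiffOn hM (hΨd ν) hx) _
  rw [← (hΨ y hy).2]
  exact Submodule.subset_span ⟨ν, rfl⟩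

lemma diagBlock_add (κ : Fin b) (Y Z : Matrix (RefIndex d a q) (RefIndex d a q) ℂ) :
    diagBlock κ (Y + Z) = diagBlock κ Y + diagBlock κ Z := rfl

lemma diagBlock_sub (κ : Fin b) (Y Z : Matrix (RefIndex d a q) (RefIndex d a q) ℂ) :
    diagBlock κ (Y - Z) = diagBlock κ Y - diagBlock κ Z := rfl

lemma diagBlock_smul {R : Type*} [SMul R ℂ] (κ : Fin b) (c : R)
    (Y : Matrix (RefIndex d a q) (RefIndex d a q) ℂ) :
    diagBlock κ (c • Y) = c • diagBlock κ Y := rfl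

lemma diagBlock_mul_blockOp (Y : ∀ κ, Matrix (Fin (d κ) × Fin (a κ)) (Fin (d κ) × Fin (a κ)) ℂ)
    (Z : Matrix (RefIndex d a q) (RefIndex d a q) ℂ) (κ : Fin b) :
    diagBlock κ (Z * blockOp Y) = diagBlock κ Z * Y κ := by
  rw [← Matrix.conjTranspose_conjTranspose (Z * blockOp Y), diagBlock_conjTranspose,
    Matrix.conjTranspose_mul, blockOp_conjTranspose, diagBlock_blockOp_mul, diagBlock_conjTranspose,
    Matrix.conjTranspose_mul, Matrix.conjTranspose_conjTranspose,
    Matrix.conjTranspose_conjTranspose]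

/-- The logarithmic derivative of the normalization `1 / n_κ`. -/
lemma IsNSFamily.pd_inv_axNorm (h : IsNSFamily M 𝓛 S ϱ) (hM : IsOpen M) {x : Fin m → ℝ}
    (hx : x ∈ M) (κ : Fin b) (α : Fin m) :
    DifferentiableAt ℝ (fun y => (axNorm (ϱ κ) y)⁻¹) x ∧
    axNorm (ϱ κ) x * pd α (fun y => (axNorm (ϱ κ) y)⁻¹) x = axConnection (ϱ κ) α x := by
  have hn := (h.axNorm_pos hx κ).ne'
  have hd := differentiableAt_of_contDiffOn hM (h.contDiffOn_axNorm (h.contDiff_ϱ κ)) hx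
  have h1 := (hasDerivAt_inv hn).comp_hasFDerivAt x hd.hasFDerivAt
  have h2 := hd.hasFDerivAt.log hn
  refine ⟨h1.differentiableAt, ?_⟩
  have h3 : pd α (fun y => (axNorm (ϱ κ) y)⁻¹) x =
      -(axNorm (ϱ κ) x ^ 2)⁻¹ * pd α (axNorm (ϱ κ)) x :=
    congrArg (fun T => T (Pi.single α (1 : ℝ))) h1.fderiv
  have h4 : pd α (fun y => Real.log (axNorm (ϱ κ) y)) x =
      (axNorm (ϱ κ) x)⁻¹ * pd α (axNorm (ϱ κ)) x :=
    congrArg (fun T => T (Pi.single α (1 : ℝ))) h2.fderiv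
  rw [axConnection, h3, h4]
  field_simp

/-- The derivative of the basis `Ψ_{κμ}` seen in the moving frame: the auxiliary norm, the auxiliary
state and the frame contribute one term each. -/
lemma IsNSFamily.conj_pd_nsBasis (h : IsNSFamily M 𝓛 S ϱ) (hM : IsOpen M) {x : Fin m → ℝ}
    (hx : x ∈ M) (α : Fin m) (i : Σ κ : Fin b, Fin (d κ ^ 2)) :
    (S x)ᴴ * pd α (fun y => nsBasis S ϱ B y i) x * S x =
      pd α (fun y => (axNorm (ϱ i.1) y)⁻¹) x • blockKronecker a q i.1 (B i.1 i.2) (ϱ i.1 x) +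
      (axNorm (ϱ i.1) x)⁻¹ • (blockKronecker a q i.1 (B i.1 i.2) (pd α (ϱ i.1) x) +
        -Complex.I • (motionGen S α x * blockKronecker a q i.1 (B i.1 i.2) (ϱ i.1 x) -
          blockKronecker a q i.1 (B i.1 i.2) (ϱ i.1 x) * motionGen S α x)) := by
  set T := blockKronecker a q i.1 (B i.1 i.2) with hT
  have hS := differentiableAt_of_contDiffOn hM h.contDiff_S hx
  have hr := differentiableAt_of_contDiffOn hM (h.contDiff_ϱ i.1) hx
  have hTr := pd_linear_comp (T.restrictScalars ℝ) hr α
  have hST := pd_mul hS hTr.1 α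
  have hSTS := pd_mul hST.1 (pd_conjTranspose hS α).1 α
  have hc := (h.pd_inv_axNorm hM hx i.1 α).1
  have h1 : pd α (fun y => nsBasis S ϱ B y i) x =
      (axNorm (ϱ i.1) x)⁻¹ • pd α (fun y => S y * T (ϱ i.1 y) * (S y)ᴴ) x +
      pd α (fun y => (axNorm (ϱ i.1) y)⁻¹) x • (S x * T (ϱ i.1 x) * (S x)ᴴ) := by
    simp only [nsBasis_eq_smul]
    exact congrArg (fun T => T (Pi.single α (1 : ℝ))) (fderiv_fun_smul hc hSTS.1)
  have h2 : pd α (fun y => S y * T (ϱ i.1 y) * (S y)ᴴ) x =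
      (pd α S x * T (ϱ i.1 x) + S x * T (pd α (ϱ i.1) x)) * (S x)ᴴ +
        S x * T (ϱ i.1 x) * (pd α S x)ᴴ := by
    refine hSTS.2.trans ?_
    rw [hST.2, hTr.2, (pd_conjTranspose hS α).2]
    rfl
  have hu := h.unitary_left x hx
  have hG : (S x)ᴴ * pd α S x = -Complex.I • motionGen S α x := by
    rw [motionGen, smul_smul]
    simp
  have hG' : (pd α S x)ᴴ * S x = Complex.I • motionGen S α x := by
    have := congrArg Matrix.conjTranspose hG
    rw [Matrix.conjTranspose_mul, Matrix.conjTranspose_conjTranspose, Matrix.conjTranspose_smul,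
      (h.motionGen_isHermitian hM hx α).eq] at this
    simpa using this
  rw [h1, h2]
  generalize pd α S x = D at *
  have e1 : (S x)ᴴ * (S x * T (ϱ i.1 x) * (S x)ᴴ) * S x = T (ϱ i.1 x) := by
    calc _ = ((S x)ᴴ * S x) * T (ϱ i.1 x) * ((S x)ᴴ * S x) := by simp only [Matrix.mul_assoc]
      _ = _ := by rw [hu, Matrix.one_mul, Matrix.mul_one]
  have e2 : (S x)ᴴ * ((D * T (ϱ i.1 x) + S x * T (pd α (ϱ i.1) x)) * (S x)ᴴ +
        S x * T (ϱ i.1 x) * Dᴴ) * S x =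
      T (pd α (ϱ i.1) x) + -Complex.I • (motionGen S α x * T (ϱ i.1 x) -
        T (ϱ i.1 x) * motionGen S α x) := by
    calc _ = ((S x)ᴴ * D) * T (ϱ i.1 x) * ((S x)ᴴ * S x) +
          ((S x)ᴴ * S x) * T (pd α (ϱ i.1) x) * ((S x)ᴴ * S x) +
          ((S x)ᴴ * S x) * T (ϱ i.1 x) * (Dᴴ * S x) := by
          simp only [Matrix.mul_assoc, Matrix.mul_add, Matrix.add_mul]
      _ = _ := by
          rw [hu, hG, hG']
          simp only [Matrix.one_mul, Matrix.mul_one, Matrix.smul_mul, Matrix.mul_smul]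
          module
  rw [Matrix.mul_add, Matrix.add_mul, Matrix.mul_smul, Matrix.mul_smul, Matrix.smul_mul,
    Matrix.smul_mul, e1, e2, add_comm]

/-- The commutator with the generator of motion, paired with `X ⊗ P_ax`, reduces to the commutator
with the effective Hamiltonian. -/
lemma trace_kronecker_commutator {k l : ℕ} (X Y : Matrix (Fin k) (Fin k) ℂ)
    {r : Matrix (Fin l) (Fin l) ℂ} (hr : r.IsHermitian)
    (g : Matrix (Fin k × Fin l) (Fin k × Fin l) ℂ) :
    ((X ⊗ₖ rangeProj r) * (g * (Y ⊗ₖ r) - (Y ⊗ₖ r) * g)).trace =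
      (X * (partialTrace ((1 ⊗ₖ r) * g) * Y - Y * partialTrace ((1 ⊗ₖ r) * g))).trace := by
  have hr' : r * rangeProj r = r := by
    have := congrArg Matrix.conjTranspose (rangeProj_mul_self r)
    rwa [Matrix.conjTranspose_mul, hr.eq, (rangeProj_isHermitian r).eq] at this
  have h1 : ((X ⊗ₖ rangeProj r) * (g * (Y ⊗ₖ r))).trace = (((Y * X) ⊗ₖ r) * g).trace := by
    rw [← Matrix.mul_assoc, Matrix.trace_mul_comm, ← Matrix.mul_assoc, ← Matrix.mul_kronecker_mul,
      hr']
  have h2 : ((X ⊗ₖ rangeProj r) * ((Y ⊗ₖ r) * g)).trace = (((X * Y) ⊗ₖ r) * g).trace := by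
    rw [← Matrix.mul_assoc, ← Matrix.mul_kronecker_mul, rangeProj_mul_self]
  rw [Matrix.mul_sub, Matrix.trace_sub, h1, h2, trace_kronecker_mul, trace_kronecker_mul,
    Matrix.mul_sub, Matrix.trace_sub, Matrix.mul_assoc, Matrix.trace_mul_comm Y, Matrix.mul_assoc,
    Matrix.mul_assoc]

/-- The connection is the pairing of `S (n_κ B_{κμ} ⊗ P_ax) S†` with the three terms of the
derivative of `Ψ_{κν}`: the frame contributes the commutator with `Ã`, the norm contributes
`-∂_α ln n_κ`, and the auxiliary state contributes nothing. -/
lemma IsNSFamily.adiabaticConnection_eq (h : IsNSFamily M 𝓛 S ϱ) (hB : IsHermitianBasis B)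
    (hM : IsOpen M) (hL : ∀ x ∈ M, IsLindbladian (𝓛 x)) (hst : ∀ x ∈ M, IsSteady (𝓛 x))
    (hdiff : ContDiffOn ℝ 1 (fun x => asymptoticProjection (𝓛 x)) M)
    {J : (Fin m → ℝ) → (Σ κ : Fin b, Fin (d κ ^ 2)) → Matrix n n ℂ}
    (hJ : ∀ x ∈ M, IsConservedDual (𝓛 x) (nsBasis S ϱ B x) (J x)) {x : Fin m → ℝ} (hx : x ∈ M)
    (α : Fin m) : adiabaticConnection J (nsBasis S ϱ B) α x =
      Matrix.blockDiagonal' (fun κ => dfsConnection S ϱ B κ α x) +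
      Matrix.blockDiagonal' (fun κ => (axConnection (ϱ κ) α x : ℂ) •
        (1 : Matrix (Fin (d κ ^ 2)) (Fin (d κ ^ 2)) ℂ)) := by
  rw [adiabaticConnection_upperLeft hM hL hst hdiff (fun x hx => h.isSteadyBasis hB hx)
    h.contDiffOn_nsBasis hJ hx]
  ext ⟨κ, μ⟩ ⟨l, ν⟩
  have hn : (axNorm (ϱ κ) x : ℂ) ≠ 0 := Complex.ofReal_ne_zero.2 (h.axNorm_pos hx κ).ne'
  have hsum : hs (upperLeft (𝓛 x) (J x ⟨κ, μ⟩)) (pd α (fun y => nsBasis S ϱ B y ⟨l, ν⟩) x) =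
      (axNorm (ϱ κ) x : ℂ) * ((B κ μ ⊗ₖ rangeProj (ϱ κ x)) *
        diagBlock κ ((S x)ᴴ * pd α (fun y => nsBasis S ϱ B y ⟨l, ν⟩) x * S x)).trace := by
    rw [h.upperLeft_dual hB hx (hL x hx) (hst x hx) (hJ x hx), hs_inFrame, Finset.sum_eq_single κ]
    · rw [Pi.single_eq_same, Matrix.conjTranspose_kronecker, (rangeProj_isHermitian _).eq,
        Matrix.conjTranspose_smul, ((hB κ).1 μ).eq, Matrix.smul_kronecker, Matrix.smul_mul,
        Matrix.trace_smul]
      simp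
    · intro κ' _ hκ
      rw [Pi.single_eq_of_ne hκ, Matrix.conjTranspose_zero, Matrix.zero_mul, Matrix.trace_zero]
    · simp
  change hs (upperLeft (𝓛 x) (J x ⟨κ, μ⟩)) (pd α (fun y => nsBasis S ϱ B y ⟨l, ν⟩) x) = _
  rw [hsum, h.conj_pd_nsBasis hM hx]
  simp only [diagBlock_add, diagBlock_sub, diagBlock_smul, blockKronecker_apply, diagBlock_blockOp,
    diagBlock_mul_blockOp, diagBlock_blockOp_mul, Matrix.add_apply]
  by_cases hκ : κ = l
  · subst hκ
    have hBB : (B κ μ * B κ ν).trace = if μ = ν then 1 else 0 := by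
      rw [← (hB κ).2, hs, ((hB κ).1 μ).eq]
    have hH : dfsConnection S ϱ B κ α x μ ν = -Complex.I *
        (B κ μ * (dfsHamiltonian S ϱ κ α x * B κ ν - B κ ν * dfsHamiltonian S ϱ κ α x)).trace := by
      rw [dfsConnection, hamMatrix, Matrix.of_apply, hs_smul_right, hs, ((hB κ).1 μ).eq]
    simp only [Pi.single_eq_same, Matrix.blockDiagonal'_apply_eq]
    rw [Matrix.mul_add, Matrix.mul_smul, Matrix.mul_smul, Matrix.mul_add, Matrix.mul_smul,
      Matrix.trace_add, Matrix.trace_smul, Matrix.trace_smul, Matrix.trace_add, Matrix.trace_smul,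
      trace_kronecker_commutator _ _ (h.posSemidef x hx κ).isHermitian, ← dfsHamiltonian_eq,
      ← Matrix.mul_kronecker_mul, ← Matrix.mul_kronecker_mul, Matrix.trace_kronecker,
      Matrix.trace_kronecker, h.trace_rangeProj_mul_pd hM hx, rangeProj_mul_self,
      h.trace_one x hx, hBB, hH, ← (h.pd_inv_axNorm hM hx κ α).2, Matrix.smul_apply,
      Matrix.one_apply]
    simp only [Complex.real_smul, smul_eq_mul, Complex.ofReal_mul, Complex.ofReal_inv]
    field_simp
    ring
  · rw [Matrix.blockDiagonal'_apply_ne _ _ _ hκ, Matrix.blockDiagonal'_apply_ne _ _ _ hκ]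
    simp only [Pi.single_eq_of_ne hκ]
    simp

end Connection

/-! ### The holonomy of noiseless subsystems -/

section Holonomy

open Set

variable {b : ℕ} {d a : Fin b → ℕ} {q : ℕ} {n : Type} [Fintype n] [DecidableEq n] {m : ℕ}
  {M : Set (Fin m → ℝ)} {𝓛 : (Fin m → ℝ) → Superop n}
  {S : (Fin m → ℝ) → Matrix n (RefIndex d a q) ℂ}
  {ϱ : ∀ κ, (Fin m → ℝ) → Matrix (Fin (a κ)) (Fin (a κ)) ℂ}
  {B : ∀ κ, Fin (d κ ^ 2) → Matrix (Fin (d κ)) (Fin (d κ)) ℂ} {γ : ℝ → Fin m → ℝ}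

lemma coordinateHolonomy_zero {ι : Type} [Fintype ι] [DecidableEq ι] (c : ℂ)
    (A : Fin m → (Fin m → ℝ) → Matrix ι ι ℂ) (γ : ℝ → Fin m → ℝ) :
    coordinateHolonomy c A γ 0 = 1 :=
  pathOrderedExp_zero _

/-- The holonomy of a Hermitian connection is unitary. -/
lemma coordinateHolonomy_mem_unitaryGroup {k : ℕ} (hγ : IsPath M γ)
    {A : Fin m → (Fin m → ℝ) → Matrix (Fin k) (Fin k) ℂ} (hA : ∀ α, ContinuousOn (A α) M)
    (hherm : ∀ x ∈ M, ∀ α, (A α x).IsHermitian) {s : ℝ} (hs : s ∈ Icc (0 : ℝ) 1) :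
    coordinateHolonomy Complex.I A γ s ∈ Matrix.unitaryGroup (Fin k) ℂ := by
  set U := coordinateHolonomy Complex.I A γ with hU
  rw [Matrix.mem_unitaryGroup_iff', Matrix.star_eq_conjTranspose]
  -- the generator is anti-Hermitian, so `U† U` is constant
  refine ode_unique_unitInterval (v := fun _ _ => 0) (C := 0) (f := fun t => (U t)ᴴ * U t)
    (g := fun _ => 1) (by simp) (fun t ht => ?_) (fun t _ => hasDerivWithinAt_const t _ _) ?_ s hs
  · have h1 := hasDerivWithinAt_coordinateHolonomy hγ Complex.I hA ht
    have h2 := (hasDerivWithinAt_linear_comp (conjTransposeReal (Fin k) (Fin k)) h1).mul h1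
    refine h2.congr_deriv ?_
    change (_ * U t)ᴴ * U t + (U t)ᴴ * (_ * U t) = 0
    rw [Matrix.conjTranspose_mul, Matrix.conjTranspose_smul, Matrix.conjTranspose_sum]
    simp only [Matrix.conjTranspose_smul, (hherm _ (hγ.2 t ht) _).eq]
    simp [Matrix.mul_assoc]
  · rw [hU, coordinateHolonomy_zero, Matrix.conjTranspose_one, Matrix.one_mul]

/-- Conjugation by the holonomy of `W` is the holonomy of the superoperators `-i[W, ·]`. -/
lemma coordinateHolonomy_hamMatrix {k : ℕ} {D : Fin (k ^ 2) → Matrix (Fin k) (Fin k) ℂ}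
    (hD : ∀ μ ν, hs (D μ) (D ν) = if μ = ν then 1 else 0) (hγ : IsPath M γ)
    {A : Fin m → (Fin m → ℝ) → Matrix (Fin k) (Fin k) ℂ} (hA : ∀ α, ContinuousOn (A α) M)
    (hherm : ∀ x ∈ M, ∀ α, (A α x).IsHermitian) {s : ℝ} (hs' : s ∈ Icc (0 : ℝ) 1) :
    coordinateHolonomy (-1) (fun α x => hamMatrix D (A α x)) γ s =
      conjMatrix D (coordinateHolonomy Complex.I A γ s) := by
  set U := coordinateHolonomy Complex.I A γ with hU
  have hAc : ∀ α, ContinuousOn (fun x => hamMatrix D (A α x)) M := fun α =>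
    continuousOn_linear_comp ((hamMatrixLinear D).restrictScalars ℝ) (hA α)
  refine (eq_pathOrderedExp (X := fun t => conjMatrix D (U t))
    (hγ.continuousOn_generator (-1) hAc) (fun t ht => ?_) ?_ s hs').symm
  · set W := ∑ α, (velocity γ α t : ℂ) • A α (γ t) with hW
    have hWh : Wᴴ = W := by
      rw [hW, Matrix.conjTranspose_sum]
      simp only [Matrix.conjTranspose_smul, (hherm _ (hγ.2 t ht) _).eq]
      simp
    have hgen : ∑ α, (velocity γ α t : ℂ) • hamMatrix D (A α (γ t)) = hamMatrix D W := by
      simp only [hW, ← hamMatrixLinear_apply, map_sum, map_smul]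
    have h1 : HasDerivWithinAt U ((Complex.I • W) * U t) (Icc 0 1) t :=
      hasDerivWithinAt_coordinateHolonomy hγ Complex.I hA ht
    have h2 := hasDerivWithinAt_linear_comp (conjTransposeReal (Fin k) (Fin k)) h1
    refine hasDerivWithinAt_matrix fun μ ν => ?_
    have h3 := hasDerivWithinAt_linear_comp ((hsLinear (D μ)).restrictScalars ℝ)
      ((h1.mul_const (D ν)).mul h2)
    refine h3.congr_deriv ?_
    rw [hgen, neg_one_smul, Matrix.neg_mul, Matrix.neg_apply, Matrix.mul_apply]
    simp only [conjMatrix, Matrix.of_apply]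
    rw [sum_hamMatrix_mul hD]
    change hs (D μ)
      ((Complex.I • W) * U t * D ν * (U t)ᴴ + U t * D ν * ((Complex.I • W) * U t)ᴴ) = _
    rw [Matrix.conjTranspose_mul, Matrix.conjTranspose_smul, hWh]
    rw [neg_eq_neg_one_mul, ← hs_smul_right]
    congr 1
    simp only [Complex.star_def, Complex.conj_I, Matrix.smul_mul, Matrix.mul_smul, Matrix.mul_assoc]
    module
  · simp only [hU, coordinateHolonomy_zero, conjMatrix_one hD]

lemma IsNSFamily.hasDerivWithinAt_log_axNorm (h : IsNSFamily M 𝓛 S ϱ) (hM : IsOpen M)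
    (hγ : IsPath M γ) (κ : Fin b) {t : ℝ} (ht : t ∈ Icc (0 : ℝ) 1) :
    HasDerivWithinAt (fun r => Real.log (axNorm (ϱ κ) (γ r)))
      (∑ α, velocity γ α t * pd α (fun y => Real.log (axNorm (ϱ κ) y)) (γ t)) (Icc 0 1) t :=
  hγ.hasDerivWithinAt_comp ht
    (differentiableAt_of_contDiffOn hM (h.contDiffOn_log_axNorm (h.contDiff_ϱ κ)) (hγ.2 t ht))

lemma IsNSFamily.hasDerivWithinAt_integral_log_axNorm (h : IsNSFamily M 𝓛 S ϱ) (hM : IsOpen M)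
    (hγ : IsPath M γ) (κ : Fin b) {t : ℝ} (ht : t ∈ Icc (0 : ℝ) 1) :
    HasDerivWithinAt (fun s => ∫ r in (0 : ℝ)..s, ∑ α, velocity γ α r *
        pd α (fun y => Real.log (axNorm (ϱ κ) y)) (γ r))
      (∑ α, velocity γ α t * pd α (fun y => Real.log (axNorm (ϱ κ) y)) (γ t)) (Icc 0 1) t := by
  refine hasDerivWithinAt_primitive (continuousOn_finsetSum _ fun α _ => ?_) ht
  exact (hγ.continuousOn_velocity α).mul (hγ.continuousOn_comp
    (continuousOn_pd hM (h.contDiffOn_log_axNorm (h.contDiff_ϱ κ)) α))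

/-- The scalar factor of the holonomy is the ratio of the auxiliary norms at the two ends of the
path. -/
lemma IsNSFamily.exp_integral_eq (h : IsNSFamily M 𝓛 S ϱ) (hM : IsOpen M) (hγ : IsPath M γ)
    (κ : Fin b) {s : ℝ} (hs : s ∈ Icc (0 : ℝ) 1) :
    Real.exp (∫ r in (0 : ℝ)..s, ∑ α, velocity γ α r *
        pd α (fun y => Real.log (axNorm (ϱ κ) y)) (γ r)) =
      axNorm (ϱ κ) (γ s) / axNorm (ϱ κ) (γ 0) := by
  have h0 : (0 : ℝ) ∈ Icc (0 : ℝ) 1 := ⟨le_rfl, zero_le_one⟩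
  have h1 := ode_unique_unitInterval (C := 0)
    (v := fun t _ => ∑ α, velocity γ α t * pd α (fun y => Real.log (axNorm (ϱ κ) y)) (γ t))
    (by simp) (fun t ht => h.hasDerivWithinAt_integral_log_axNorm hM hγ κ ht)
    (fun t ht => (h.hasDerivWithinAt_log_axNorm hM hγ κ ht).sub_const
      (Real.log (axNorm (ϱ κ) (γ 0)))) (by simp) s hs
  rw [h1, Real.exp_sub, Real.exp_log (h.axNorm_pos (hγ.2 s hs) κ),
    Real.exp_log (h.axNorm_pos (hγ.2 0 h0) κ)]

/-- The assembly of diagonal blocks is linear. -/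
def blockDiagonalLinear (e : Fin b → ℕ) :
    (∀ κ, Matrix (Fin (e κ)) (Fin (e κ)) ℂ) →ₗ[ℂ]
      Matrix (Σ κ : Fin b, Fin (e κ)) (Σ κ : Fin b, Fin (e κ)) ℂ where
  toFun := Matrix.blockDiagonal'
  map_add' := Matrix.blockDiagonal'_add
  map_smul' c Y := Matrix.blockDiagonal'_smul c Y

/-- The scalar part of the connection commutes with the rest, so it splits off as an exponential
factor on each block. -/
lemma IsNSFamily.coordinateHolonomy_eq (h : IsNSFamily M 𝓛 S ϱ) (hB : IsHermitianBasis B)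
    (hM : IsOpen M) (hL : ∀ x ∈ M, IsLindbladian (𝓛 x)) (hst : ∀ x ∈ M, IsSteady (𝓛 x))
    (hdiff : ContDiffOn ℝ 1 (fun x => asymptoticProjection (𝓛 x)) M)
    {J : (Fin m → ℝ) → (Σ κ : Fin b, Fin (d κ ^ 2)) → Matrix n n ℂ}
    (hJ : ∀ x ∈ M, IsConservedDual (𝓛 x) (nsBasis S ϱ B x) (J x)) (hγ : IsPath M γ) {s : ℝ}
    (hs : s ∈ Icc (0 : ℝ) 1) :
    coordinateHolonomy (-1) (adiabaticConnection J (nsBasis S ϱ B)) γ s =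
      Matrix.blockDiagonal' (fun κ =>
        (Real.exp (∫ r in (0 : ℝ)..s, ∑ α, velocity γ α r *
          pd α (fun y => Real.log (axNorm (ϱ κ) y)) (γ r)) : ℂ) •
        coordinateHolonomy (-1) (dfsConnection S ϱ B κ) γ s) := by
  have hA := continuousOn_adiabaticConnection hM hL hst hdiff (fun x hx => h.isSteadyBasis hB hx)
    h.contDiffOn_nsBasis hJ
  set g : Fin b → ℝ → ℝ := fun κ r => ∑ α, velocity γ α r *
    pd α (fun y => Real.log (axNorm (ϱ κ) y)) (γ r) with hg
  set V : ∀ κ, ℝ → Matrix (Fin (d κ ^ 2)) (Fin (d κ ^ 2)) ℂ := fun κ =>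
    coordinateHolonomy (-1) (dfsConnection S ϱ B κ) γ with hV
  set e : Fin b → ℝ → ℝ := fun κ t => Real.exp (∫ r in (0 : ℝ)..t, g κ r) with he
  have hX : ∀ t, blockDiagonalLinear (fun κ => d κ ^ 2) (fun κ => e κ t • V κ t) =
      Matrix.blockDiagonal' (fun κ => (e κ t : ℂ) • V κ t) := fun t => rfl
  refine Eq.trans ?_ (hX s)
  refine (eq_pathOrderedExp (X := fun t => blockDiagonalLinear (fun κ => d κ ^ 2)
    (fun κ => e κ t • V κ t)) (hγ.continuousOn_generator (-1) hA) (fun t ht => ?_) ?_ s hs).symm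
  · set K : ∀ κ, Matrix (Fin (d κ ^ 2)) (Fin (d κ ^ 2)) ℂ := fun κ =>
      (-1 : ℂ) • ∑ α, (velocity γ α t : ℂ) • dfsConnection S ϱ B κ α (γ t) with hK
    have hVd : ∀ κ, HasDerivWithinAt (V κ) (K κ * V κ t) (Icc 0 1) t := fun κ =>
      hasDerivWithinAt_coordinateHolonomy hγ (-1) (h.continuousOn_dfsConnection hM κ) ht
    have hed : ∀ κ, HasDerivWithinAt (e κ) (e κ t * g κ t) (Icc 0 1) t := fun κ =>
      (h.hasDerivWithinAt_integral_log_axNorm hM hγ κ ht).exp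
    have hpi : HasDerivWithinAt (fun r κ => e κ r • V κ r)
        (fun κ => e κ t • (K κ * V κ t) + (e κ t * g κ t) • V κ t) (Icc 0 1) t :=
      hasDerivWithinAt_pi.2 fun κ => (hed κ).smul (hVd κ)
    refine (hasDerivWithinAt_linear_comp
      ((blockDiagonalLinear fun κ => d κ ^ 2).restrictScalars ℝ) hpi).congr_deriv ?_
    have hgen : (-1 : ℂ) • ∑ α, (velocity γ α t : ℂ) •
        adiabaticConnection J (nsBasis S ϱ B) α (γ t) =
          blockDiagonalLinear (fun κ => d κ ^ 2) fun κ => K κ + (g κ t : ℂ) • 1 := by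
      have h1 : ∀ α, adiabaticConnection J (nsBasis S ϱ B) α (γ t) =
          blockDiagonalLinear (fun κ => d κ ^ 2) fun κ => dfsConnection S ϱ B κ α (γ t) +
            (axConnection (ϱ κ) α (γ t) : ℂ) • 1 := fun α => by
        rw [h.adiabaticConnection_eq hB hM hL hst hdiff hJ (hγ.2 t ht)]
        exact (Matrix.blockDiagonal'_add _ _).symm
      simp only [h1, ← map_smul, ← map_sum]
      congr 1
      funext κ
      simp only [Pi.smul_apply, Finset.sum_apply, hK, hg, axConnection, smul_add,
        Finset.sum_add_distrib, Complex.ofReal_sum, Complex.ofReal_mul, Complex.ofReal_neg,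
        Finset.sum_smul, Finset.smul_sum, smul_smul]
      congr 1
      refine Finset.sum_congr rfl fun α _ => ?_
      congr 1
      ring
    rw [hgen]
    refine Eq.trans ?_ (Matrix.blockDiagonal'_mul (fun κ => K κ + (g κ t : ℂ) • 1)
      fun κ => e κ t • V κ t)
    change Matrix.blockDiagonal'
      (fun κ => e κ t • (K κ * V κ t) + (e κ t * g κ t) • V κ t) = _
    congr 1
    funext κ
    rw [Matrix.add_mul, Matrix.mul_smul (K κ)]
    congr 1
    rw [Matrix.smul_mul, Matrix.one_mul, mul_comm, mul_smul]
    rfl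
  · change Matrix.blockDiagonal' (fun κ => e κ 0 • V κ 0) = 1
    have : (fun κ => e κ 0 • V κ 0) = 1 := by
      funext κ
      simp [he, hV, coordinateHolonomy_zero]
    rw [this, Matrix.blockDiagonal'_one]

/-- The decoherence-free factors evolve unitarily, by conjugation with the holonomy of `Ã`. -/
lemma IsNSFamily.dfsHolonomy (h : IsNSFamily M 𝓛 S ϱ) (hB : IsHermitianBasis B)
    (hM : IsOpen M) (hγ : IsPath M γ) {s : ℝ} (hs : s ∈ Icc (0 : ℝ) 1) (κ : Fin b) :
    coordinateHolonomy Complex.I (dfsHamiltonian S ϱ κ) γ s ∈ Matrix.unitaryGroup (Fin (d κ)) ℂ ∧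
    coordinateHolonomy (-1) (dfsConnection S ϱ B κ) γ s ∈
      Matrix.unitaryGroup (Fin (d κ ^ 2)) ℂ ∧
    coordinateHolonomy (-1) (dfsConnection S ϱ B κ) γ s =
      conjMatrix (B κ) (coordinateHolonomy Complex.I (dfsHamiltonian S ϱ κ) γ s) := by
  have h1 := coordinateHolonomy_mem_unitaryGroup hγ (h.continuousOn_dfsHamiltonian hM κ)
    (fun x hx α => h.dfsHamiltonian_isHermitian hM hx κ α) hs
  have h2 : coordinateHolonomy (-1) (dfsConnection S ϱ B κ) γ s =
      conjMatrix (B κ) (coordinateHolonomy Complex.I (dfsHamiltonian S ϱ κ) γ s) :=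
    coordinateHolonomy_hamMatrix (hB κ).2 hγ (h.continuousOn_dfsHamiltonian hM κ)
      (fun x hx α => h.dfsHamiltonian_isHermitian hM hx κ α) hs
  refine ⟨h1, ?_, h2⟩
  rw [h2]
  exact conjMatrix_mem_unitaryGroup (hB κ).2 h1

/-- In the operator form of the holonomy the ratio of auxiliary norms is absorbed by the
normalization of the basis, and only the unitary conjugation remains. -/
lemma IsNSFamily.operatorHolonomy_inFrame (h : IsNSFamily M 𝓛 S ϱ) (hB : IsHermitianBasis B)
    (hM : IsOpen M) (hL : ∀ x ∈ M, IsLindbladian (𝓛 x)) (hst : ∀ x ∈ M, IsSteady (𝓛 x))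
    (hdiff : ContDiffOn ℝ 1 (fun x => asymptoticProjection (𝓛 x)) M)
    {J : (Fin m → ℝ) → (Σ κ : Fin b, Fin (d κ ^ 2)) → Matrix n n ℂ}
    (hJ : ∀ x ∈ M, IsConservedDual (𝓛 x) (nsBasis S ϱ B x) (J x)) (hγ : IsPath M γ) {s : ℝ}
    (hs' : s ∈ Icc (0 : ℝ) 1) (X : ∀ κ, Matrix (Fin (d κ)) (Fin (d κ)) ℂ) :
    operatorHolonomy (fun x => asymptoticProjection (𝓛 x)) γ s
        (inFrame (S (γ 0)) (fun κ => X κ ⊗ₖ ϱ κ (γ 0))) =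
      inFrame (S (γ s)) (fun κ =>
        (coordinateHolonomy Complex.I (dfsHamiltonian S ϱ κ) γ s * X κ *
          (coordinateHolonomy Complex.I (dfsHamiltonian S ϱ κ) γ s)ᴴ) ⊗ₖ ϱ κ (γ s)) := by
  have h0 : γ 0 ∈ M := hγ.2 0 ⟨le_rfl, zero_le_one⟩
  have hn : ∀ κ, (axNorm (ϱ κ) (γ 0) : ℂ) ≠ 0 := fun κ =>
    Complex.ofReal_ne_zero.2 (h.axNorm_pos h0 κ).ne'
  rw [h.nsBasis_expand hB h0, h.nsBasis_expand hB (hγ.2 s hs'), map_sum]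
  simp only [map_smul, operatorHolonomy_basis hM hL hst hdiff (fun x hx => h.isSteadyBasis hB hx)
    h.contDiffOn_nsBasis hJ hγ hs', Finset.smul_sum, smul_smul]
  rw [Finset.sum_comm]
  refine Finset.sum_congr rfl fun i _ => ?_
  rw [← Finset.sum_smul]
  congr 1
  obtain ⟨κ, μ⟩ := i
  rw [h.coordinateHolonomy_eq hB hM hL hst hdiff hJ hγ hs', Fintype.sum_sigma,
    Finset.sum_eq_single κ]
  · simp only [Matrix.blockDiagonal'_apply_eq, Matrix.smul_apply, h.exp_integral_eq hM hγ κ hs',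
      (h.dfsHolonomy hB hM hγ hs' κ).2.2]
    generalize coordinateHolonomy Complex.I (dfsHamiltonian S ϱ κ) γ s = U
    have h1 : ∀ Z, hs (B κ μ) (U * Z * Uᴴ) = hs (Uᴴ * B κ μ * U) Z := fun Z => by
      rw [hs_mul_mul, Matrix.conjTranspose_conjTranspose]
    rw [h1, ← sum_hs_mul_hs (hB κ).2, Finset.mul_sum]
    refine Finset.sum_congr rfl fun ν _ => ?_
    rw [conjMatrix, Matrix.of_apply, h1, smul_eq_mul, Complex.ofReal_div]
    field_simp [hn κ]
  · intro κ' _ hκ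
    refine Finset.sum_eq_zero fun ν _ => ?_
    rw [Matrix.blockDiagonal'_apply_ne _ _ _ hκ.symm, mul_zero]
  · simp

/-- Around a closed path the auxiliary factors cancel and the holonomy is unitary. -/
lemma IsNSFamily.coordinateHolonomy_closed (h : IsNSFamily M 𝓛 S ϱ) (hB : IsHermitianBasis B)
    (hM : IsOpen M) (hL : ∀ x ∈ M, IsLindbladian (𝓛 x)) (hst : ∀ x ∈ M, IsSteady (𝓛 x))
    (hdiff : ContDiffOn ℝ 1 (fun x => asymptoticProjection (𝓛 x)) M)
    {J : (Fin m → ℝ) → (Σ κ : Fin b, Fin (d κ ^ 2)) → Matrix n n ℂ}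
    (hJ : ∀ x ∈ M, IsConservedDual (𝓛 x) (nsBasis S ϱ B x) (J x)) (hγ : IsPath M γ)
    (hcl : γ 1 = γ 0) :
    coordinateHolonomy (-1) (adiabaticConnection J (nsBasis S ϱ B)) γ 1 =
      Matrix.blockDiagonal' (fun κ => coordinateHolonomy (-1) (dfsConnection S ϱ B κ) γ 1) ∧
    coordinateHolonomy (-1) (adiabaticConnection J (nsBasis S ϱ B)) γ 1 ∈
      Matrix.unitaryGroup (Σ κ : Fin b, Fin (d κ ^ 2)) ℂ := by
  have h1 : (1 : ℝ) ∈ Icc (0 : ℝ) 1 := ⟨zero_le_one, le_rfl⟩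
  have h2 : coordinateHolonomy (-1) (adiabaticConnection J (nsBasis S ϱ B)) γ 1 =
      Matrix.blockDiagonal' (fun κ => coordinateHolonomy (-1) (dfsConnection S ϱ B κ) γ 1) := by
    rw [h.coordinateHolonomy_eq hB hM hL hst hdiff hJ hγ h1]
    congr 1
    funext κ
    rw [h.exp_integral_eq hM hγ κ h1, hcl,
      div_self (h.axNorm_pos (hγ.2 0 ⟨le_rfl, zero_le_one⟩) κ).ne', Complex.ofReal_one, one_smul]
  refine ⟨h2, ?_⟩
  rw [h2, Matrix.mem_unitaryGroup_iff', Matrix.star_eq_conjTranspose,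
    Matrix.blockDiagonal'_conjTranspose, ← Matrix.blockDiagonal'_mul]
  have h3 : (fun κ => (coordinateHolonomy (-1) (dfsConnection S ϱ B κ) γ 1)ᴴ *
      coordinateHolonomy (-1) (dfsConnection S ϱ B κ) γ 1) = 1 := by
    funext κ
    exact Matrix.mem_unitaryGroup_iff'.1 (h.dfsHolonomy hB hM hγ h1 κ).2.1
  rw [h3, Matrix.blockDiagonal'_one]

end Holonomy

/-! ### The curvature of noiseless subsystems -/

section Curvature

variable {b : ℕ} {d a : Fin b → ℕ} {q : ℕ} {n : Type} [Fintype n] [DecidableEq n] {m : ℕ}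
  {M : Set (Fin m → ℝ)} {𝓛 : (Fin m → ℝ) → Superop n}
  {S : (Fin m → ℝ) → Matrix n (RefIndex d a q) ℂ}
  {ϱ : ∀ κ, (Fin m → ℝ) → Matrix (Fin (a κ)) (Fin (a κ)) ℂ}
  {B : ∀ κ, Fin (d κ ^ 2) → Matrix (Fin (d κ)) (Fin (d κ)) ℂ}

/-- The curvature of the superoperators `-i[A_α, ·]` is represented by the curvature of the
`A_α`. -/
lemma curvature_hamMatrix {k : ℕ} {D : Fin (k ^ 2) → Matrix (Fin k) (Fin k) ℂ}
    (hD : ∀ μ ν, hs (D μ) (D ν) = if μ = ν then 1 else 0)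
    {A : Fin m → (Fin m → ℝ) → Matrix (Fin k) (Fin k) ℂ} {x : Fin m → ℝ}
    (hA : ∀ α, DifferentiableAt ℝ (A α) x) (α β : Fin m) :
    curvature 1 (fun α x => hamMatrix D (A α x)) α β x =
      hamMatrix D (curvature (-Complex.I) A α β x) := by
  have h1 : ∀ α β, pd α (fun x => hamMatrix D (A β x)) x = hamMatrixLinear D (pd α (A β) x) :=
    fun α β => (pd_linear_comp ((hamMatrixLinear D).restrictScalars ℝ) (hA β) α).2
  rw [curvature, h1, h1, one_smul, hamMatrix_commutator hD, ← hamMatrixLinear_apply,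
    ← hamMatrixLinear_apply, ← map_sub, ← map_add, curvature]

lemma pd_comm {f : (Fin m → ℝ) → ℝ} (hM : IsOpen M) (hf : ContDiffOn ℝ 2 f M) {x : Fin m → ℝ}
    (hx : x ∈ M) (α β : Fin m) : pd α (pd β f) x = pd β (pd α f) x := by
  have hd : DifferentiableAt ℝ (fderiv ℝ f) x := differentiableAt_of_contDiffOn hM
    (hf.fderiv_of_isOpen hM (by norm_num)) hx
  have h1 : ∀ α β, pd α (pd β f) x = fderiv ℝ (fderiv ℝ f) x (Pi.single α 1) (Pi.single β 1) := by
    intro α β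
    have h2 := (hd.hasFDerivAt.clm_apply (hasFDerivAt_const (Pi.single β (1 : ℝ)) x)).fderiv
    refine (congrArg (fun T => T (Pi.single α (1 : ℝ))) h2).trans ?_
    simp
  rw [h1, h1]
  exact (hf.contDiffAt (hM.mem_nhds hx)).isSymmSndFDerivAt (by simp) _ _

lemma pd_blockDiagonal' {e : Fin b → ℕ} {F : ∀ κ, (Fin m → ℝ) → Matrix (Fin (e κ)) (Fin (e κ)) ℂ}
    {x : Fin m → ℝ} (hF : ∀ κ, DifferentiableAt ℝ (F κ) x) (α : Fin m) :
    pd α (fun y => Matrix.blockDiagonal' fun κ => F κ y) x =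
      Matrix.blockDiagonal' fun κ => pd α (F κ) x := by
  have h1 : HasFDerivAt (fun y κ => F κ y) (ContinuousLinearMap.pi fun κ => fderiv ℝ (F κ) x) x :=
    hasFDerivAt_pi.2 fun κ => (hF κ).hasFDerivAt
  have h2 := (pd_linear_comp ((blockDiagonalLinear e).restrictScalars ℝ) h1.differentiableAt α).2
  refine h2.trans ?_
  rw [pd, h1.fderiv]
  rfl

/-- The scalar part `-∂_α ln n_κ` of the connection is central and closed, so only the connection
`-i[Ã, ·]` contributes to the curvature. -/
lemma IsNSFamily.curvature_eq (h : IsNSFamily M 𝓛 S ϱ) (hB : IsHermitianBasis B)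
    (hM : IsOpen M) (hL : ∀ x ∈ M, IsLindbladian (𝓛 x)) (hst : ∀ x ∈ M, IsSteady (𝓛 x))
    (hdiff : ContDiffOn ℝ 1 (fun x => asymptoticProjection (𝓛 x)) M)
    {J : (Fin m → ℝ) → (Σ κ : Fin b, Fin (d κ ^ 2)) → Matrix n n ℂ}
    (hJ : ∀ x ∈ M, IsConservedDual (𝓛 x) (nsBasis S ϱ B x) (J x))
    (hS : ContDiffOn ℝ 2 S M) (hr : ∀ κ, ContDiffOn ℝ 2 (ϱ κ) M) {x : Fin m → ℝ} (hx : x ∈ M)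
    (α β : Fin m) :
    curvature 1 (adiabaticConnection J (nsBasis S ϱ B)) α β x =
      Matrix.blockDiagonal' (fun κ => curvature 1 (dfsConnection S ϱ B κ) α β x) ∧
    ∀ κ, curvature 1 (dfsConnection S ϱ B κ) α β x =
      hamMatrix (B κ) (curvature (-Complex.I) (dfsHamiltonian S ϱ κ) α β x) := by
  have hHd : ∀ κ α, DifferentiableAt ℝ (dfsHamiltonian S ϱ κ α) x := fun κ α =>
    differentiableAt_of_contDiffOn hM (contDiffOn_dfsHamiltonian h.contDiff_S
      (contDiffOn_pd hM hS (by norm_num) α) (h.contDiff_ϱ κ)) hx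
  refine ⟨?_, fun κ => curvature_hamMatrix (hB κ).2 (hHd κ) α β⟩
  have hdfs : ∀ κ α, DifferentiableAt ℝ (dfsConnection S ϱ B κ α) x := fun κ α =>
    (pd_linear_comp ((hamMatrixLinear (B κ)).restrictScalars ℝ) (hHd κ α) α).1
  have hax : ∀ κ α, DifferentiableAt ℝ (axConnection (ϱ κ) α) x := fun κ α =>
    differentiableAt_of_contDiffOn hM
      (contDiffOn_pd hM (h.contDiffOn_log_axNorm (hr κ)) (by norm_num) α).neg hx
  have hclosed : ∀ κ, pd α (axConnection (ϱ κ) β) x = pd β (axConnection (ϱ κ) α) x := by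
    intro κ
    have h1 : ∀ α β, pd α (axConnection (ϱ κ) β) x =
        -pd α (pd β fun y => Real.log (axNorm (ϱ κ) y)) x := fun α β =>
      congrArg (fun T : (Fin m → ℝ) →L[ℝ] ℝ => T (Pi.single α 1)) fderiv_fun_neg
    rw [h1, h1, pd_comm hM (h.contDiffOn_log_axNorm (hr κ)) hx]
  set F : ∀ κ, Fin m → (Fin m → ℝ) → Matrix (Fin (d κ ^ 2)) (Fin (d κ ^ 2)) ℂ := fun κ α y =>
    dfsConnection S ϱ B κ α y + axConnection (ϱ κ) α y • 1 with hF
  have hA : ∀ α, ∀ y ∈ M, adiabaticConnection J (nsBasis S ϱ B) α y =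
      Matrix.blockDiagonal' fun κ => F κ α y := fun α y hy => by
    rw [h.adiabaticConnection_eq hB hM hL hst hdiff hJ hy]
    exact (Matrix.blockDiagonal'_add _ _).symm
  have hFd : ∀ κ α β, DifferentiableAt ℝ (F κ β) x ∧ pd α (F κ β) x =
      pd α (dfsConnection S ϱ B κ β) x + pd α (axConnection (ϱ κ) β) x • 1 := by
    intro κ α β
    have h1 := pd_linear_comp (LinearMap.toSpanSingleton ℝ
      (Matrix (Fin (d κ ^ 2)) (Fin (d κ ^ 2)) ℂ) 1) (hax κ β) α
    refine ⟨(hdfs κ β).add h1.1, ?_⟩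
    refine Eq.trans (congrArg (fun T => T (Pi.single α (1 : ℝ)))
      (fderiv_fun_add (hdfs κ β) h1.1)) ?_
    exact congrArg (fun T => pd α (dfsConnection S ϱ B κ β) x + T) h1.2
  have hpd : ∀ α β, pd α (adiabaticConnection J (nsBasis S ϱ B) β) x =
      Matrix.blockDiagonal' fun κ => pd α (F κ β) x := fun α β => by
    rw [pd_congr hM (hA β) hx, pd_blockDiagonal' fun κ => (hFd κ α β).1]
  rw [curvature, hpd, hpd, hA α x hx, hA β x hx, ← Matrix.blockDiagonal'_mul,
    ← Matrix.blockDiagonal'_mul, ← Matrix.blockDiagonal'_sub, ← Matrix.blockDiagonal'_sub,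
    one_smul, ← Matrix.blockDiagonal'_add]
  congr 1
  funext κ
  simp only [Pi.add_apply, Pi.sub_apply]
  rw [(hFd κ α β).2, (hFd κ β α).2, hclosed κ]
  simp only [hF, curvature, one_smul,
    Matrix.add_mul, Matrix.mul_add, Matrix.smul_mul, Matrix.mul_smul, Matrix.one_mul,
    Matrix.mul_one]
  module

end Curvature

end LindbladHolonomy

end

open LindbladHolonomy in
theorem mainTheorem6 {n : Type} [Fintype n] [DecidableEq n] {m : ℕ}
    (M : Set (Fin m → ℝ)) (hM : IsOpen M)
    (𝓛 : (Fin m → ℝ) → Superop n)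
    (hLind : ∀ x ∈ M, IsLindbladian (𝓛 x))
    (hsteady : ∀ x ∈ M, IsSteady (𝓛 x))
    (hdiff : ContDiffOn ℝ 1 (fun x => asymptoticProjection (𝓛 x)) M) :
    -- conserved quantities exist and are unique, and the projections are the expected dyadic sums
    (∀ x ∈ M, ∀ (ι : Type) [Fintype ι] [DecidableEq ι] (Ψ : ι → Matrix n n ℂ),
      IsSteadyBasis (𝓛 x) Ψ →
        (∃! J : ι → Matrix n n ℂ, IsConservedDual (𝓛 x) Ψ J) ∧
        ∀ J : ι → Matrix n n ℂ, IsConservedDual (𝓛 x) Ψ J → ∀ ρ : Matrix n n ℂ,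
          asymptoticProjection (𝓛 x) ρ = ∑ μ, hs (J μ) ρ • Ψ μ ∧
          minimalProjection (𝓛 x) ρ = ∑ μ, hs (upperLeft (𝓛 x) (J μ)) ρ • Ψ μ) ∧
    -- the connection only sees the upper-left part of the conserved quantities, and the coordinate
    -- and operator forms of the holonomy agree
    (∀ (ι : Type) [Fintype ι] [DecidableEq ι] (Ψ J : (Fin m → ℝ) → ι → Matrix n n ℂ),
      (∀ x ∈ M, IsSteadyBasis (𝓛 x) (Ψ x)) →
      (∀ μ, ContDiffOn ℝ 1 (fun x => Ψ x μ) M) →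
      (∀ x ∈ M, IsConservedDual (𝓛 x) (Ψ x) (J x)) →
        (∀ x ∈ M, ∀ α, adiabaticConnection J Ψ α x =
          adiabaticConnection (fun y μ => upperLeft (𝓛 y) (J y μ)) Ψ α x) ∧
        ∀ γ, IsPath M γ → ∀ s ∈ Set.Icc (0 : ℝ) 1, ∀ ν,
          operatorHolonomy (fun x => asymptoticProjection (𝓛 x)) γ s (Ψ (γ 0) ν) =
            ∑ μ, coordinateHolonomy (-1) (adiabaticConnection J Ψ) γ s μ ν • Ψ (γ s) μ) ∧
    -- the holonomy depends only on the minimal projection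
    (ContDiffOn ℝ 1 (fun x => minimalProjection (𝓛 x)) M →
      ∀ γ, IsPath M γ → ∀ s ∈ Set.Icc (0 : ℝ) 1, ∀ ρ ∈ asymptoticSubspace (𝓛 (γ 0)),
        operatorHolonomy (fun x => asymptoticProjection (𝓛 x)) γ s ρ =
          operatorHolonomy (fun x => minimalProjection (𝓛 x)) γ s ρ) ∧
    -- noiseless-subsystem blocks
    (∀ (b : ℕ) (d a : Fin b → ℕ) (q : ℕ)
      (S : (Fin m → ℝ) → Matrix n (RefIndex d a q) ℂ)
      (ϱ : ∀ κ, (Fin m → ℝ) → Matrix (Fin (a κ)) (Fin (a κ)) ℂ)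
      (B : ∀ κ, Fin (d κ ^ 2) → Matrix (Fin (d κ)) (Fin (d κ)) ℂ),
      IsNSFamily M 𝓛 S ϱ → IsHermitianBasis B →
        (∀ x ∈ M, IsSteadyBasis (𝓛 x) (nsBasis S ϱ B x) ∧
          ∀ ρ : Matrix n n ℂ, minimalProjection (𝓛 x) ρ =
            inFrame (S x) (fun κ =>
              traceAx κ (blockOp (q := q) (Pi.single κ
                ((1 : Matrix (Fin (d κ)) (Fin (d κ)) ℂ) ⊗ₖ rangeProj (ϱ κ x))) *
                ((S x)ᴴ * ρ * S x)) ⊗ₖ ϱ κ x)) ∧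
        (∀ x ∈ M, ∀ κ α, (dfsHamiltonian S ϱ κ α x).IsHermitian) ∧
        ∀ J : (Fin m → ℝ) → (Σ κ : Fin b, Fin (d κ ^ 2)) → Matrix n n ℂ,
          (∀ x ∈ M, IsConservedDual (𝓛 x) (nsBasis S ϱ B x) (J x)) →
          -- the connection
          (∀ x ∈ M, ∀ α, adiabaticConnection J (nsBasis S ϱ B) α x =
            Matrix.blockDiagonal' (fun κ => dfsConnection S ϱ B κ α x) +
            Matrix.blockDiagonal' (fun κ => (axConnection (ϱ κ) α x : ℂ) •
              (1 : Matrix (Fin (d κ ^ 2)) (Fin (d κ ^ 2)) ℂ))) ∧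
          -- the holonomy
          (∀ γ, IsPath M γ →
            (∀ s ∈ Set.Icc (0 : ℝ) 1,
              (∀ κ,
                coordinateHolonomy Complex.I (dfsHamiltonian S ϱ κ) γ s ∈
                  Matrix.unitaryGroup (Fin (d κ)) ℂ ∧
                coordinateHolonomy (-1) (dfsConnection S ϱ B κ) γ s ∈
                  Matrix.unitaryGroup (Fin (d κ ^ 2)) ℂ ∧
                coordinateHolonomy (-1) (dfsConnection S ϱ B κ) γ s =
                  conjMatrix (B κ) (coordinateHolonomy Complex.I (dfsHamiltonian S ϱ κ) γ s)) ∧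
              coordinateHolonomy (-1) (adiabaticConnection J (nsBasis S ϱ B)) γ s =
                Matrix.blockDiagonal' (fun κ =>
                  (Real.exp (∫ r in (0 : ℝ)..s, ∑ α, velocity γ α r *
                    pd α (fun y => Real.log (axNorm (ϱ κ) y)) (γ r)) : ℂ) •
                  coordinateHolonomy (-1) (dfsConnection S ϱ B κ) γ s) ∧
              (∀ κ, Real.exp (∫ r in (0 : ℝ)..s, ∑ α, velocity γ α r *
                  pd α (fun y => Real.log (axNorm (ϱ κ) y)) (γ r)) =
                axNorm (ϱ κ) (γ s) / axNorm (ϱ κ) (γ 0)) ∧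
              ∀ X : ∀ κ, Matrix (Fin (d κ)) (Fin (d κ)) ℂ,
                operatorHolonomy (fun x => asymptoticProjection (𝓛 x)) γ s
                  (inFrame (S (γ 0)) (fun κ => X κ ⊗ₖ ϱ κ (γ 0))) =
                inFrame (S (γ s)) (fun κ =>
                  (coordinateHolonomy Complex.I (dfsHamiltonian S ϱ κ) γ s * X κ *
                    (coordinateHolonomy Complex.I (dfsHamiltonian S ϱ κ) γ s)ᴴ) ⊗ₖ
                    ϱ κ (γ s))) ∧
            (γ 1 = γ 0 →
              coordinateHolonomy (-1) (adiabaticConnection J (nsBasis S ϱ B)) γ 1 =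
                Matrix.blockDiagonal' (fun κ =>
                  coordinateHolonomy (-1) (dfsConnection S ϱ B κ) γ 1) ∧
              coordinateHolonomy (-1) (adiabaticConnection J (nsBasis S ϱ B)) γ 1 ∈
                Matrix.unitaryGroup (Σ κ : Fin b, Fin (d κ ^ 2)) ℂ)) ∧
          -- the curvature
          (ContDiffOn ℝ 2 S M → (∀ κ, ContDiffOn ℝ 2 (ϱ κ) M) → ∀ x ∈ M, ∀ α β,
            curvature 1 (adiabaticConnection J (nsBasis S ϱ B)) α β x =
              Matrix.blockDiagonal' (fun κ => curvature 1 (dfsConnection S ϱ B κ) α β x) ∧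
            ∀ κ, curvature 1 (dfsConnection S ϱ B κ) α β x =
              hamMatrix (B κ) (curvature (-Complex.I) (dfsHamiltonian S ϱ κ) α β x))) := by
  refine ⟨fun x hx ι _ _ Ψ hΨ => ⟨hΨ.existsUnique_dual (hLind x hx) (hsteady x hx),
      fun J hJ ρ => ⟨hJ.asymptoticProjection_eq (hLind x hx) (hsteady x hx) hΨ ρ,
        hJ.minimalProjection_eq (hLind x hx) (hsteady x hx) hΨ ρ⟩⟩,
    fun ι _ _ Ψ J hΨ hΨd hJ =>
      ⟨fun x hx α => adiabaticConnection_upperLeft hM hLind hsteady hdiff hΨ hΨd hJ hx α,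
        fun γ hγ s hs ν => operatorHolonomy_basis hM hLind hsteady hdiff hΨ hΨd hJ hγ hs ν⟩,
    fun hmin γ hγ s hs ρ hρ =>
      operatorHolonomy_minimalProjection hM hLind hsteady hdiff hmin hγ hs hρ,
    fun b d a q S ϱ B h hB =>
      ⟨fun x hx => ⟨h.isSteadyBasis hB hx,
          (h.frame hx).minimalProjection_eq (hLind x hx) (hsteady x hx)⟩,
        fun x hx κ α => h.dfsHamiltonian_isHermitian hM hx κ α,
        fun J hJ =>
          ⟨fun x hx α => h.adiabaticConnection_eq hB hM hLind hsteady hdiff hJ hx α,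
            fun γ hγ =>
              ⟨fun s hs =>
                ⟨h.dfsHolonomy hB hM hγ hs,
                  h.coordinateHolonomy_eq hB hM hLind hsteady hdiff hJ hγ hs,
                  fun κ => h.exp_integral_eq hM hγ κ hs,
                  h.operatorHolonomy_inFrame hB hM hLind hsteady hdiff hJ hγ hs⟩,
                h.coordinateHolonomy_closed hB hM hLind hsteady hdiff hJ hγ⟩,
            fun hS hr x hx α β =>
              h.curvature_eq hB hM hLind hsteady hdiff hJ hS hr hx α β⟩⟩⟩
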